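/- Let $n\ge 3$ and let $V\in L^\infty(\mathbb{R}^n)$ be real-valued with $|V(x)|\le C_0\langle x\rangle^{-\delta}$ for almost every $x\in\mathbb{R}^n$, for some constants $C_0$ and $\delta>3$, where $\langle x\rangle=(1+|x|^2)^{1/2}$. For $h>0$ let $P(h)=-h^2\Delta+V$ be the Schrödinger operator on $L^2(\mathbb{R}^n)$ with domain the Sobolev space $H^2(\mathbb{R}^n)$, where $\Delta=\sum_{j}\partial_{x_j}^2$. Fix an energy $E>0$ and $s>1/2$. Then there are constants $C>0$ and $h_0>0$ such that for all $0<h\le h_0$, all $0<\varepsilon<1$ and both choices of the sign $\pm$, the operator $P(h)-E\pm i\varepsilon:H^2(\mathbb{R}^n)\to L^2(\mathbb{R}^n)$ has a bounded inverse on $L^2(\mathbb{R}^n)$, and $$\log\left\|\langle x\rangle^{-s}(P(h)-E\pm i\varepsilon)^{-1}\langle x\rangle^{-s}\right\|_{L^2(\mathbb{R}^n)\to L^2(\mathbb{R}^n)}\le C h^{-4/3}\log(1/h).$$ In particular $C$ and $h_0$ do not depend on $h$, $\varepsilon$ or the sign. -/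

import Mathlib

open MeasureTheory TemperedDistribution
open scoped ENNReal SchwartzMap Laplacian

noncomputable section

namespace SemiclassicalResolvent

/-- Euclidean space `ℝⁿ`. -/
abbrev RSpace (n : ℕ) : Type := EuclideanSpace ℝ (Fin n)

/-- The complex Hilbert space `L²(ℝⁿ)`, with respect to Lebesgue measure. -/
abbrev L2 (n : ℕ) : Type := Lp ℂ 2 (volume : Measure (RSpace n))

/-- The bracket `⟨x⟩ = (1 + |x|²)^{1/2}`. -/
def bracket {n : ℕ} (x : RSpace n) : ℝ := Real.sqrt (1 + ‖x‖ ^ 2)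

/-- Multiplication by a function `g ∈ L^∞(ℝⁿ)`, as a bounded operator on `L²(ℝⁿ)`. -/
def mulOp {n : ℕ} (g : RSpace n → ℂ) (hg : MemLp g ∞ volume) : L2 n →L[ℂ] L2 n :=
  (ContinuousLinearMap.mul ℂ ℂ).holderL volume ∞ 2 2 hg.toLp

theorem mulOp_coeFn {n : ℕ} (g : RSpace n → ℂ) (hg : MemLp g ∞ volume) (u : L2 n) :
    (mulOp g hg u : RSpace n → ℂ) =ᵐ[volume] fun x => g x * u x := by
  have h1 := (ContinuousLinearMap.mul ℂ ℂ).coeFn_holder (r := 2) hg.toLp u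
  filter_upwards [h1, hg.coeFn_toLp] with x hx hx'
  rw [← hx', ← ContinuousLinearMap.mul_apply' ℂ ℂ, ← hx]
  rfl

theorem memLp_bracket_rpow_neg (n : ℕ) {s : ℝ} (hs : 0 ≤ s) :
    MemLp (fun x : RSpace n => ((bracket x ^ (-s) : ℝ) : ℂ)) ∞ volume := by
  have hpos : ∀ x : RSpace n, 0 < bracket x := fun x => Real.sqrt_pos.2 (by positivity)
  refine memLp_top_of_bound (Continuous.aestronglyMeasurable ?_) 1 (Filter.Eventually.of_forall ?_)
  · refine Complex.continuous_ofReal.comp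
      (Continuous.rpow_const ?_ fun x => Or.inl (hpos x).ne')
    unfold bracket
    fun_prop
  · intro x
    have h1 : 1 ≤ bracket x := Real.one_le_sqrt.2 (by nlinarith [sq_nonneg ‖x‖])
    rw [Complex.norm_real, Real.norm_eq_abs, abs_of_nonneg (Real.rpow_nonneg (hpos x).le _)]
    exact Real.rpow_le_one_of_one_le_of_nonpos h1 (by linarith)

/-- The bounded operator of multiplication by the weight `⟨x⟩^{-s}`, `s ≥ 0`, on `L²(ℝⁿ)`. -/
def weightOp (n : ℕ) (s : ℝ) (hs : 0 ≤ s) : L2 n →L[ℂ] L2 n :=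
  mulOp (fun x => ((bracket x ^ (-s) : ℝ) : ℂ)) (memLp_bracket_rpow_neg n hs)

/-- The bounded operator of multiplication by a real-valued potential `V ∈ L^∞(ℝⁿ)`. -/
def potentialOp {n : ℕ} (V : RSpace n → ℝ) (hV : MemLp V ∞ volume) : L2 n →L[ℂ] L2 n :=
  mulOp (fun x => ((V x : ℝ) : ℂ)) hV.ofReal

/-- The Sobolev space `H²(ℝⁿ)`, as a subspace of `L²(ℝⁿ)`. -/
def H2 (n : ℕ) : Submodule ℂ (L2 n) where
  carrier := {u | MemSobolev 2 2 (u : 𝓢'(RSpace n, ℂ))}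
  zero_mem' := by
    have h := memSobolev_fun_zero (RSpace n) ℂ 2 2
    rwa [← map_zero (Lp.toTemperedDistributionCLM ℂ (volume : Measure (RSpace n)) 2)] at h
  add_mem' {u v} hu hv := by
    have h := MemSobolev.add hu hv
    rwa [← Lp.toTemperedDistributionCLM_apply u, ← Lp.toTemperedDistributionCLM_apply v,
      ← map_add] at h
  smul_mem' c u hu := by
    have h := MemSobolev.smul c hu
    rwa [← Lp.toTemperedDistributionCLM_apply u, ← map_smul] at h

/-- The distributional Laplacian of an `H²` function is an `L²` function. -/
theorem exists_laplacian {n : ℕ} (u : H2 n) :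
    ∃ w : L2 n, (w : 𝓢'(RSpace n, ℂ)) = Δ ((u : L2 n) : 𝓢'(RSpace n, ℂ)) := by
  have h : MemSobolev (2 - 2) 2 (Δ ((u : L2 n) : 𝓢'(RSpace n, ℂ))) := MemSobolev.laplacian u.2
  rw [sub_self] at h
  obtain ⟨w, hw⟩ := memSobolev_zero_iff.1 h
  exact ⟨w, hw.symm⟩

theorem toTemperedDistribution_injective {n : ℕ} {u v : L2 n}
    (h : (u : 𝓢'(RSpace n, ℂ)) = (v : 𝓢'(RSpace n, ℂ))) : u = v :=
  LinearMap.ker_eq_bot.1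
    (Lp.ker_toTemperedDistributionCLM_eq_bot (F := ℂ) (μ := (volume : Measure (RSpace n))) (p := 2))
    h

/-- The distributional Laplacian `Δ = ∑ ∂ⱼ²`, as a linear map from `H²(ℝⁿ)` to `L²(ℝⁿ)`. -/
def laplacianH2 (n : ℕ) : H2 n →ₗ[ℂ] L2 n where
  toFun u := (exists_laplacian u).choose
  map_add' u v := by
    apply toTemperedDistribution_injective
    rw [(exists_laplacian (u + v)).choose_spec]
    simp only [← Lp.toTemperedDistributionCLM_apply, Submodule.coe_add, map_add]
    simp only [← laplacianCLM_apply, map_add]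
    simp only [laplacianCLM_apply, Lp.toTemperedDistributionCLM_apply]
    rw [(exists_laplacian u).choose_spec, (exists_laplacian v).choose_spec]
  map_smul' c u := by
    apply toTemperedDistribution_injective
    rw [(exists_laplacian (c • u)).choose_spec]
    simp only [← Lp.toTemperedDistributionCLM_apply, Submodule.coe_smul, map_smul,
      RingHom.id_apply]
    simp only [← laplacianCLM_apply, map_smul]
    simp only [laplacianCLM_apply, Lp.toTemperedDistributionCLM_apply]
    rw [(exists_laplacian u).choose_spec]

theorem laplacianH2_spec {n : ℕ} (u : H2 n) :
    ((laplacianH2 n u : L2 n) : 𝓢'(RSpace n, ℂ)) = Δ ((u : L2 n) : 𝓢'(RSpace n, ℂ)) :=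
  (exists_laplacian u).choose_spec

/-- The Schrödinger operator `P(h) = -h²Δ + V` on `L²(ℝⁿ)`, with domain `H²(ℝⁿ)`. -/
def schrodinger {n : ℕ} (h : ℝ) (V : RSpace n → ℝ) (hV : MemLp V ∞ volume) :
    L2 n →ₗ.[ℂ] L2 n where
  domain := H2 n
  toFun := -((h : ℂ) ^ 2 • laplacianH2 n) + (potentialOp V hV).toLinearMap ∘ₗ (H2 n).subtype

/-- The operator `A + z`, with the domain of `A`. -/
def shift {n : ℕ} (A : L2 n →ₗ.[ℂ] L2 n) (z : ℂ) : L2 n →ₗ.[ℂ] L2 n where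
  domain := A.domain
  toFun := A.toFun + z • A.domain.subtype

/-- `R` is the everywhere defined bounded inverse `A⁻¹` of the unbounded operator `A`. -/
def IsBoundedInverse {n : ℕ} (A : L2 n →ₗ.[ℂ] L2 n) (R : L2 n →L[ℂ] L2 n) : Prop :=
  (∀ f : L2 n, ∃ u : A.domain, (u : L2 n) = R f ∧ A u = f) ∧
    ∀ u : A.domain, R (A u) = (u : L2 n)

/-- A bounded inverse is unique. -/
theorem IsBoundedInverse.unique {n : ℕ} {A : L2 n →ₗ.[ℂ] L2 n} {R R' : L2 n →L[ℂ] L2 n}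
    (hR : IsBoundedInverse A R) (hR' : IsBoundedInverse A R') : R = R' := by
  ext1 f
  obtain ⟨u, hu, rfl⟩ := hR.1 f
  rw [hR.2, hR'.2]

end SemiclassicalResolvent

end

/-!
The bound is a global Carleman estimate, proved by one explicit multiplier identity with radial
weights. For a radial phase `φ` with `∇φ = ψ x` put `u = exp (φ / h) v`. Pairing the conjugated
equation with `a (x · ∇u + (n - 1) / 2 u)`, for a radial multiplier `a`, and integrating by parts
gives (`conjugated_identity`)

* a nonnegative kinetic form in `∇u`, as `|2 ρ a'| ≤ a` with `ρ = |x|²`;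
* the square `4 h ψ a (x · ∇u + (n - 1) / 2 u)²`, which absorbs the cross terms with the potential,
  with the second derivative of the phase and with the source;
* a zeroth order term whose main part is the radial derivative of `a (E + |∇φ|²)`.

No derivative of `V` enters: it is treated by the Cauchy-Schwarz inequality, at the price
`a V² / (h ψ)` in the zeroth order term. With `ψ = lam (1 + h² ρ)^(-η) / (√(ρ + τ²) ⟨x⟩)` the radial
derivative of `a |∇φ|²` contains a positive term that beats `a V² / (h ψ)` when `lam³ h ≳ 1` and
`|V| ≲ ⟨x⟩⁻³`; hence `lam ∼ h ^ (-1 / 3)`. Both the smoothing at scale `τ = h / (2 lam)` and the bump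
`τ / √(ρ + τ²)` in the multiplier deal with the origin, where the slope `lam / |x|` would be singular;
the bump has a favourable sign in dimension at least three. All other errors are `o(1)` relative to
the energy term, whence `coercivity`. As `|∇φ|` behaves like `lam / ⟨x⟩` between `h` and `1 / h`, the
phase is `O(lam log (1 / h))` (`phase_le`), so that the weight `exp (φ / h)` costs
`exp (C h ^ (-4 / 3) log (1 / h))`.

The identity is applied to the real and imaginary parts of Schwartz functions
(`carleman_schwartz`) and extended to `H²` by density in the graph norm (`exists_schwartz_tendsto`).
The terms with a factor `ε` that remain are controlled by the quadratic form of
`P(h) - E ± i ε` (`norm_weighted_resolvent_le`). Its imaginary part `± ε ‖u‖²` also gives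
injectivity, and with the method of continuity (`surjective_of_continuity`) the existence of the
bounded inverse.
-/

noncomputable section

namespace SemiclassicalResolvent

/-! ### Scalar inequalities for the multiplier and the phase

In this part `ρ = |x|²`, `q = ⟨x⟩`, `T = 1 + h² ρ`, `m = T ^ (-η)`, `z = √(ρ + τ²)`; the multiplier is
`q (2 - m) / T + τ / z` and the slope of the phase is `lam m / (z q)`. -/

/-- With `a₀ = q (2 - m) / T`, the radial derivative `a₀ + 2 ρ a₀'` dominates the gain
`y = q m / T`. -/
theorem main_weight_deriv_ge {η h ρ q m T : ℝ} (hη0 : 0 < η) (hη : η ≤ 1 / 2)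
    (hq0 : 0 < q) (hq : q ^ 2 = 1 + ρ) (hT : T = 1 + h ^ 2 * ρ) (hT1 : 1 ≤ T)
    (hTq : T ≤ q ^ 2) (hm1 : m ≤ 1) :
    2 * η * (q * m / T) ≤ q * (2 - m) / T +
      2 * ρ * ((2 - m) / (2 * q * T) + q * h ^ 2 * (-2 + (1 + η) * m) / T ^ 2) := by
  have hT0 : 0 < T := by linarith
  have key : 0 ≤ q ^ 2 * (4 - 2 * (1 + η) * m) - (2 - m) * T := by
    nlinarith [mul_nonneg (sub_nonneg.2 hTq) (by linarith : 0 ≤ 2 - m),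
      mul_nonneg (sq_nonneg q) (by nlinarith : 0 ≤ 2 - (1 + 2 * η) * m)]
  have e : q * (2 - m) / T +
      2 * ρ * ((2 - m) / (2 * q * T) + q * h ^ 2 * (-2 + (1 + η) * m) / T ^ 2)
      - 2 * η * (q * m / T) = (q ^ 2 * (4 - 2 * (1 + η) * m) - (2 - m) * T) / (q * T ^ 2) := by
    field_simp
    linear_combination (-(2-m)*T) * hq - 2 * q^2*(-2 + (1 + η) * m)*hT
  have : 0 ≤ (q ^ 2 * (4 - 2 * (1 + η) * m) - (2 - m) * T) / (q * T ^ 2) := by positivity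
  linarith

/-- The coefficient `a₀ - 2 ρ a₀'` of the angular part of the kinetic form is nonnegative. -/
theorem main_angular_nonneg {η h ρ q m T : ℝ} (hη : η ≤ 1 / 2) (hη0 : 0 < η)
    (hq0 : 0 < q) (hq : q ^ 2 = 1 + ρ) (hρ : 0 ≤ ρ) (hT1 : 1 ≤ T)
    (hm0 : 0 < m) (hm1 : m ≤ 1) :
    0 ≤ q * (2 - m) / T -
      2 * ρ * ((2 - m) / (2 * q * T) + q * h ^ 2 * (-2 + (1 + η) * m) / T ^ 2) := by
  have hT0 : 0 < T := by linarith
  have e : q * (2 - m) / T -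
      2 * ρ * ((2 - m) / (2 * q * T) + q * h ^ 2 * (-2 + (1 + η) * m) / T ^ 2)
      = (2 - m) / (q * T) + 2 * ρ * (q * h ^ 2 * (2 - (1 + η) * m) / T ^ 2) := by
    field_simp
    linear_combination (2-m)*T* hq
  have h2 : 0 ≤ 2 - (1 + η) * m := by nlinarith
  have h3 : 0 ≤ 2 - m := by linarith
  rw [e]; positivity

/-- The zeroth order term produced by `-h² Δ` acting on `a₀` is `O(h² y)`. -/
theorem main_laplacian_le {η h ρ q m T n : ℝ} (hη : η ≤ 1 / 2) (hη0 : 0 < η) (hn : 1 ≤ n)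
    (hq1 : 1 ≤ q) (hq : q ^ 2 = 1 + ρ) (hρ : 0 ≤ ρ) (hT : T = 1 + h ^ 2 * ρ) (hT1 : 1 ≤ T)
    (hm0 : 0 < m) (hm1 : m ≤ 1) (hmT : 1 ≤ m * T) (hh : h ^ 2 ≤ 1) :
    (n - 1) * (2 * ρ * (-(2 - m) / (4 * q ^ 3 * T) + h ^ 2 * (-2 + (1 + η) * m) / (q * T ^ 2)
        + q * h ^ 4 * (4 - (1 + η) * (2 + η) * m) / T ^ 3)
      + n * ((2 - m) / (2 * q * T) + q * h ^ 2 * (-2 + (1 + η) * m) / T ^ 2))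
      ≤ 9 * n ^ 2 * (q * m / T) := by
  have hT0 : 0 < T := by linarith
  have hq0 : 0 < q := by linarith
  have h2 : 0 ≤ 2 - (1 + η) * m := by nlinarith
  have h3 : 0 ≤ 2 - m := by linarith
  have hy : 1 / (q * T) ≤ q * m / T := by
    rw [div_le_div_iff₀ (by positivity) hT0]
    nlinarith
  have hz : q / T ^ 2 ≤ q * m / T := by
    rw [div_le_div_iff₀ (by positivity) hT0]
    nlinarith [mul_pos hq0 hT0]
  have a1 : -(2 - m) / (4 * q ^ 3 * T) ≤ 0 :=
    div_nonpos_of_nonpos_of_nonneg (by linarith) (by positivity)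
  have a2 : h ^ 2 * (-2 + (1 + η) * m) / (q * T ^ 2) ≤ 0 :=
    div_nonpos_of_nonpos_of_nonneg
      (mul_nonpos_of_nonneg_of_nonpos (by positivity) (by linarith)) (by positivity)
  have a3 : q * h ^ 2 * (-2 + (1 + η) * m) / T ^ 2 ≤ 0 :=
    div_nonpos_of_nonpos_of_nonneg
      (mul_nonpos_of_nonneg_of_nonpos (by positivity) (by linarith)) (by positivity)
  have a4 : ρ * (q * h ^ 4 * (4 - (1 + η) * (2 + η) * m) / T ^ 3) ≤ 4 * h ^ 2 * (q / T ^ 2) := by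
    have : ρ * (q * h ^ 4 * (4 - (1 + η) * (2 + η) * m) / T ^ 3)
      = ((T - 1) / T) * (4 - (1 + η) * (2 + η) * m) * h ^ 2 * (q / T ^ 2) := by
      rw [hT]; field_simp; ring
    rw [this]
    have b1 : (T - 1) / T ≤ 1 := by rw [div_le_one hT0]; linarith
    have b0 : 0 ≤ (T - 1) / T := div_nonneg (by linarith) hT0.le
    have b2 : (T - 1) / T * (4 - (1 + η) * (2 + η) * m) ≤ 4 := by
      have : (T - 1) / T * (4 - (1 + η) * (2 + η) * m) ≤ (T - 1) / T * 4 :=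
        mul_le_mul_of_nonneg_left (by nlinarith [mul_pos hη0 hm0]) b0
      linarith
    have : 0 ≤ h ^ 2 * (q / T ^ 2) := by positivity
    nlinarith
  have a5 : (2 - m) / (2 * q * T) ≤ q * m / T := by
    refine le_trans ?_ hy
    rw [div_le_div_iff₀ (by positivity) (by positivity)]
    nlinarith [mul_pos hq0 hT0]
  have hyp : 0 ≤ q * m / T := by positivity
  have a6 : 4 * h ^ 2 * (q / T ^ 2) ≤ 4 * (q * m / T) := by
    have : h ^ 2 * (q / T ^ 2) ≤ 1 * (q * m / T) := mul_le_mul hh hz (by positivity) zero_le_one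
    linarith
  have a1' := mul_nonpos_of_nonneg_of_nonpos hρ a1
  have a2' := mul_nonpos_of_nonneg_of_nonpos hρ a2
  have a7 : n * ((2 - m) / (2 * q * T) + q * h ^ 2 * (-2 + (1 + η) * m) / T ^ 2)
      ≤ n * (q * m / T) := mul_le_mul_of_nonneg_left (by linarith) (by linarith)
  set y := q * m / T
  calc _ ≤ (n - 1) * (8 * y + n * y) :=
        mul_le_mul_of_nonneg_left (by nlinarith) (by linarith)
    _ ≤ 9 * n ^ 2 * y := by
        have : (n - 1) * (8 + n) ≤ 9 * n ^ 2 := by nlinarith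
        nlinarith

/-- The contribution `2 ρ (a₀ ρ ψ²)' + a₀ ρ ψ²` of the phase is bounded below, up to `O(lam² h² y)`,
by the gain `lam² ρ m² / (z² q³ T)`, which absorbs the potential at intermediate `ρ`. -/
theorem main_phase_ge {η h ρ q z m T lam : ℝ} (hη0 : 0 < η) (hη : η ≤ 1 / 2)
    (hq0 : 0 < q) (hq : q ^ 2 = 1 + ρ) (hρ : 0 ≤ ρ) (hT : T = 1 + h ^ 2 * ρ) (hT1 : 1 ≤ T)
    (hm0 : 0 < m) (hm1 : m ≤ 1) (hz0 : 0 < z) (hz : ρ ≤ z ^ 2) :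
    lam ^ 2 * ρ * m ^ 2 / (z ^ 2 * q ^ 3 * T) - 8 * lam ^ 2 * h ^ 2 * (q * m / T) ≤
      ρ * (lam * m / (z * q)) ^ 2 *
        (q * (2 - m) / T +
          2 * ρ * ((2 - m) / (2 * q * T) + q * h ^ 2 * (-2 + (1 + η) * m) / T ^ 2)
        + 2 * (q * (2 - m) / T) *
          (1 + 2 * ρ * (-1 / (2 * z ^ 2) - 1 / (2 * q ^ 2) - η * h ^ 2 / T))) := by
  have hT0 : 0 < T := by linarith
  have h3 : 0 < 2 - m := by linarith
  have hTm : 0 ≤ T - 1 := by linarith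
  have e : q * (2 - m) / T +
          2 * ρ * ((2 - m) / (2 * q * T) + q * h ^ 2 * (-2 + (1 + η) * m) / T ^ 2)
        + 2 * (q * (2 - m) / T) *
          (1 + 2 * ρ * (-1 / (2 * z ^ 2) - 1 / (2 * q ^ 2) - η * h ^ 2 / T))
      = q * (2 - m) / T * (1 / q ^ 2 - 4 * ((T - 1) / T))
        + q * (2 - m) / T * (2 * ((z ^ 2 - ρ) / z ^ 2))
        + q * (2 - m) / T * (2 * ((T - 1) / T) * (1 - 2 * η))
        + 2 * ((T - 1) / T) * (q * (η * m) / T) := by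
    have hρ' : ρ = q ^ 2 - 1 := by linarith
    have hT' : T - 1 = h ^ 2 * (q ^ 2 - 1) := by rw [hT, hρ']; ring
    rw [hT', hρ']
    field_simp
    ring
  rw [e]
  have p1 : 0 ≤ q * (2 - m) / T * (2 * ((z ^ 2 - ρ) / z ^ 2)) := by
    have : 0 ≤ z ^ 2 - ρ := by linarith
    positivity
  have p2 : 0 ≤ q * (2 - m) / T * (2 * ((T - 1) / T) * (1 - 2 * η)) := by
    have : 0 ≤ 1 - 2 * η := by linarith
    positivity
  have p3 : 0 ≤ 2 * ((T - 1) / T) * (q * (η * m) / T) := by positivity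
  have hN : 0 ≤ ρ * (lam * m / (z * q)) ^ 2 := by positivity
  refine le_trans ?_ (mul_le_mul_of_nonneg_left (by linarith : q * (2 - m) / T * (1 / q ^ 2
    - 4 * ((T - 1) / T)) ≤ _) hN)
  have g : lam ^ 2 * ρ * m ^ 2 / (z ^ 2 * q ^ 3 * T) ≤
      ρ * (lam * m / (z * q)) ^ 2 * (q * (2 - m) / T * (1 / q ^ 2)) := by
    have : ρ * (lam * m / (z * q)) ^ 2 * (q * (2 - m) / T * (1 / q ^ 2))
      = lam ^ 2 * ρ * m ^ 2 / (z ^ 2 * q ^ 3 * T) * (2 - m) := by field_simp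
    rw [this]
    exact le_mul_of_one_le_right (by positivity) (by linarith)
  have l : ρ * (lam * m / (z * q)) ^ 2 * (q * (2 - m) / T * (4 * ((T - 1) / T)))
      ≤ 8 * lam ^ 2 * h ^ 2 * (q * m / T) := by
    have e1 : ρ * (lam * m / (z * q)) ^ 2 * (q * (2 - m) / T * (4 * ((T - 1) / T)))
      = 4 * lam ^ 2 * h ^ 2 * (q * m / T) * ((ρ / z ^ 2) * (ρ / q ^ 2) * (m / T) * (2 - m)) := by
      have : T - 1 = h ^ 2 * ρ := by rw [hT]; ring
      rw [this]
      field_simp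
    have b1 : ρ / z ^ 2 ≤ 1 := (div_le_one (by positivity)).2 hz
    have b2 : ρ / q ^ 2 ≤ 1 := (div_le_one (by positivity)).2 (by linarith)
    have b3 : m / T ≤ 1 := (div_le_one (by positivity)).2 (by linarith)
    have b4 : (ρ / z ^ 2) * (ρ / q ^ 2) * (m / T) * (2 - m) ≤ 1 * 1 * 1 * 2 := by
      gcongr
      linarith
    rw [e1]
    have : 0 ≤ 4 * lam ^ 2 * h ^ 2 * (q * m / T) := by positivity
    nlinarith
  linarith

/-- The bump `τ / z` loses at most `4 τ lam² y` to the phase. -/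
theorem bump_phase_ge {η h ρ q z m T lam τ : ℝ} (hη0 : 0 < η) (hη : η ≤ 1 / 2)
    (hq0 : 0 < q) (hq : q ^ 2 = 1 + ρ) (hρ : 0 ≤ ρ) (hT : T = 1 + h ^ 2 * ρ) (hT1 : 1 ≤ T)
    (hm0 : 0 < m) (hz0 : 0 < z) (hz : ρ ≤ z ^ 2) (hzq : z ≤ q)
    (hτ : 0 ≤ τ) (hh : h ^ 2 ≤ 1) (hm1 : m ≤ 1) :
    - (4 * τ * lam ^ 2 * (q * m / T)) ≤
      ρ * (lam * m / (z * q)) ^ 2 *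
        (τ / z + 2 * ρ * (-τ / (2 * z ^ 3))
        + 2 * (τ / z) *
          (1 + 2 * ρ * (-1 / (2 * z ^ 2) - 1 / (2 * q ^ 2) - η * h ^ 2 / T))) := by
  have hT0 : 0 < T := by linarith
  have hTm : 0 ≤ T - 1 := by linarith
  have hTr : (T - 1) / T ≤ ρ / q ^ 2 := by
    rw [div_le_div_iff₀ hT0 (by positivity), hT, hq]
    nlinarith
  have e : τ / z + 2 * ρ * (-τ / (2 * z ^ 3))
        + 2 * (τ / z) *
          (1 + 2 * ρ * (-1 / (2 * z ^ 2) - 1 / (2 * q ^ 2) - η * h ^ 2 / T))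
      = τ / z * (3 * ((z ^ 2 - ρ) / z ^ 2)) + τ / z * (-2 * (ρ / q ^ 2) - 4 * η * ((T - 1) / T)) := by
    have : T - 1 = h ^ 2 * ρ := by rw [hT]; ring
    rw [this]
    field_simp
    ring
  rw [e]
  have hN : 0 ≤ ρ * (lam * m / (z * q)) ^ 2 := by positivity
  have p1 : 0 ≤ τ / z * (3 * ((z ^ 2 - ρ) / z ^ 2)) := by
    have : 0 ≤ z ^ 2 - ρ := by linarith
    positivity
  have p2 : τ / z * (-4 * (ρ / q ^ 2)) ≤ τ / z * (-2 * (ρ / q ^ 2) - 4 * η * ((T - 1) / T)) := by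
    apply mul_le_mul_of_nonneg_left _ (by positivity)
    have : 0 ≤ (T - 1) / T := by positivity
    nlinarith
  refine le_trans ?_ (mul_le_mul_of_nonneg_left (by linarith : τ / z * (-4 * (ρ / q ^ 2)) ≤ _) hN)
  have e1 : ρ * (lam * m / (z * q)) ^ 2 * (τ / z * (-4 * (ρ / q ^ 2)))
    = - (4 * τ * lam ^ 2 * (q * m / T) *
        ((ρ / z ^ 2) ^ 2 * (z / q) * (T / q ^ 2) * (1 / q ^ 2) * m)) := by
    field_simp
  have hq1 : 1 ≤ q ^ 2 := by linarith
  have hTq : T ≤ q ^ 2 := by nlinarith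
  have b1 : (ρ / z ^ 2) ^ 2 * (z / q) * (T / q ^ 2) * (1 / q ^ 2) * m ≤ 1 ^ 2 * 1 * 1 * 1 * 1 := by
    gcongr
    · exact (div_le_one (by positivity)).2 hz
    · exact (div_le_one (by positivity)).2 hzq
    · exact (div_le_one (by positivity)).2 hTq
    · exact (div_le_one (by positivity)).2 hq1
  rw [e1]
  have : 0 ≤ 4 * τ * lam ^ 2 * (q * m / T) := by positivity
  nlinarith

/-- In dimension at least three the bump `τ / z` yields a positive term `3 h² τ³ / z⁵`,
concentrated at the origin, where it absorbs the second derivative of the phase. -/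
theorem bump_laplacian_le {ρ z τ n : ℝ} (hn : 3 ≤ n) (hz0 : 0 < z) (hz : z ^ 2 = ρ + τ ^ 2)
    (hρ : 0 ≤ ρ) (hτ : 0 < τ) :
    (n - 1) * (2 * ρ * (3 * τ / (4 * z ^ 5)) + n * (-τ / (2 * z ^ 3))) ≤ -(3 * τ ^ 3 / z ^ 5) := by
  have e : (n - 1) * (2 * ρ * (3 * τ / (4 * z ^ 5)) + n * (-τ / (2 * z ^ 3)))
      + (3 * τ ^ 3 / z ^ 5) = - ((n - 1) * ((n - 3) * ρ + n * τ ^ 2) / 2 - 3 * τ ^ 2) * τ / z ^ 5 := by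
    field_simp
    linear_combination (-4 * n * (n - 1)) * hz
  have k : 0 ≤ (n - 1) * ((n - 3) * ρ + n * τ ^ 2) / 2 - 3 * τ ^ 2 := by
    have h1 : 0 ≤ (n - 1) * ((n - 3) * ρ) :=
      mul_nonneg (by linarith) (mul_nonneg (by linarith) hρ)
    have h2 : 6 * τ ^ 2 ≤ (n - 1) * n * τ ^ 2 :=
      mul_le_mul_of_nonneg_right (by nlinarith) (sq_nonneg τ)
    nlinarith
  have : 0 ≤ ((n - 1) * ((n - 3) * ρ + n * τ ^ 2) / 2 - 3 * τ ^ 2) * τ / z ^ 5 := by positivity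
  have e2 : - ((n - 1) * ((n - 3) * ρ + n * τ ^ 2) / 2 - 3 * τ ^ 2) * τ / z ^ 5
    = - (((n - 1) * ((n - 3) * ρ + n * τ ^ 2) / 2 - 3 * τ ^ 2) * τ / z ^ 5) := by ring
  linarith

theorem weight_le {q z m T τ ρ : ℝ} (hq0 : 0 < q) (hq : q ^ 2 = 1 + ρ) (hρ : 0 ≤ ρ)
    (hT1 : 1 ≤ T) (hTq : T ≤ q ^ 2) (hm0 : 0 < m) (hz0 : 0 < z) (hz : z ^ 2 = ρ + τ ^ 2)
    (hτ : 0 < τ) (hτ1 : τ ≤ 1) :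
    q * (2 - m) / T + τ / z ≤ 3 * (q / T) := by
  have hT0 : 0 < T := by linarith
  have h1 : τ * q ≤ z := by
    apply le_of_sq_le_sq _ hz0.le
    rw [mul_pow, hq, hz]
    nlinarith [mul_nonneg hρ (by nlinarith : 0 ≤ 1 - τ ^ 2)]
  have h2 : τ / z ≤ q / T := by
    rw [div_le_div_iff₀ hz0 hT0]
    nlinarith
  have h3 : q * (2 - m) / T ≤ 2 * (q / T) := by
    rw [mul_div_assoc', div_le_div_iff_of_pos_right hT0]
    nlinarith
  linarith

/-- The term `a h φ''² / ψ`, where `φ'' = ψ + 2 ρ ψ'` is the second radial derivative of the phase,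
is absorbed by the bump near the origin (this fixes `2 lam τ = h`) and is `O(h lam y)` elsewhere. -/
theorem phase_second_deriv_le {η h ρ q z m T lam τ a : ℝ} (hη0 : 0 < η) (hη : η ≤ 1 / 2)
    (hq0 : 0 < q) (hq : q ^ 2 = 1 + ρ) (hρ : 0 ≤ ρ) (hT : T = 1 + h ^ 2 * ρ) (hT1 : 1 ≤ T)
    (hm0 : 0 < m) (hm1 : m ≤ 1) (hz0 : 0 < z) (hz : z ^ 2 = ρ + τ ^ 2) (hzq : z ≤ q)
    (hτ : 0 < τ) (hh0 : 0 < h) (hh : h ^ 2 ≤ 1) (hlam : 0 < lam) (hlt : 2 * lam * τ = h)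
    (ha0 : 0 < a) (ha : a ≤ 3 * (q / T)) :
    a * h * ((lam * m / (z * q)) *
        (1 + 2 * ρ * (-1 / (2 * z ^ 2) - 1 / (2 * q ^ 2) - η * h ^ 2 / T))) ^ 2 /
        (lam * m / (z * q)) ≤ 3 * h ^ 2 * τ ^ 3 / z ^ 5 + 24 * h * lam * (q * m / T) := by
  have hT0 : 0 < T := by linarith
  have hTm : 0 ≤ T - 1 := by linarith
  have hTr : (T - 1) / T ≤ ρ / q ^ 2 := by
    rw [div_le_div_iff₀ hT0 (by positivity), hT, hq]
    nlinarith
  have e : 1 + 2 * ρ * (-1 / (2 * z ^ 2) - 1 / (2 * q ^ 2) - η * h ^ 2 / T)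
    = τ ^ 2 / z ^ 2 - (ρ / q ^ 2 + 2 * η * ((T - 1) / T)) := by
    have : T - 1 = h ^ 2 * ρ := by rw [hT]; ring
    rw [this]
    have hτ2 : τ ^ 2 = z ^ 2 - ρ := by linarith
    rw [hτ2]
    field_simp
    ring
  have hw0 : 0 ≤ ρ / q ^ 2 + 2 * η * ((T - 1) / T) := by positivity
  have hw1 : ρ / q ^ 2 + 2 * η * ((T - 1) / T) ≤ 2 * (ρ / q ^ 2) := by
    have : 0 ≤ (T - 1) / T := by positivity
    nlinarith
  have hsq : (1 + 2 * ρ * (-1 / (2 * z ^ 2) - 1 / (2 * q ^ 2) - η * h ^ 2 / T)) ^ 2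
      ≤ 2 * (τ ^ 2 / z ^ 2) ^ 2 + 8 * (ρ / q ^ 2) ^ 2 := by
    rw [e]
    set w := ρ / q ^ 2 + 2 * η * ((T - 1) / T)
    have : w ^ 2 ≤ (2 * (ρ / q ^ 2)) ^ 2 := pow_le_pow_left₀ hw0 hw1 2
    nlinarith [sq_nonneg (τ ^ 2 / z ^ 2 + w)]
  set κ := 1 + 2 * ρ * (-1 / (2 * z ^ 2) - 1 / (2 * q ^ 2) - η * h ^ 2 / T)
  have e1 : a * h * ((lam * m / (z * q)) * κ) ^ 2 / (lam * m / (z * q))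
      = a * (h * (lam * m / (z * q)) * κ ^ 2) := by field_simp
  have e2 : a * (h * (lam * m / (z * q)) * κ ^ 2) ≤
      3 * (q / T) * (h * (lam * m / (z * q)) * (2 * (τ ^ 2 / z ^ 2) ^ 2 + 8 * (ρ / q ^ 2) ^ 2)) := by
    gcongr
  have e3 : 3 * (q / T) * (h * (lam * m / (z * q)) *
        (2 * (τ ^ 2 / z ^ 2) ^ 2 + 8 * (ρ / q ^ 2) ^ 2))
      = 3 * h * (2 * lam * τ) * τ ^ 3 / z ^ 5 * (m / T)
        + 24 * h * lam * (q * m / T) * ((ρ / z ^ 2) * (z / q) * (ρ / q ^ 2) * (1 / q ^ 2)) := by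
    field_simp
    ring
  have b1 : m / T ≤ 1 := (div_le_one hT0).2 (by linarith)
  have b2 : (ρ / z ^ 2) * (z / q) * (ρ / q ^ 2) * (1 / q ^ 2) ≤ 1 * 1 * 1 * 1 := by
    gcongr
    · exact (div_le_one (by positivity)).2 (by nlinarith)
    · exact (div_le_one (by positivity)).2 hzq
    · exact (div_le_one (by positivity)).2 (by linarith)
    · exact (div_le_one (by positivity)).2 (by linarith)
  rw [e1]
  refine e2.trans ?_
  rw [e3, hlt]
  have c1 : 3 * h * h * τ ^ 3 / z ^ 5 * (m / T) ≤ 3 * h * h * τ ^ 3 / z ^ 5 :=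
    mul_le_of_le_one_right (by positivity) b1
  have c2 : 24 * h * lam * (q * m / T) * ((ρ / z ^ 2) * (z / q) * (ρ / q ^ 2) * (1 / q ^ 2))
      ≤ 24 * h * lam * (q * m / T) := mul_le_of_le_one_right (by positivity) (by linarith)
  have c3 : 3 * h * h * τ ^ 3 / z ^ 5 = 3 * h ^ 2 * τ ^ 3 / z ^ 5 := by ring
  linarith

/-- The potential term `a V² / (h ψ)` is absorbed by the gain from the phase where
`τ² ≤ ρ ≤ h⁻²`, which requires `lam³ h ≳ C²`; it is a small multiple of `y` both for `ρ ≤ τ²` and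
for `ρ ≥ h⁻²`. -/
theorem potential_term_le {h ρ q z m T lam τ a V C : ℝ}
    (hq0 : 0 < q) (hq : q ^ 2 = 1 + ρ) (hρ : 0 ≤ ρ) (hT : T = 1 + h ^ 2 * ρ) (hT1 : 1 ≤ T)
    (hm0 : 0 < m) (hz0 : 0 < z) (hz : z ^ 2 = ρ + τ ^ 2) (hzq : z ≤ q)
    (hmT : 1 ≤ m * T) (hmq : 1 ≤ m ^ 2 * q ^ 2)
    (hτ : 0 < τ) (hh0 : 0 < h) (hlam : 0 < lam) (hlt : 2 * lam * τ = h)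
    (ha : a ≤ 3 * (q / T)) (hV : V ^ 2 ≤ C ^ 2 / q ^ 6) (hC : 48 * C ^ 2 ≤ lam ^ 3 * h) :
    a * V ^ 2 / (h * (lam * m / (z * q))) ≤
      lam ^ 2 * ρ * m ^ 2 / (z ^ 2 * q ^ 3 * T)
        + (3 * C ^ 2 / lam ^ 2 + 3 * C ^ 2 * h / lam) * (q * m / T) := by
  have hT0 : 0 < T := by linarith
  have hq1 : 1 ≤ q := by nlinarith
  have h1 : a * V ^ 2 / (h * (lam * m / (z * q))) ≤
      3 * (q / T) * (C ^ 2 / q ^ 6) / (h * (lam * m / (z * q))) := by gcongr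
  have h2 : 3 * (q / T) * (C ^ 2 / q ^ 6) / (h * (lam * m / (z * q)))
    = 3 * C ^ 2 * z / (h * lam * m * T * q ^ 4) := by field_simp
  rw [h2] at h1
  refine h1.trans ?_
  have hG : 0 ≤ lam ^ 2 * ρ * m ^ 2 / (z ^ 2 * q ^ 3 * T) := by positivity
  have hA : 0 ≤ 3 * C ^ 2 / lam ^ 2 * (q * m / T) := by positivity
  have hB : 0 ≤ 3 * C ^ 2 * h / lam * (q * m / T) := by positivity
  rw [add_mul]
  rcases le_total ρ (τ ^ 2) with hc | hc
  · have hz2 : z ≤ 2 * τ := by nlinarith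
    have : 3 * C ^ 2 * z / (h * lam * m * T * q ^ 4) ≤ 3 * C ^ 2 / lam ^ 2 * (q * m / T) := by
      calc 3 * C ^ 2 * z / (h * lam * m * T * q ^ 4)
          ≤ 3 * C ^ 2 * (2 * τ) / (h * lam * m * T * q ^ 4) := by gcongr
        _ = 3 * C ^ 2 / lam ^ 2 * (1 / (m * q ^ 4 * T)) := by
            rw [← hlt]; field_simp
        _ ≤ 3 * C ^ 2 / lam ^ 2 * (q * m / T) := by
            apply mul_le_mul_of_nonneg_left _ (by positivity)
            rw [div_le_div_iff₀ (by positivity) hT0]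
            have : 1 ≤ m ^ 2 * q ^ 2 * q ^ 3 := one_le_mul_of_one_le_of_one_le hmq (one_le_pow₀ hq1)
            calc 1 * T ≤ (m ^ 2 * q ^ 2 * q ^ 3) * T := by gcongr
              _ = _ := by ring
    linarith
  have h3 : 3 * C ^ 2 * z / (h * lam * m * T * q ^ 4) ≤ 3 * C ^ 2 / (h * lam * m * T * q ^ 3) := by
    rw [div_le_div_iff₀ (by positivity) (by positivity)]
    have : 3 * C ^ 2 * (h * lam * m * T * q ^ 3) * z ≤ 3 * C ^ 2 * (h * lam * m * T * q ^ 3) * q :=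
      by gcongr
    linarith
  rcases le_total T 2 with hc2 | hc2
  · have hm2 : 1 / 2 ≤ m := by nlinarith
    have : 3 * C ^ 2 / (h * lam * m * T * q ^ 3) ≤ lam ^ 2 * ρ * m ^ 2 / (z ^ 2 * q ^ 3 * T) := by
      rw [div_le_div_iff₀ (by positivity) (by positivity)]
      have k1 : z ^ 2 ≤ 2 * ρ := by linarith
      have k2 : 1 / 8 ≤ m ^ 3 := by
        have := pow_le_pow_left₀ (by norm_num) hm2 3
        norm_num at this ⊢
        linarith
      have k3 : 6 * C ^ 2 ≤ lam ^ 3 * h * m ^ 3 := by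
        have : 0 < lam ^ 3 * h := by positivity
        nlinarith
      calc 3 * C ^ 2 * (z ^ 2 * q ^ 3 * T) ≤ 3 * C ^ 2 * ((2 * ρ) * q ^ 3 * T) := by gcongr
        _ = (6 * C ^ 2) * (ρ * q ^ 3 * T) := by ring
        _ ≤ (lam ^ 3 * h * m ^ 3) * (ρ * q ^ 3 * T) := by gcongr
        _ = _ := by ring
    linarith
  · have : 3 * C ^ 2 / (h * lam * m * T * q ^ 3) ≤ 3 * C ^ 2 * h / lam * (q * m / T) := by
      have e : 3 * C ^ 2 / (h * lam * m * T * q ^ 3)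
        = 3 * C ^ 2 / (h * lam * m * T * q ^ 3) * 1 := by ring
      have k : 1 ≤ h ^ 2 * q ^ 2 * (m ^ 2 * q ^ 2) :=
        one_le_mul_of_one_le_of_one_le (by nlinarith) hmq
      rw [e]
      calc _ ≤ 3 * C ^ 2 / (h * lam * m * T * q ^ 3) * (h ^ 2 * q ^ 2 * (m ^ 2 * q ^ 2)) := by
            gcongr
        _ = _ := by field_simp
    linarith

/-! ### The multiplier, the phase slope and coercivity -/

section

/-- The cutoff factor `(1 + h²ρ)^{-η}`, with `ρ = |x|²`. -/
def cutoff (η h ρ : ℝ) : ℝ := (1 + h ^ 2 * ρ) ^ (-η)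

/-- The radial multiplier, as a function of `ρ = |x|²`: a bulk part of size `⟨x⟩ / (1 + h² ρ)` plus
a bump `τ / √(ρ + τ²)` concentrated near the origin. -/
def mult (η h τ ρ : ℝ) : ℝ :=
  √(1 + ρ) * (2 - cutoff η h ρ) / (1 + h ^ 2 * ρ) + τ / √(ρ + τ ^ 2)

/-- The derivative of `mult` in `ρ`. -/
def mult' (η h τ ρ : ℝ) : ℝ :=
  (2 - cutoff η h ρ) / (2 * √(1 + ρ) * (1 + h ^ 2 * ρ)) +
    √(1 + ρ) * h ^ 2 * (-2 + (1 + η) * cutoff η h ρ) / (1 + h ^ 2 * ρ) ^ 2 +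
    -τ / (2 * √(ρ + τ ^ 2) ^ 3)

/-- The second derivative of `mult` in `ρ`. -/
def mult'' (η h τ ρ : ℝ) : ℝ :=
  -(2 - cutoff η h ρ) / (4 * √(1 + ρ) ^ 3 * (1 + h ^ 2 * ρ)) +
    h ^ 2 * (-2 + (1 + η) * cutoff η h ρ) / (√(1 + ρ) * (1 + h ^ 2 * ρ) ^ 2) +
    √(1 + ρ) * h ^ 4 * (4 - (1 + η) * (2 + η) * cutoff η h ρ) / (1 + h ^ 2 * ρ) ^ 3 +
    3 * τ / (4 * √(ρ + τ ^ 2) ^ 5)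

/-- The slope `ψ` of the Carleman phase `φ`, a radial function with `∇φ = ψ x`, as a function of
`ρ = |x|²`. -/
def slope (η h lam τ ρ : ℝ) : ℝ := lam * cutoff η h ρ / (√(ρ + τ ^ 2) * √(1 + ρ))

/-- The logarithmic derivative of `slope` in `ρ`. -/
def slopeLog (η h τ ρ : ℝ) : ℝ :=
  -1 / (2 * √(ρ + τ ^ 2) ^ 2) - 1 / (2 * √(1 + ρ) ^ 2) - η * h ^ 2 / (1 + h ^ 2 * ρ)

/-- The derivative of `slope` in `ρ`. -/
def slope' (η h lam τ ρ : ℝ) : ℝ := slope η h lam τ ρ * slopeLog η h τ ρ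

theorem hasDerivAt_cutoff (η h : ℝ) {ρ : ℝ} (hρ : 0 ≤ ρ) :
    HasDerivAt (cutoff η h) (-(η * h ^ 2) * cutoff η h ρ / (1 + h ^ 2 * ρ)) ρ := by
  have hT : 0 < 1 + h ^ 2 * ρ := by positivity
  have h1 : HasDerivAt (fun r : ℝ => 1 + h ^ 2 * r) (h ^ 2) ρ := by
    simpa using ((hasDerivAt_id ρ).const_mul (h ^ 2)).const_add 1
  have h2 := h1.rpow_const (p := -η) (Or.inl hT.ne')
  refine h2.congr_deriv ?_
  rw [Real.rpow_sub_one hT.ne', cutoff]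
  field_simp

theorem hasDerivAt_sqrt_add (c : ℝ) {ρ : ℝ} (hρ : 0 < ρ + c) :
    HasDerivAt (fun r : ℝ => √(r + c)) (1 / (2 * √(ρ + c))) ρ :=
  ((hasDerivAt_id ρ).add_const c).sqrt hρ.ne'

theorem hasDerivAt_mult {η h τ ρ : ℝ} (hρ : 0 ≤ ρ) (hτ : 0 < τ) :
    HasDerivAt (mult η h τ) (mult' η h τ ρ) ρ := by
  have hT : 0 < 1 + h ^ 2 * ρ := by positivity
  have hq : 0 < √(1 + ρ) := by positivity
  have hz : 0 < √(ρ + τ ^ 2) := by positivity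
  have h1 : HasDerivAt (fun r : ℝ => 1 + h ^ 2 * r) (h ^ 2) ρ := by
    simpa using ((hasDerivAt_id ρ).const_mul (h ^ 2)).const_add 1
  have hq' : HasDerivAt (fun r : ℝ => √(1 + r)) (1 / (2 * √(1 + ρ))) ρ := by
    simpa [add_comm] using hasDerivAt_sqrt_add 1 (ρ := ρ) (by positivity)
  have hz' := hasDerivAt_sqrt_add (τ ^ 2) (ρ := ρ) (by positivity)
  have hm' := hasDerivAt_cutoff η h hρ
  have := ((hq'.fun_mul (hm'.const_sub 2)).fun_div h1 hT.ne').fun_add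
    ((hasDerivAt_const ρ τ).fun_div hz' hz.ne')
  refine this.congr_deriv ?_
  rw [mult']
  field_simp
  ring

theorem hasDerivAt_mult' {η h τ ρ : ℝ} (hρ : 0 ≤ ρ) (hτ : 0 < τ) :
    HasDerivAt (mult' η h τ) (mult'' η h τ ρ) ρ := by
  have hT : 0 < 1 + h ^ 2 * ρ := by positivity
  have hq : 0 < √(1 + ρ) := by positivity
  have hz : 0 < √(ρ + τ ^ 2) := by positivity
  have h1 : HasDerivAt (fun r : ℝ => 1 + h ^ 2 * r) (h ^ 2) ρ := by
    simpa using ((hasDerivAt_id ρ).const_mul (h ^ 2)).const_add 1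
  have hq' : HasDerivAt (fun r : ℝ => √(1 + r)) (1 / (2 * √(1 + ρ))) ρ := by
    simpa [add_comm] using hasDerivAt_sqrt_add 1 (ρ := ρ) (by positivity)
  have hz' := hasDerivAt_sqrt_add (τ ^ 2) (ρ := ρ) (by positivity)
  have hm' := hasDerivAt_cutoff η h hρ
  have d1 := (hm'.const_sub 2).fun_div ((hq'.const_mul 2).fun_mul h1)
    (by positivity : 2 * √(1 + ρ) * (1 + h ^ 2 * ρ) ≠ 0)
  have d2 := ((hq'.mul_const (h ^ 2)).fun_mul ((hm'.const_mul (1 + η)).const_add (-2))).fun_div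
    (h1.fun_pow 2) (by positivity)
  have d3 := (hasDerivAt_const ρ (-τ)).fun_div ((hz'.fun_pow 3).const_mul 2) (by positivity)
  refine ((d1.fun_add d2).fun_add d3).congr_deriv ?_
  rw [mult'']
  field_simp
  ring

theorem hasDerivAt_slope {η h lam τ ρ : ℝ} (hρ : 0 ≤ ρ) (hτ : 0 < τ) :
    HasDerivAt (slope η h lam τ) (slope' η h lam τ ρ) ρ := by
  have hT : 0 < 1 + h ^ 2 * ρ := by positivity
  have hq : 0 < √(1 + ρ) := by positivity
  have hz : 0 < √(ρ + τ ^ 2) := by positivity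
  have hq' : HasDerivAt (fun r : ℝ => √(1 + r)) (1 / (2 * √(1 + ρ))) ρ := by
    simpa [add_comm] using hasDerivAt_sqrt_add 1 (ρ := ρ) (by positivity)
  have hz' := hasDerivAt_sqrt_add (τ ^ 2) (ρ := ρ) (by positivity)
  have hm' := hasDerivAt_cutoff η h hρ
  have := (hm'.const_mul lam).fun_div (hz'.fun_mul hq') (by positivity)
  refine this.congr_deriv ?_
  rw [slope', slopeLog, slope]
  field_simp
  ring

section Bounds

variable {η h τ ρ lam : ℝ}

theorem cutoff_pos (hρ : 0 ≤ ρ) : 0 < cutoff η h ρ := Real.rpow_pos_of_pos (by positivity) _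

theorem cutoff_le_one (hη : 0 ≤ η) (hρ : 0 ≤ ρ) : cutoff η h ρ ≤ 1 :=
  Real.rpow_le_one_of_one_le_of_nonpos (by nlinarith [mul_nonneg (sq_nonneg h) hρ]) (by linarith)

theorem one_le_cutoff_mul (hη : η ≤ 1) (hρ : 0 ≤ ρ) : 1 ≤ cutoff η h ρ * (1 + h ^ 2 * ρ) := by
  have hT : 1 ≤ 1 + h ^ 2 * ρ := by nlinarith [mul_nonneg (sq_nonneg h) hρ]
  rw [cutoff, ← Real.rpow_add_one (by linarith)]
  exact Real.one_le_rpow hT (by linarith)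

theorem one_le_cutoff_sq_mul (hη : η ≤ 1 / 2) (hρ : 0 ≤ ρ) :
    1 ≤ cutoff η h ρ ^ 2 * (1 + h ^ 2 * ρ) := by
  have hT : 1 ≤ 1 + h ^ 2 * ρ := by nlinarith [mul_nonneg (sq_nonneg h) hρ]
  rw [cutoff, ← Real.rpow_mul_natCast (by linarith), ← Real.rpow_add_one (by linarith)]
  exact Real.one_le_rpow hT (by push_cast; linarith)

theorem slope_pos (hlam : 0 < lam) (hρ : 0 ≤ ρ) (hτ : 0 < τ) : 0 < slope η h lam τ ρ := by
  have := cutoff_pos (η := η) (h := h) hρ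
  rw [slope]; positivity

theorem mult_pos (hη : 0 ≤ η) (hρ : 0 ≤ ρ) (hτ : 0 < τ) : 0 < mult η h τ ρ := by
  have := cutoff_le_one (h := h) hη hρ
  have h2 : 0 < 2 - cutoff η h ρ := by linarith
  rw [mult]; positivity

theorem scale_le (hh : h ^ 2 ≤ 1) (hρ : 0 ≤ ρ) : 1 + h ^ 2 * ρ ≤ √(1 + ρ) ^ 2 := by
  rw [Real.sq_sqrt (by positivity)]
  nlinarith

theorem one_le_scale (hρ : 0 ≤ ρ) : 1 ≤ 1 + h ^ 2 * ρ := by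
  nlinarith [mul_nonneg (sq_nonneg h) hρ]

theorem mult_le (hρ : 0 ≤ ρ) (hτ : 0 < τ) (hτ1 : τ ≤ 1) (hh : h ^ 2 ≤ 1) :
    mult η h τ ρ ≤ 3 * (√(1 + ρ) / (1 + h ^ 2 * ρ)) :=
  weight_le (by positivity) (Real.sq_sqrt (by positivity)) hρ (one_le_scale hρ) (scale_le hh hρ)
    (cutoff_pos hρ) (by positivity) (Real.sq_sqrt (by positivity)) hτ hτ1

theorem gain_le_mult_add (hη0 : 0 < η) (hη : η ≤ 1 / 2) (hρ : 0 ≤ ρ) (hτ : 0 < τ)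
    (hh : h ^ 2 ≤ 1) :
    2 * η * (√(1 + ρ) * cutoff η h ρ / (1 + h ^ 2 * ρ)) ≤
      mult η h τ ρ + 2 * ρ * mult' η h τ ρ := by
  have h1 := main_weight_deriv_ge (h := h) hη0 hη (by positivity : 0 < √(1 + ρ))
    (Real.sq_sqrt (by positivity)) rfl (one_le_scale hρ) (scale_le hh hρ)
    (cutoff_le_one (h := h) hη0.le hρ)
  have hz : 0 < √(ρ + τ ^ 2) := by positivity
  have hz2 : √(ρ + τ ^ 2) ^ 2 = ρ + τ ^ 2 := Real.sq_sqrt (by positivity)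
  have h2 : 0 ≤ τ / √(ρ + τ ^ 2) + 2 * ρ * (-τ / (2 * √(ρ + τ ^ 2) ^ 3)) := by
    have : τ / √(ρ + τ ^ 2) + 2 * ρ * (-τ / (2 * √(ρ + τ ^ 2) ^ 3))
      = τ ^ 3 / √(ρ + τ ^ 2) ^ 3 := by
      field_simp
      linear_combination hz2
    rw [this]; positivity
  rw [mult, mult']
  linarith

theorem mult_sub_nonneg (hη0 : 0 < η) (hη : η ≤ 1 / 2) (hρ : 0 ≤ ρ) (hτ : 0 < τ) :
    0 ≤ mult η h τ ρ - 2 * ρ * mult' η h τ ρ := by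
  have h1 := main_angular_nonneg (h := h) hη hη0 (by positivity : 0 < √(1 + ρ))
    (Real.sq_sqrt (by positivity)) hρ (one_le_scale (h := h) hρ)
    (cutoff_pos hρ) (cutoff_le_one (h := h) hη0.le hρ)
  have h2 : 0 ≤ τ / √(ρ + τ ^ 2) + 2 * ρ * (τ / (2 * √(ρ + τ ^ 2) ^ 3)) := by positivity
  rw [mult, mult', neg_div]
  linarith

theorem laplacian_mult_le {n : ℝ} (hη0 : 0 < η) (hη : η ≤ 1 / 2) (hρ : 0 ≤ ρ) (hτ : 0 < τ)
    (hh : h ^ 2 ≤ 1) (hn : 3 ≤ n) :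
    (n - 1) * (2 * ρ * mult'' η h τ ρ + n * mult' η h τ ρ)
      ≤ 9 * n ^ 2 * (√(1 + ρ) * cutoff η h ρ / (1 + h ^ 2 * ρ))
        - 3 * τ ^ 3 / √(ρ + τ ^ 2) ^ 5 := by
  have l1 := main_laplacian_le (n := n) hη hη0 (by linarith) (Real.one_le_sqrt.2 (by linarith))
    (Real.sq_sqrt (by positivity)) hρ rfl (one_le_scale (h := h) hρ) (cutoff_pos hρ)
    (cutoff_le_one (h := h) hη0.le hρ) (one_le_cutoff_mul (by linarith) hρ) hh
  have l2 := bump_laplacian_le hn (by positivity) (Real.sq_sqrt (by positivity)) hρ hτ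
  rw [sub_eq_add_neg]
  refine le_trans (le_of_eq ?_) (add_le_add l1 l2)
  simp only [mult', mult'']
  ring

theorem phase_gain_ge (hη0 : 0 < η) (hη : η ≤ 1 / 2) (hρ : 0 ≤ ρ) (hτ : 0 < τ) (hτ1 : τ ≤ 1)
    (hh : h ^ 2 ≤ 1) :
    lam ^ 2 * ρ * cutoff η h ρ ^ 2 / (√(ρ + τ ^ 2) ^ 2 * √(1 + ρ) ^ 3 * (1 + h ^ 2 * ρ))
        - (8 * lam ^ 2 * h ^ 2 + 4 * τ * lam ^ 2) *
          (√(1 + ρ) * cutoff η h ρ / (1 + h ^ 2 * ρ))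
      ≤ ρ * slope η h lam τ ρ ^ 2 *
        (mult η h τ ρ + 2 * ρ * mult' η h τ ρ
          + 2 * mult η h τ ρ * (1 + 2 * ρ * slopeLog η h τ ρ)) := by
  have hzr : ρ ≤ √(ρ + τ ^ 2) ^ 2 := by rw [Real.sq_sqrt (by positivity)]; nlinarith
  have hzq : √(ρ + τ ^ 2) ≤ √(1 + ρ) := Real.sqrt_le_sqrt (by nlinarith)
  have l4 := main_phase_ge (lam := lam) hη0 hη (by positivity) (Real.sq_sqrt (by positivity)) hρ rfl
    (one_le_scale (h := h) hρ) (cutoff_pos hρ) (cutoff_le_one (h := h) hη0.le hρ)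
    (by positivity) hzr
  have l5 := bump_phase_ge (lam := lam) hη0 hη (by positivity) (Real.sq_sqrt (by positivity)) hρ rfl
    (one_le_scale (h := h) hρ) (cutoff_pos hρ) (by positivity) hzr hzq hτ.le hh
    (cutoff_le_one (h := h) hη0.le hρ)
  have l := add_le_add l4 l5
  rw [add_mul, ← sub_sub, sub_eq_add_neg _ (4 * τ * lam ^ 2 * _)]
  refine l.trans (le_of_eq ?_)
  simp only [slope, mult, mult', slopeLog]
  ring

/-- Coercivity of the zeroth order coefficient in the Carleman identity: after the potential and
the second derivative of the phase are subtracted, it still dominates the weight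
`η E ⟨x⟩ (1 + h² ρ)^(-1 - η)`. -/
theorem coercivity {n E V C : ℝ} (hη0 : 0 < η) (hη : η ≤ 1 / 2) (hρ : 0 ≤ ρ) (hτ : 0 < τ)
    (hτ1 : τ ≤ 1) (hh0 : 0 < h) (hh : h ^ 2 ≤ 1) (hlam : 0 < lam) (hlt : 2 * lam * τ = h)
    (hn : 3 ≤ n) (hE : 0 < E) (hV : V ^ 2 ≤ C ^ 2 / √(1 + ρ) ^ 6) (hC : 48 * C ^ 2 ≤ lam ^ 3 * h)
    (hsmall : 9 * n ^ 2 * h ^ 2 + (8 * lam ^ 2 * h ^ 2 + 4 * τ * lam ^ 2) + 24 * h * lam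
      + (3 * C ^ 2 / lam ^ 2 + 3 * C ^ 2 * h / lam) ≤ η * E) :
    η * E * (√(1 + ρ) * cutoff η h ρ / (1 + h ^ 2 * ρ)) ≤
      -(h ^ 2 * ((n - 1) * (2 * ρ * mult'' η h τ ρ + n * mult' η h τ ρ)))
      + (mult η h τ ρ * (E + ρ * slope η h lam τ ρ ^ 2)
        + 2 * ρ * (mult' η h τ ρ * (E + ρ * slope η h lam τ ρ ^ 2) + mult η h τ ρ *
          (slope η h lam τ ρ ^ 2 + 2 * ρ * slope η h lam τ ρ * slope' η h lam τ ρ)))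
      - mult η h τ ρ * V ^ 2 / (h * slope η h lam τ ρ)
      - mult η h τ ρ * h * (slope η h lam τ ρ + 2 * ρ * slope' η h lam τ ρ) ^ 2
          / slope η h lam τ ρ := by
  have hq : 0 < √(1 + ρ) := by positivity
  have hq2 : √(1 + ρ) ^ 2 = 1 + ρ := Real.sq_sqrt (by positivity)
  have hz : 0 < √(ρ + τ ^ 2) := by positivity
  have hz2 : √(ρ + τ ^ 2) ^ 2 = ρ + τ ^ 2 := Real.sq_sqrt (by positivity)
  have hzq : √(ρ + τ ^ 2) ≤ √(1 + ρ) := Real.sqrt_le_sqrt (by nlinarith)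
  have hm0 := cutoff_pos (η := η) (h := h) hρ
  have hm1 := cutoff_le_one (h := h) hη0.le hρ
  have hT1 := one_le_scale (h := h) hρ
  have hmT := one_le_cutoff_mul (h := h) (by linarith : η ≤ 1) hρ
  have hmT2 := one_le_cutoff_sq_mul (h := h) hη hρ
  have ha0 := mult_pos (h := h) hη0.le hρ hτ
  have ha := mult_le (η := η) hρ hτ hτ1 hh
  have l3 := gain_le_mult_add hη0 hη hρ hτ hh
  have l6 : mult η h τ ρ * h * (slope η h lam τ ρ * (1 + 2 * ρ * slopeLog η h τ ρ)) ^ 2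
      / slope η h lam τ ρ ≤ 3 * h ^ 2 * τ ^ 3 / √(ρ + τ ^ 2) ^ 5
        + 24 * h * lam * (√(1 + ρ) * cutoff η h ρ / (1 + h ^ 2 * ρ)) :=
    phase_second_deriv_le hη0 hη hq hq2 hρ rfl hT1 hm0 hm1 hz hz2 hzq hτ hh0 hh hlam hlt ha0 ha
  have l7 : mult η h τ ρ * V ^ 2 / (h * slope η h lam τ ρ) ≤ _ :=
    potential_term_le hq hq2 hρ rfl hT1 hm0 hz hz2 hzq hmT
      (hmT2.trans (mul_le_mul_of_nonneg_left (scale_le hh hρ) (sq_nonneg _))) hτ hh0 hlam hlt ha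
      hV hC
  have l45 := phase_gain_ge (lam := lam) hη0 hη hρ hτ hτ1 hh
  have hy : 0 < √(1 + ρ) * cutoff η h ρ / (1 + h ^ 2 * ρ) := by positivity
  have e1 : slope η h lam τ ρ + 2 * ρ * slope' η h lam τ ρ
    = slope η h lam τ ρ * (1 + 2 * ρ * slopeLog η h τ ρ) := by rw [slope']; ring
  have e2 : mult η h τ ρ * (E + ρ * slope η h lam τ ρ ^ 2)
        + 2 * ρ * (mult' η h τ ρ * (E + ρ * slope η h lam τ ρ ^ 2) + mult η h τ ρ *
          (slope η h lam τ ρ ^ 2 + 2 * ρ * slope η h lam τ ρ * slope' η h lam τ ρ))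
      = E * (mult η h τ ρ + 2 * ρ * mult' η h τ ρ) + ρ * slope η h lam τ ρ ^ 2 *
        (mult η h τ ρ + 2 * ρ * mult' η h τ ρ
          + 2 * mult η h τ ρ * (1 + 2 * ρ * slopeLog η h τ ρ)) := by
    rw [slope']; ring
  have l12 := mul_le_mul_of_nonneg_left (laplacian_mult_le hη0 hη hρ hτ hh hn) (sq_nonneg h)
  have l3' := mul_le_mul_of_nonneg_left l3 hE.le
  have hs := mul_le_mul_of_nonneg_right hsmall hy.le
  have e3 : 3 * h ^ 2 * τ ^ 3 / √(ρ + τ ^ 2) ^ 5 = h ^ 2 * (3 * τ ^ 3 / √(ρ + τ ^ 2) ^ 5) := by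
    ring
  rw [e3] at l6
  rw [e1, e2]
  generalize (n - 1) * (2 * ρ * mult'' η h τ ρ + n * mult' η h τ ρ) = X1 at *
  generalize √(1 + ρ) * cutoff η h ρ / (1 + h ^ 2 * ρ) = y at *
  generalize 3 * τ ^ 3 / √(ρ + τ ^ 2) ^ 5 = X2 at *
  generalize ρ * slope η h lam τ ρ ^ 2 * (mult η h τ ρ + 2 * ρ * mult' η h τ ρ
    + 2 * mult η h τ ρ * (1 + 2 * ρ * slopeLog η h τ ρ)) = X3 at *
  generalize mult η h τ ρ + 2 * ρ * mult' η h τ ρ = X4 at *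
  generalize mult η h τ ρ * V ^ 2 / (h * slope η h lam τ ρ) = X5 at *
  generalize mult η h τ ρ * h * (slope η h lam τ ρ * (1 + 2 * ρ * slopeLog η h τ ρ)) ^ 2
      / slope η h lam τ ρ = X6 at *
  generalize lam ^ 2 * ρ * cutoff η h ρ ^ 2 / (√(ρ + τ ^ 2) ^ 2 * √(1 + ρ) ^ 3 * (1 + h ^ 2 * ρ))
    = X7 at *
  clear * - l12 l3' hs l6 l7 l45
  linarith

end Bounds

end

/-! ### The multiplier identity -/

section

variable {n : ℕ}

/-- Continuous real functions of at most polynomial growth. -/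
def PolyGrowth (f : RSpace n → ℝ) : Prop :=
  Continuous f ∧ ∃ (k : ℕ) (C : ℝ), ∀ x, |f x| ≤ C * (1 + ‖x‖) ^ k

/-- Continuous real functions decaying faster than any power. -/
def RapidDecay (f : RSpace n → ℝ) : Prop :=
  Continuous f ∧ ∀ k : ℕ, ∃ C : ℝ, ∀ x, (1 + ‖x‖) ^ k * |f x| ≤ C

namespace PolyGrowth

theorem of_bounded {f : RSpace n → ℝ} (hf : Continuous f) (C : ℝ) (h : ∀ x, |f x| ≤ C) :
    PolyGrowth f := ⟨hf, 0, C, fun x => by simpa using h x⟩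

theorem const (c : ℝ) : PolyGrowth (fun _ : RSpace n => c) :=
  of_bounded continuous_const |c| fun _ => le_rfl

theorem add {f g : RSpace n → ℝ} (hf : PolyGrowth f) (hg : PolyGrowth g) :
    PolyGrowth fun x => f x + g x := by
  obtain ⟨hf, k, C, hC⟩ := hf
  obtain ⟨hg, l, D, hD⟩ := hg
  refine ⟨hf.add hg, k + l, |C| + |D|, fun x => ?_⟩
  have h1 : 1 ≤ 1 + ‖x‖ := by linarith [norm_nonneg x]
  have hk : (1 + ‖x‖) ^ k ≤ (1 + ‖x‖) ^ (k + l) := pow_le_pow_right₀ h1 (by omega)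
  have hl : (1 + ‖x‖) ^ l ≤ (1 + ‖x‖) ^ (k + l) := pow_le_pow_right₀ h1 (by omega)
  calc |f x + g x| ≤ |f x| + |g x| := abs_add_le _ _
    _ ≤ |C| * (1 + ‖x‖) ^ k + |D| * (1 + ‖x‖) ^ l :=
        add_le_add ((hC x).trans (by gcongr; exact le_abs_self _))
          ((hD x).trans (by gcongr; exact le_abs_self _))
    _ ≤ _ := by rw [add_mul]; gcongr

theorem mul {f g : RSpace n → ℝ} (hf : PolyGrowth f) (hg : PolyGrowth g) :
    PolyGrowth fun x => f x * g x := by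
  obtain ⟨hf, k, C, hC⟩ := hf
  obtain ⟨hg, l, D, hD⟩ := hg
  refine ⟨hf.mul hg, k + l, C * D, fun x => ?_⟩
  rw [abs_mul, pow_add]
  calc |f x| * |g x| ≤ (C * (1 + ‖x‖) ^ k) * (D * (1 + ‖x‖) ^ l) :=
        mul_le_mul (hC x) (hD x) (abs_nonneg _) ((abs_nonneg _).trans (hC x))
    _ = _ := by ring

theorem const_mul {f : RSpace n → ℝ} (hf : PolyGrowth f) (c : ℝ) :
    PolyGrowth fun x => c * f x := (const c).mul hf

theorem coord (j : Fin n) : PolyGrowth fun x : RSpace n => x j := by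
  refine ⟨by fun_prop, 1, 1, fun x => ?_⟩
  have := PiLp.norm_apply_le x j
  rw [Real.norm_eq_abs] at this
  simp; linarith

theorem normSq : PolyGrowth fun x : RSpace n => ‖x‖ ^ 2 := by
  refine ⟨by fun_prop, 2, 1, fun x => ?_⟩
  rw [abs_of_nonneg (by positivity), one_mul]
  exact pow_le_pow_left₀ (norm_nonneg x) (by linarith) 2

end PolyGrowth

namespace RapidDecay

theorem polyGrowth {f : RSpace n → ℝ} (hf : RapidDecay f) : PolyGrowth f := by
  obtain ⟨C, hC⟩ := hf.2 0
  exact .of_bounded hf.1 C fun x => by simpa using hC x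

theorem mul_poly {f g : RSpace n → ℝ} (hf : RapidDecay f) (hg : PolyGrowth g) :
    RapidDecay fun x => f x * g x := by
  obtain ⟨hg, l, D, hD⟩ := hg
  refine ⟨hf.1.mul hg, fun k => ?_⟩
  obtain ⟨C, hC⟩ := hf.2 (k + l)
  refine ⟨C * |D|, fun x => ?_⟩
  have hx := norm_nonneg x
  calc (1 + ‖x‖) ^ k * |f x * g x| = (1 + ‖x‖) ^ k * |f x| * |g x| := by rw [abs_mul]; ring
    _ ≤ (1 + ‖x‖) ^ k * |f x| * (|D| * (1 + ‖x‖) ^ l) := by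
        gcongr
        exact (hD x).trans (by gcongr; exact le_abs_self D)
    _ = ((1 + ‖x‖) ^ (k + l) * |f x|) * |D| := by ring
    _ ≤ _ := by gcongr; exact hC x

theorem add {f g : RSpace n → ℝ} (hf : RapidDecay f) (hg : RapidDecay g) :
    RapidDecay fun x => f x + g x := by
  refine ⟨hf.1.add hg.1, fun k => ?_⟩
  obtain ⟨C, hC⟩ := hf.2 k
  obtain ⟨D, hD⟩ := hg.2 k
  refine ⟨C + D, fun x => ?_⟩
  have hx := norm_nonneg x
  calc (1 + ‖x‖) ^ k * |f x + g x| ≤ (1 + ‖x‖) ^ k * (|f x| + |g x|) := by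
        gcongr; exact abs_add_le _ _
    _ ≤ _ := by rw [mul_add]; exact add_le_add (hC x) (hD x)

theorem const_mul {f : RSpace n → ℝ} (hf : RapidDecay f) (c : ℝ) :
    RapidDecay fun x => c * f x := by
  simpa [mul_comm] using hf.mul_poly (.const c)

theorem sum {ι : Type*} (s : Finset ι) {f : ι → RSpace n → ℝ} (hf : ∀ i ∈ s, RapidDecay (f i)) :
    RapidDecay fun x => ∑ i ∈ s, f i x := by
  classical
  induction s using Finset.induction_on with
  | empty =>
    refine ⟨by simpa using continuous_const, fun k => ⟨0, fun x => by simp⟩⟩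
  | insert a s ha ih =>
    simp only [Finset.sum_insert ha]
    exact (hf a (by simp)).add (ih fun i hi => hf i (by simp [hi]))

theorem integrable {f : RSpace n → ℝ} (hf : RapidDecay f) : Integrable f := by
  obtain ⟨C, hC⟩ := hf.2 (volume : Measure (RSpace n)).integrablePower
  refine ((Measure.integrable_pow_neg_integrablePower
    (volume : Measure (RSpace n))).const_mul C).mono' hf.1.aestronglyMeasurable
    (.of_forall fun x => ?_)
  have hx : 0 < 1 + ‖x‖ := by linarith [norm_nonneg x]
  rw [Real.rpow_neg hx.le, Real.rpow_natCast, Real.norm_eq_abs, ← div_eq_mul_inv,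
    le_div_iff₀ (by positivity), mul_comm]
  exact hC x

end RapidDecay

/-- The `j`-th vector of the standard basis. -/
abbrev stdVec (j : Fin n) : RSpace n := EuclideanSpace.single j 1

/-- `f'` is the `j`-th partial derivative of `f`, and both have polynomial growth. -/
structure PolyDeriv (j : Fin n) (f f' : RSpace n → ℝ) : Prop where
  deriv : ∀ x, HasLineDerivAt ℝ f (f' x) x (stdVec j)
  poly : PolyGrowth f
  poly' : PolyGrowth f'

/-- `f'` is the `j`-th partial derivative of `f`, and both are rapidly decaying. -/
structure RapidDeriv (j : Fin n) (f f' : RSpace n → ℝ) : Prop where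
  deriv : ∀ x, HasLineDerivAt ℝ f (f' x) x (stdVec j)
  rapid : RapidDecay f
  rapid' : RapidDecay f'

theorem _root_.HasLineDerivAt.mul_real {f g : RSpace n → ℝ} {f' g' : ℝ} {x v : RSpace n}
    (hf : HasLineDerivAt ℝ f f' x v) (hg : HasLineDerivAt ℝ g g' x v) :
    HasLineDerivAt ℝ (fun x => f x * g x) (f' * g x + f x * g') x v := by
  have := HasDerivAt.fun_mul hf hg
  simp only [zero_smul, add_zero] at this
  exact this

theorem _root_.HasLineDerivAt.add_real {f g : RSpace n → ℝ} {f' g' : ℝ} {x v : RSpace n}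
    (hf : HasLineDerivAt ℝ f f' x v) (hg : HasLineDerivAt ℝ g g' x v) :
    HasLineDerivAt ℝ (fun x => f x + g x) (f' + g') x v :=
  HasDerivAt.fun_add hf hg

theorem hasLineDerivAt_coord (i j : Fin n) (x : RSpace n) :
    HasLineDerivAt ℝ (fun x : RSpace n => x i) (if i = j then 1 else 0) x (stdVec j) := by
  have h := ((EuclideanSpace.proj (𝕜 := ℝ) i).hasFDerivAt (x := x)).hasLineDerivAt (stdVec j)
  simpa using h

theorem hasLineDerivAt_radial {f : ℝ → ℝ} {f' : ℝ} {x : RSpace n} (hf : HasDerivAt f f' (‖x‖ ^ 2))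
    (j : Fin n) : HasLineDerivAt ℝ (fun x : RSpace n => f (‖x‖ ^ 2)) (2 * x j * f') x (stdVec j) := by
  have h1 := ((hasStrictFDerivAt_norm_sq x).hasFDerivAt).hasLineDerivAt (stdVec j)
  have h2 : HasDerivAt f f' (‖x + (0:ℝ) • stdVec j‖ ^ 2) := by simpa using hf
  have h3 := HasDerivAt.comp (0:ℝ) h2 h1
  refine HasDerivAt.congr_deriv h3 ?_
  simp [EuclideanSpace.inner_single_right]
  ring

namespace PolyDeriv

variable {j : Fin n} {f f' g g' : RSpace n → ℝ}

theorem congr {f'' : RSpace n → ℝ} (hf : PolyDeriv j f f') (h : ∀ x, f' x = f'' x) :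
    PolyDeriv j f f'' := by
  rwa [show f'' = f' from funext fun x => (h x).symm]

theorem mul (hf : PolyDeriv j f f') (hg : PolyDeriv j g g') :
    PolyDeriv j (fun x => f x * g x) fun x => f' x * g x + f x * g' x :=
  ⟨fun x => (hf.deriv x).mul_real (hg.deriv x), hf.poly.mul hg.poly,
    (hf.poly'.mul hg.poly).add (hf.poly.mul hg.poly')⟩

theorem const (c : ℝ) : PolyDeriv j (fun _ => c) fun _ => 0 :=
  ⟨fun _ => hasDerivAt_const _ _, .const c, .const 0⟩

theorem const_mul (hf : PolyDeriv j f f') (c : ℝ) :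
    PolyDeriv j (fun x => c * f x) fun x => c * f' x :=
  ((const c).mul hf).congr fun x => by simp

theorem coord (i : Fin n) : PolyDeriv j (fun x => x i) fun _ => if i = j then 1 else 0 :=
  ⟨hasLineDerivAt_coord i j, .coord i, .const _⟩

end PolyDeriv

namespace RapidDeriv

variable {j : Fin n} {f f' g g' : RSpace n → ℝ}

theorem congr {f'' : RSpace n → ℝ} (hf : RapidDeriv j f f') (h : ∀ x, f' x = f'' x) :
    RapidDeriv j f f'' := by
  rwa [show f'' = f' from funext fun x => (h x).symm]

theorem polyDeriv (hf : RapidDeriv j f f') : PolyDeriv j f f' :=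
  ⟨hf.deriv, hf.rapid.polyGrowth, hf.rapid'.polyGrowth⟩

theorem mul_poly (hf : RapidDeriv j f f') (hg : PolyDeriv j g g') :
    RapidDeriv j (fun x => f x * g x) fun x => f' x * g x + f x * g' x :=
  ⟨fun x => (hf.deriv x).mul_real (hg.deriv x), hf.rapid.mul_poly hg.poly,
    (hf.rapid'.mul_poly hg.poly).add (hf.rapid.mul_poly hg.poly')⟩

theorem add (hf : RapidDeriv j f f') (hg : RapidDeriv j g g') :
    RapidDeriv j (fun x => f x + g x) fun x => f' x + g' x :=
  ⟨fun x => (hf.deriv x).add_real (hg.deriv x), hf.rapid.add hg.rapid, hf.rapid'.add hg.rapid'⟩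

theorem const_mul (hf : RapidDeriv j f f') (c : ℝ) :
    RapidDeriv j (fun x => c * f x) fun x => c * f' x :=
  ⟨fun x => HasDerivAt.const_mul c (hf.deriv x), hf.rapid.const_mul c, hf.rapid'.const_mul c⟩

theorem sum {ι : Type*} (s : Finset ι) {f f' : ι → RSpace n → ℝ}
    (hf : ∀ i ∈ s, RapidDeriv j (f i) (f' i)) :
    RapidDeriv j (fun x => ∑ i ∈ s, f i x) fun x => ∑ i ∈ s, f' i x :=
  ⟨fun x => HasDerivAt.fun_sum fun i hi => (hf i hi).deriv x,
    .sum s fun i hi => (hf i hi).rapid, .sum s fun i hi => (hf i hi).rapid'⟩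

theorem integral_eq_zero (hf : RapidDeriv j f f') : ∫ x, f' x = 0 := by
  have := integral_bilinear_hasLineDerivAt_right_eq_neg_left_of_integrable
    (μ := (volume : Measure (RSpace n))) (f := fun _ => (1 : ℝ)) (f' := fun _ => 0) (g := f)
    (g' := f') (v := stdVec j) (B := ContinuousLinearMap.mul ℝ ℝ) (by simp)
    (by simpa using hf.rapid'.integrable) (by simpa using hf.rapid.integrable)
    (fun x _ => hasDerivAt_const _ _) (fun x _ => hf.deriv x)
  simpa using this

end RapidDeriv

/-- The multiplier identity. Twice the product of `-h² Δu - G u` (with gradient `p = ∇u`, Hessian `H`)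
and `a (x · ∇u + (n - 1) / 2 u)` is, up to quadratic forms in `u` and `∇u`, the divergence of a
rapidly decaying vector field, hence has integral zero. -/
theorem integrable_and_integral_divergence {h : ℝ} {a a' a'' G G' u : RSpace n → ℝ}
    {p : Fin n → RSpace n → ℝ} {H : Fin n → Fin n → RSpace n → ℝ}
    (ha : ∀ j, PolyDeriv j a fun x => 2 * x j * a' x)
    (ha' : ∀ j, PolyDeriv j a' fun x => 2 * x j * a'' x)
    (hG : ∀ j, PolyDeriv j G fun x => 2 * x j * G' x)
    (hu : ∀ j, RapidDeriv j u (p j)) (hp : ∀ j k, RapidDeriv j (p k) (H j k))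
    (hH : ∀ j k x, H j k x = H k j x) :
    ∃ dJ : RSpace n → ℝ, Integrable dJ ∧ ∫ x, dJ x = 0 ∧ ∀ x, dJ x =
      h ^ 2 * (-2 * a x * (∑ j, H j j x) * (∑ k, x k * p k x + (n - 1) / 2 * u x)
        - (∑ k, p k x ^ 2) * (a x - 2 * ‖x‖ ^ 2 * a' x)
        - 4 * a' x * (∑ k, x k * p k x) ^ 2
        + (n - 1) * (2 * ‖x‖ ^ 2 * a'' x + n * a' x) * u x ^ 2)
      - (a x * G x + 2 * ‖x‖ ^ 2 * (a' x * G x + a x * G' x)) * u x ^ 2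
      - 2 * a x * G x * u x * (∑ k, x k * p k x + (n - 1) / 2 * u x) := by
  have hD : ∀ j, RapidDeriv j (fun x => ∑ k, x k * p k x)
      (fun x => p j x + ∑ k, x k * H j k x) := fun j => by
    have h0 : RapidDeriv j (fun x => ∑ k, p k x * x k)
        (fun x => p j x + ∑ k, x k * H j k x) :=
      (RapidDeriv.sum Finset.univ fun k _ => (hp j k).mul_poly (.coord k)).congr fun x => by
        simp [Finset.sum_add_distrib, mul_comm, add_comm]
    have e : (fun x : RSpace n => ∑ k, x k * p k x) = fun x => ∑ k, p k x * x k := by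
      funext x; simp only [mul_comm]
    rwa [e]
  have hP : ∀ j, RapidDeriv j (fun x => ∑ k, p k x * p k x)
      (fun x => 2 * ∑ k, p k x * H j k x) := fun j => by
    refine (RapidDeriv.sum Finset.univ fun k _ =>
      ((hp j k).mul_poly (hp j k).polyDeriv)).congr fun x => ?_
    rw [Finset.mul_sum]
    exact Finset.sum_congr rfl fun k _ => by ring
  have hJ : ∀ j, RapidDeriv j _ _ := fun j =>
    (((((hD j).mul_poly (hp j j).polyDeriv).mul_poly (ha j)).const_mul (-2 * h ^ 2)).add
      ((((hu j).mul_poly (hp j j).polyDeriv).mul_poly (ha j)).const_mul (-(n - 1) * h ^ 2))).add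
      (((((hP j).mul_poly (.coord j)).mul_poly (ha j)).const_mul (h ^ 2)).add
      (((((hu j).mul_poly (hu j).polyDeriv).mul_poly (.coord j)).mul_poly (ha' j)).const_mul
        ((n - 1) * h ^ 2))) |>.add
      (((((hu j).mul_poly (hu j).polyDeriv).mul_poly (.coord j)).mul_poly
        ((ha j).mul (hG j))).const_mul (-1))
  refine ⟨_, integrable_finsetSum Finset.univ fun j _ => (hJ j).rapid'.integrable, ?_, fun x => ?_⟩
  · rw [integral_finsetSum _ fun j _ => (hJ j).rapid'.integrable]
    exact Finset.sum_eq_zero fun j _ => (hJ j).integral_eq_zero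
  set D := ∑ k, x k * p k x with hDdef
  set P := ∑ k, p k x * p k x with hPdef
  have hρ : ∑ j, x j * x j = ‖x‖ ^ 2 := by
    rw [EuclideanSpace.real_norm_sq_eq]
    exact Finset.sum_congr rfl fun k _ => by ring
  have hP2 : ∑ k, p k x ^ 2 = P := Finset.sum_congr rfl fun k _ => by ring
  have hX : ∑ j, x j * ∑ k, p k x * H j k x = ∑ j, p j x * ∑ k, x k * H j k x := by
    simp only [Finset.mul_sum]
    rw [Finset.sum_comm]
    refine Finset.sum_congr rfl fun j _ => Finset.sum_congr rfl fun k _ => ?_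
    rw [hH k j]; ring
  have hn : ∑ _j : Fin n, (1 : ℝ) = n := by simp
  rw [hP2]
  calc _ = ∑ j, ((-4 * h ^ 2 * a' x * D - 2 * a x * G x * u x) * (x j * p j x)
      + (h ^ 2 * (-2 * a x - (n - 1) * a x)) * (p j x * p j x)
      + (-2 * h ^ 2 * a x) * (p j x * ∑ k, x k * H j k x)
      + (h ^ 2 * (-2 * a x * D - (n - 1) * a x * u x)) * H j j x
      + (2 * h ^ 2 * a x) * (x j * ∑ k, p k x * H j k x)
      + (h ^ 2 * (2 * a' x * P + 2 * (n - 1) * a'' x * u x ^ 2)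
          - 2 * (a' x * G x + a x * G' x) * u x ^ 2) * (x j * x j)
      + (h ^ 2 * (a x * P + (n - 1) * a' x * u x ^ 2) - a x * G x * u x ^ 2) * 1) := by
        refine Finset.sum_congr rfl fun j _ => ?_
        simp only [if_true]
        ring
    _ = _ := by
        simp only [Finset.sum_add_distrib, ← Finset.mul_sum]
        rw [hX, hρ, hn, ← hDdef, ← hPdef]
        ring

end

/-! ### Bounds for the multiplier and the phase -/

section

section Asymptotics

variable {η h τ ρ lam : ℝ}

/-- The weight gained in `coercivity` dominates `⟨x⟩^(-2 s)`, uniformly in `h`. -/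
theorem rpow_neg_le_gain {s : ℝ} (hη : 0 ≤ η) (hρ : 0 ≤ ρ) (hh : h ^ 2 ≤ 1) (hs : 1 / 2 + η ≤ s) :
    √(1 + ρ) ^ (-(2 * s)) ≤ √(1 + ρ) * cutoff η h ρ / (1 + h ^ 2 * ρ) := by
  have hq1 : 1 ≤ √(1 + ρ) := Real.one_le_sqrt.2 (by linarith)
  have hq0 : 0 < √(1 + ρ) := by linarith
  have hT : 0 < 1 + h ^ 2 * ρ := by positivity
  rw [mul_div_assoc, cutoff, ← Real.rpow_sub_one hT.ne']
  calc √(1 + ρ) ^ (-(2 * s)) ≤ √(1 + ρ) ^ (1 + (2 * (-η - 1))) :=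
        Real.rpow_le_rpow_of_exponent_le hq1 (by linarith)
    _ = √(1 + ρ) * (√(1 + ρ) ^ 2) ^ (-η - 1) := by
        rw [Real.rpow_add hq0, Real.rpow_one, Real.rpow_mul hq0.le, Real.rpow_two]
    _ ≤ _ := by
        exact mul_le_mul_of_nonneg_left
          (Real.rpow_le_rpow_of_nonpos hT (scale_le hh hρ) (by linarith)) hq0.le

theorem sq_div_scale_le (hh0 : 0 < h) (hh : h ^ 2 ≤ 1) (hρ : 0 ≤ ρ) :
    (1 + ρ) / (1 + h ^ 2 * ρ) ≤ 1 / h ^ 2 := by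
  rw [div_le_div_iff₀ (by positivity) (by positivity)]
  nlinarith

theorem mult_le_slope_mul {s : ℝ} (hη : 0 ≤ η) (hρ : 0 ≤ ρ) (hτ : 0 < τ)
    (hτ1 : τ ≤ 1) (hh0 : 0 < h) (hh : h ^ 2 ≤ 1) (hlam : 0 < lam) (hs : 1 / 2 + η ≤ s) :
    mult η h τ ρ ≤ 3 / (h ^ 3 * lam) * (h * slope η h lam τ ρ) * √(1 + ρ) ^ (2 * s) := by
  have hq1 : 1 ≤ √(1 + ρ) := Real.one_le_sqrt.2 (by linarith)
  have hq0 : 0 < √(1 + ρ) := by linarith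
  have hq2 : √(1 + ρ) ^ 2 = 1 + ρ := Real.sq_sqrt (by positivity)
  have hT : 0 < 1 + h ^ 2 * ρ := by positivity
  have hz : 0 < √(ρ + τ ^ 2) := by positivity
  have hzq : √(ρ + τ ^ 2) ≤ √(1 + ρ) := Real.sqrt_le_sqrt (by nlinarith)
  refine (mult_le hρ hτ hτ1 hh).trans ?_
  have h1 : (√(1 + ρ) ^ (2 * η))⁻¹ ≤ cutoff η h ρ := by
    rw [← Real.rpow_neg hq0.le, cutoff]
    calc √(1 + ρ) ^ (-(2 * η)) = (√(1 + ρ) ^ 2) ^ (-η) := by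
          rw [← Real.rpow_natCast, ← Real.rpow_mul hq0.le]; congr 1; push_cast; ring
      _ ≤ _ := Real.rpow_le_rpow_of_nonpos hT (scale_le hh hρ) (by linarith)
  have h2 : √(1 + ρ) * √(1 + ρ) ^ (2 * η) ≤ √(1 + ρ) ^ (2 * s) := by
    rw [mul_comm, ← Real.rpow_add_one hq0.ne']
    exact Real.rpow_le_rpow_of_exponent_le hq1 (by linarith)
  have h3 : √(1 + ρ) ≤ cutoff η h ρ * √(1 + ρ) ^ (2 * s) := by
    have hp : 0 < √(1 + ρ) ^ (2 * η) := by positivity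
    calc √(1 + ρ) = (√(1 + ρ) ^ (2 * η))⁻¹ * (√(1 + ρ) * √(1 + ρ) ^ (2 * η)) := by field_simp
      _ ≤ cutoff η h ρ * √(1 + ρ) ^ (2 * s) := by
        gcongr
        exact (cutoff_pos hρ).le
  have h4 := sq_div_scale_le hh0 hh hρ
  have h5 : 1 / √(1 + ρ) ≤
      cutoff η h ρ * √(1 + ρ) ^ (2 * s) / (√(ρ + τ ^ 2) * √(1 + ρ)) := by
    rw [div_le_div_iff₀ hq0 (by positivity), one_mul]
    exact mul_le_mul_of_nonneg_right (hzq.trans h3) hq0.le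
  calc 3 * (√(1 + ρ) / (1 + h ^ 2 * ρ))
      = 3 * (√(1 + ρ) ^ 2 / (1 + h ^ 2 * ρ)) * (1 / √(1 + ρ)) := by field_simp
    _ ≤ 3 * (1 / h ^ 2) *
        (cutoff η h ρ * √(1 + ρ) ^ (2 * s) / (√(ρ + τ ^ 2) * √(1 + ρ))) := by
        rw [hq2]
        exact mul_le_mul (mul_le_mul_of_nonneg_left h4 (by norm_num)) h5 (by positivity)
          (by positivity)
    _ = _ := by rw [slope]; field_simp

theorem mult_sq_mul_le (hη : 0 ≤ η) (hρ : 0 ≤ ρ) (hτ : 0 < τ) (hτ1 : τ ≤ 1) (hh0 : 0 < h)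
    (hh : h ^ 2 ≤ 1) : mult η h τ ρ ^ 2 * (1 + ρ) ≤ 9 / h ^ 4 := by
  have h1 := mult_le (η := η) hρ hτ hτ1 hh
  have h2 := pow_le_pow_left₀ (mult_pos hη hρ hτ).le h1 2
  have h4 := pow_le_pow_left₀ (by positivity) (sq_div_scale_le hh0 hh hρ) 2
  have hq2 : √(1 + ρ) ^ 2 = 1 + ρ := Real.sq_sqrt (by positivity)
  calc _ ≤ (3 * (√(1 + ρ) / (1 + h ^ 2 * ρ))) ^ 2 * (1 + ρ) := by gcongr
    _ = 9 * ((1 + ρ) / (1 + h ^ 2 * ρ)) ^ 2 := by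
        rw [mul_pow, div_pow, div_pow, hq2]; field_simp; norm_num
    _ ≤ 9 * (1 / h ^ 2) ^ 2 := by gcongr
    _ = _ := by ring

theorem slope_mul_le (hη : 0 ≤ η) (hρ : 0 ≤ ρ) (hτ : 0 < τ) :
    slope η h lam τ ρ ^ 2 * ρ ≤ lam ^ 2 := by
  have hz2 : √(ρ + τ ^ 2) ^ 2 = ρ + τ ^ 2 := Real.sq_sqrt (by positivity)
  have hq2 : √(1 + ρ) ^ 2 = 1 + ρ := Real.sq_sqrt (by positivity)
  have hm0 := cutoff_pos (η := η) (h := h) hρ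
  have hm1 : cutoff η h ρ ^ 2 ≤ 1 := pow_le_one₀ hm0.le (cutoff_le_one hη hρ)
  rw [slope, div_pow, mul_pow, mul_pow, hz2, hq2, div_mul_eq_mul_div,
    div_le_iff₀ (by positivity)]
  have h1 : ρ ≤ (ρ + τ ^ 2) * (1 + ρ) := by
    nlinarith [sq_nonneg τ, mul_nonneg hρ hρ, mul_nonneg hρ (sq_nonneg τ)]
  have h2 : cutoff η h ρ ^ 2 * ρ ≤ 1 * ((ρ + τ ^ 2) * (1 + ρ)) :=
    mul_le_mul hm1 h1 hρ zero_le_one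
  rw [mul_assoc, ← one_mul ((ρ + τ ^ 2) * (1 + ρ))]
  exact mul_le_mul_of_nonneg_left h2 (sq_nonneg lam)

/-- The Carleman phase as a function of `ρ = |x|²`. The absolute value makes the integrand
continuous on the whole line; only `ρ ≥ 0` matters. -/
def phase (η h lam τ ρ : ℝ) : ℝ := ∫ r in (0 : ℝ)..ρ, slope η h lam τ |r| / 2

theorem continuous_slope_abs (hτ : 0 < τ) : Continuous fun r : ℝ => slope η h lam τ |r| :=
  continuous_iff_continuousAt.2 fun r =>
    ContinuousAt.comp (f := fun r : ℝ => |r|) (hasDerivAt_slope (abs_nonneg r) hτ).continuousAt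
      continuous_abs.continuousAt

theorem hasDerivAt_phase (hρ : 0 ≤ ρ) (hτ : 0 < τ) :
    HasDerivAt (phase η h lam τ) (slope η h lam τ ρ / 2) ρ := by
  have hc : Continuous fun r : ℝ => slope η h lam τ |r| / 2 :=
    (continuous_slope_abs hτ).div_const 2
  have := intervalIntegral.integral_hasDerivAt_right (hc.intervalIntegrable 0 ρ)
    (hc.stronglyMeasurableAtFilter _ _) hc.continuousAt
  rwa [abs_of_nonneg hρ] at this

theorem phase_nonneg (hlam : 0 < lam) (hρ : 0 ≤ ρ) (hτ : 0 < τ) : 0 ≤ phase η h lam τ ρ :=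
  intervalIntegral.integral_nonneg hρ fun r _ => by
    have := slope_pos (η := η) (h := h) hlam (abs_nonneg r) hτ
    exact (half_pos this).le

/-- The slope is bounded by an integrable power of `ρ + τ²`, for any exponent `0 ≤ η' ≤ η`. -/
theorem slope_le_rpow {η' : ℝ} (hη' : 0 ≤ η') (hηη : η' ≤ η) (hρ : 0 ≤ ρ) (hτ : 0 < τ)
    (hτ1 : τ ≤ 1) (hh0 : 0 < h) (hh : h ^ 2 ≤ 1) (hlam : 0 < lam) :
    slope η h lam τ ρ ≤ lam * h ^ (-(2 * η')) * (ρ + τ ^ 2) ^ (-η' - 1) := by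
  have hS : 0 < ρ + τ ^ 2 := by positivity
  have hz : 0 < √(ρ + τ ^ 2) := by positivity
  have hzq : √(ρ + τ ^ 2) ≤ √(1 + ρ) := Real.sqrt_le_sqrt (by nlinarith)
  have h1 : cutoff η h ρ ≤ (h ^ 2 * (ρ + τ ^ 2)) ^ (-η') :=
    calc cutoff η h ρ ≤ (1 + h ^ 2 * ρ) ^ (-η') :=
          Real.rpow_le_rpow_of_exponent_le (one_le_scale hρ) (by linarith)
      _ ≤ _ := Real.rpow_le_rpow_of_nonpos (by positivity)
          (by nlinarith [mul_nonneg (sq_nonneg h) (by nlinarith : 0 ≤ 1 - τ ^ 2)]) (by linarith)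
  rw [slope]
  calc lam * cutoff η h ρ / (√(ρ + τ ^ 2) * √(1 + ρ))
      ≤ lam * (h ^ 2 * (ρ + τ ^ 2)) ^ (-η') / (√(ρ + τ ^ 2) * √(ρ + τ ^ 2)) := by gcongr
    _ = lam * (h ^ 2 * (ρ + τ ^ 2)) ^ (-η') / (ρ + τ ^ 2) := by
        rw [Real.mul_self_sqrt hS.le]
    _ = _ := by
        rw [Real.mul_rpow (by positivity) hS.le, Real.rpow_sub_one hS.ne', ← Real.rpow_natCast h 2,
          ← Real.rpow_mul hh0.le]
        push_cast
        rw [mul_neg]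
        ring

/-- The phase is bounded. The free exponent `η'` is taken to be `1 / log (1 / h)` later, so that the
negative power of `h τ` costs only a constant and `1 / η'` only a logarithm. -/
theorem phase_le {η' : ℝ} (hη' : 0 < η') (hηη : η' ≤ η) (hρ : 0 ≤ ρ) (hτ : 0 < τ)
    (hτ1 : τ ≤ 1) (hh0 : 0 < h) (hh : h ^ 2 ≤ 1) (hlam : 0 < lam) :
    phase η h lam τ ρ ≤ lam / (2 * η') * (h * τ) ^ (-(2 * η')) := by
  set c := lam * h ^ (-(2 * η')) / (2 * η') with hc
  have hc0 : 0 ≤ c := by positivity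
  let g : ℝ → ℝ := fun r => phase η h lam τ r + c * (r + τ ^ 2) ^ (-η')
  have hd : ∀ r, 0 ≤ r → HasDerivAt g (slope η h lam τ r / 2 +
      c * (-η' * (r + τ ^ 2) ^ (-η' - 1))) r := fun r hr => by
    have h1 : HasDerivAt (fun r : ℝ => r + τ ^ 2) 1 r := (hasDerivAt_id r).add_const _
    have h2 := (h1.rpow_const (p := -η') (Or.inl (by positivity))).const_mul c
    refine ((hasDerivAt_phase hr hτ).add h2).congr_deriv ?_
    ring
  have hanti : AntitoneOn g (Set.Ici 0) := by
    refine antitoneOn_of_deriv_nonpos (convex_Ici 0)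
      (fun r hr => (hd r hr).continuousAt.continuousWithinAt)
      (fun r hr => (hd r (interior_subset hr)).differentiableAt.differentiableWithinAt)
      fun r hr => ?_
    rw [(hd r (interior_subset hr)).deriv]
    have := slope_le_rpow hη'.le hηη (interior_subset hr : (0:ℝ) ≤ r) hτ hτ1 hh0 hh hlam
    have e : c * (-η' * (r + τ ^ 2) ^ (-η' - 1))
      = -(lam * h ^ (-(2 * η')) * (r + τ ^ 2) ^ (-η' - 1)) / 2 := by
      rw [hc]; field_simp
    rw [e]; linarith
  have h0 : g ρ ≤ g 0 := hanti (Set.mem_Ici.2 le_rfl) hρ hρ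
  have hp : 0 ≤ c * (ρ + τ ^ 2) ^ (-η') := by positivity
  have e0 : g 0 = lam / (2 * η') * (h * τ) ^ (-(2 * η')) := by
    simp only [g, phase, intervalIntegral.integral_same, zero_add, hc]
    rw [← Real.rpow_natCast τ 2, ← Real.rpow_mul hτ.le, Real.mul_rpow hh0.le hτ.le]
    push_cast
    rw [mul_neg]
    ring
  rw [← e0]
  exact le_trans (le_add_of_nonneg_right hp) h0

end Asymptotics

variable {n : ℕ}

/-- Continuous functions with a positive lower bound. -/
def PosBelow (f : RSpace n → ℝ) : Prop := Continuous f ∧ ∃ c > 0, ∀ x, c ≤ f x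

theorem PosBelow.mul {f g : RSpace n → ℝ} (hf : PosBelow f) (hg : PosBelow g) :
    PosBelow fun x => f x * g x := by
  obtain ⟨hf, c, hc, hc'⟩ := hf
  obtain ⟨hg, d, hd, hd'⟩ := hg
  exact ⟨hf.mul hg, c * d, mul_pos hc hd, fun x =>
    mul_le_mul (hc' x) (hd' x) hd.le (hc.le.trans (hc' x))⟩

theorem PosBelow.pow {f : RSpace n → ℝ} (hf : PosBelow f) (k : ℕ) :
    PosBelow fun x => f x ^ k := by
  obtain ⟨hf, c, hc, hc'⟩ := hf
  exact ⟨hf.pow k, c ^ k, pow_pos hc k, fun x => pow_le_pow_left₀ hc.le (hc' x) k⟩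

theorem PosBelow.const {c : ℝ} (hc : 0 < c) : PosBelow fun _ : RSpace n => c :=
  ⟨continuous_const, c, hc, fun _ => le_rfl⟩

theorem PolyGrowth.div {f g : RSpace n → ℝ} (hf : PolyGrowth f) (hg : PosBelow g) :
    PolyGrowth fun x => f x / g x := by
  obtain ⟨hg, c, hc, hc'⟩ := hg
  have : PolyGrowth fun x => (g x)⁻¹ :=
    .of_bounded (hg.inv₀ fun x => (hc.trans_le (hc' x)).ne') c⁻¹ fun x => by
      rw [abs_inv, abs_of_pos (hc.trans_le (hc' x))]
      exact inv_anti₀ hc (hc' x)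
  simpa only [div_eq_mul_inv] using hf.mul this

theorem posBelow_scale (h : ℝ) : PosBelow fun x : RSpace n => 1 + h ^ 2 * ‖x‖ ^ 2 :=
  ⟨by fun_prop, 1, one_pos, fun _ => one_le_scale (sq_nonneg _)⟩

theorem posBelow_bracket : PosBelow fun x : RSpace n => √(1 + ‖x‖ ^ 2) :=
  ⟨by fun_prop, 1, one_pos, fun x => Real.one_le_sqrt.2 (by nlinarith [norm_nonneg x])⟩

theorem posBelow_sqrt {τ : ℝ} (hτ : 0 < τ) : PosBelow fun x : RSpace n => √(‖x‖ ^ 2 + τ ^ 2) :=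
  ⟨by fun_prop, τ, hτ, fun x => Real.le_sqrt_of_sq_le (by nlinarith [norm_nonneg x])⟩

theorem polyGrowth_bracket : PolyGrowth fun x : RSpace n => √(1 + ‖x‖ ^ 2) := by
  refine ⟨by fun_prop, 1, 1, fun x => ?_⟩
  have := norm_nonneg x
  rw [abs_of_nonneg (Real.sqrt_nonneg _), pow_one, one_mul]
  exact Real.sqrt_le_iff.2 ⟨by linarith, by nlinarith⟩

theorem polyGrowth_cutoff {η h : ℝ} (hη : 0 ≤ η) :
    PolyGrowth fun x : RSpace n => cutoff η h (‖x‖ ^ 2) := by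
  refine .of_bounded ((posBelow_scale h).1.rpow_const fun _ => Or.inl (by positivity)) 1 fun x => ?_
  rw [abs_of_pos (cutoff_pos (sq_nonneg _))]
  exact cutoff_le_one hη (sq_nonneg _)

section Radial

variable {η h τ lam : ℝ}

theorem polyGrowth_affine_cutoff (hη : 0 ≤ η) (c d : ℝ) :
    PolyGrowth fun x : RSpace n => c + d * cutoff η h (‖x‖ ^ 2) :=
  (PolyGrowth.const c).add ((polyGrowth_cutoff hη).const_mul d)

theorem polyGrowth_mult (hη : 0 ≤ η) (hτ : 0 < τ) :
    PolyGrowth fun x : RSpace n => mult η h τ (‖x‖ ^ 2) := by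
  have h1 := ((polyGrowth_bracket.mul (polyGrowth_affine_cutoff (n := n) (h := h) hη 2 (-1))).div
    (posBelow_scale h)).add ((PolyGrowth.const τ).div (posBelow_sqrt hτ))
  convert h1 using 2 with x
  rw [mult]; ring

theorem polyGrowth_mult' (hη : 0 ≤ η) (hτ : 0 < τ) :
    PolyGrowth fun x : RSpace n => mult' η h τ (‖x‖ ^ 2) := by
  have h1 := (((polyGrowth_affine_cutoff (n := n) (h := h) hη 2 (-1)).div
    (((PosBelow.const two_pos).mul posBelow_bracket).mul (posBelow_scale h))).add
    (((polyGrowth_bracket.mul (.const (h ^ 2))).mul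
      (polyGrowth_affine_cutoff (n := n) (h := h) hη (-2) (1 + η))).div
        ((posBelow_scale h).pow 2))).add
    ((PolyGrowth.const (-τ)).div ((PosBelow.const two_pos).mul ((posBelow_sqrt hτ).pow 3)))
  convert h1 using 2 with x
  rw [mult']; ring

theorem polyGrowth_mult'' (hη : 0 ≤ η) (hτ : 0 < τ) :
    PolyGrowth fun x : RSpace n => mult'' η h τ (‖x‖ ^ 2) := by
  have h1 := ((((polyGrowth_affine_cutoff (n := n) (h := h) hη (-2) 1).div
    (((PosBelow.const four_pos).mul (posBelow_bracket.pow 3)).mul (posBelow_scale h))).add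
    (((PolyGrowth.const (h ^ 2)).mul
      (polyGrowth_affine_cutoff (n := n) (h := h) hη (-2) (1 + η))).div
        (posBelow_bracket.mul ((posBelow_scale h).pow 2)))).add
    (((polyGrowth_bracket.mul (.const (h ^ 4))).mul
      (polyGrowth_affine_cutoff (n := n) (h := h) hη 4 (-((1 + η) * (2 + η))))).div
        ((posBelow_scale h).pow 3))).add
    ((PolyGrowth.const (3 * τ)).div ((PosBelow.const four_pos).mul ((posBelow_sqrt hτ).pow 5)))
  convert h1 using 2 with x
  rw [mult'']; ring

theorem polyGrowth_slope (hη : 0 ≤ η) (hτ : 0 < τ) :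
    PolyGrowth fun x : RSpace n => slope η h lam τ (‖x‖ ^ 2) :=
  ((PolyGrowth.const lam).mul (polyGrowth_cutoff hη)).div
    ((posBelow_sqrt hτ).mul posBelow_bracket)

theorem polyGrowth_slope' (hη : 0 ≤ η) (hτ : 0 < τ) :
    PolyGrowth fun x : RSpace n => slope' η h lam τ (‖x‖ ^ 2) := by
  have h1 := (((PolyGrowth.const (-1)).div ((PosBelow.const two_pos).mul
    ((posBelow_sqrt (n := n) hτ).pow 2))).add ((PolyGrowth.const (-1)).div
      ((PosBelow.const two_pos).mul (posBelow_bracket.pow 2)))).add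
    ((PolyGrowth.const (-(η * h ^ 2))).div (posBelow_scale h))
  have h2 := (polyGrowth_slope (n := n) (h := h) (lam := lam) hη hτ).mul h1
  convert h2 using 2 with x
  rw [slope', slopeLog]; ring

theorem PolyDeriv.radial {f f' : ℝ → ℝ} (hf : ∀ ρ, 0 ≤ ρ → HasDerivAt f (f' ρ) ρ)
    (hp : PolyGrowth fun x : RSpace n => f (‖x‖ ^ 2))
    (hp' : PolyGrowth fun x : RSpace n => f' (‖x‖ ^ 2)) (j : Fin n) :
    PolyDeriv j (fun x => f (‖x‖ ^ 2)) fun x => 2 * x j * f' (‖x‖ ^ 2) :=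
  ⟨fun _ => hasLineDerivAt_radial (hf _ (sq_nonneg _)) j, hp,
    ((PolyGrowth.coord j).const_mul 2).mul hp'⟩

end Radial

end

/-! ### Conjugation by the exponential weight -/

section

variable {n : ℕ} {η h τ lam : ℝ}

theorem PolyGrowth.congr {f g : RSpace n → ℝ} (hf : PolyGrowth f) (h : ∀ x, f x = g x) :
    PolyGrowth g := by
  rwa [show g = f from funext fun x => (h x).symm]

theorem phaseFactor_polyDeriv (hη : 0 ≤ η) (hτ : 0 < τ) {M : ℝ}
    (hM : ∀ ρ, 0 ≤ ρ → Real.exp (phase η h lam τ ρ / h) ≤ M) (j : Fin n) :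
    PolyDeriv j (fun x => Real.exp (phase η h lam τ (‖x‖ ^ 2) / h))
      fun x => Real.exp (phase η h lam τ (‖x‖ ^ 2) / h) * (slope η h lam τ (‖x‖ ^ 2) / h * x j) := by
  have hd : ∀ ρ, 0 ≤ ρ → HasDerivAt (fun ρ => Real.exp (phase η h lam τ ρ / h))
      (Real.exp (phase η h lam τ ρ / h) * (slope η h lam τ ρ / 2 / h)) ρ := fun ρ hρ =>
    ((hasDerivAt_phase hρ hτ).div_const h).exp
  have hp : PolyGrowth fun x : RSpace n => Real.exp (phase η h lam τ (‖x‖ ^ 2) / h) := by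
    refine .of_bounded (continuous_iff_continuousAt.2 fun x => ?_) M fun x => ?_
    · exact ContinuousAt.comp (f := fun x : RSpace n => ‖x‖ ^ 2)
        (g := fun ρ => Real.exp (phase η h lam τ ρ / h)) (hd _ (sq_nonneg _)).continuousAt
        (by fun_prop)
    · rw [abs_of_pos (Real.exp_pos _)]; exact hM _ (sq_nonneg _)
  have h2 := PolyDeriv.radial hd hp ((hp.mul (((polyGrowth_slope (n := n) (h := h) (lam := lam) hη
    hτ).const_mul (1 / 2 / h)))).congr fun x => ?_) j
  · exact h2.congr fun x => by ring
  · ring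

/-- The integrated-by-parts form of the conjugated equation: with `W = exp (φ / h)` and `u = W v`,
twice the product of `W (-h² Δ + V - E) v` with the multiplier `a (x · ∇ + (n - 1) / 2) u` is a
divergence plus quadratic forms in `u` and `∇u`. -/
theorem conjugated_identity (E : ℝ) (hη : 0 ≤ η) (hτ : 0 < τ) (hh0 : 0 < h)
    {M : ℝ} (hM : ∀ ρ, 0 ≤ ρ → Real.exp (phase η h lam τ ρ / h) ≤ M)
    {v : RSpace n → ℝ} {dv : Fin n → RSpace n → ℝ} {ddv : Fin n → Fin n → RSpace n → ℝ}
    (hv : ∀ j, RapidDeriv j v (dv j)) (hdv : ∀ j k, RapidDeriv j (dv k) (ddv j k))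
    (hsymm : ∀ j k x, ddv j k x = ddv k j x) :
    ∃ dJ : RSpace n → ℝ, Integrable dJ ∧ ∫ x, dJ x = 0 ∧ ∀ x, ∀ V : ℝ,
      ∀ ρ W a a' a'' ψ ψ' u D L : ℝ,
      ρ = ‖x‖ ^ 2 → W = Real.exp (phase η h lam τ ρ / h) → a = mult η h τ ρ → a' = mult' η h τ ρ →
      a'' = mult'' η h τ ρ → ψ = slope η h lam τ ρ → ψ' = slope' η h lam τ ρ → u = W * v x →
      D = ∑ k, x k * (W * (dv k x + ψ / h * x k * v x)) → L = D + (n - 1) / 2 * u →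
      2 * a * (W * (-(h ^ 2 * ∑ j, ddv j j x) + (V - E) * v x)) * L =
        dJ x + h ^ 2 * ((∑ k, (W * (dv k x + ψ / h * x k * v x)) ^ 2) * (a - 2 * ρ * a')
          + 4 * a' * D ^ 2)
        + (-(h ^ 2 * ((n - 1) * (2 * ρ * a'' + n * a')))
          + (a * (E + ρ * ψ ^ 2) + 2 * ρ * (a' * (E + ρ * ψ ^ 2)
            + a * (ψ ^ 2 + 2 * ρ * ψ * ψ')))) * u ^ 2
        + 4 * h * ψ * a * L ^ 2 + 2 * a * (V + h * (ψ + 2 * ρ * ψ')) * u * L := by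
  have hW := fun j => phaseFactor_polyDeriv (n := n) (lam := lam) hη hτ hM j
  have hψp := polyGrowth_slope (n := n) (h := h) (lam := lam) hη hτ
  have hψ'p := polyGrowth_slope' (n := n) (h := h) (lam := lam) hη hτ
  have hψ := fun j : Fin n => PolyDeriv.radial (fun ρ hρ => hasDerivAt_slope hρ hτ) hψp hψ'p j
  have ha := fun j : Fin n => PolyDeriv.radial (fun ρ hρ => hasDerivAt_mult hρ hτ)
    (polyGrowth_mult (n := n) (h := h) hη hτ) (polyGrowth_mult' hη hτ) j
  have ha' := fun j : Fin n => PolyDeriv.radial (fun ρ hρ => hasDerivAt_mult' hρ hτ)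
    (polyGrowth_mult' (n := n) (h := h) hη hτ) (polyGrowth_mult'' hη hτ) j
  have hGp : PolyGrowth fun x : RSpace n => E + ‖x‖ ^ 2 * slope η h lam τ (‖x‖ ^ 2) ^ 2 :=
    ((PolyGrowth.const E).add (PolyGrowth.normSq.mul (hψp.mul hψp))).congr fun x => by ring
  have hG'p : PolyGrowth fun x : RSpace n => slope η h lam τ (‖x‖ ^ 2) ^ 2
      + 2 * ‖x‖ ^ 2 * slope η h lam τ (‖x‖ ^ 2) * slope' η h lam τ (‖x‖ ^ 2) :=
    ((hψp.mul hψp).add ((PolyGrowth.normSq.const_mul 2).mul (hψp.mul hψ'p))).congr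
      fun x => by ring
  have hGd : ∀ ρ, 0 ≤ ρ → HasDerivAt (fun ρ => E + ρ * slope η h lam τ ρ ^ 2)
      (slope η h lam τ ρ ^ 2 + 2 * ρ * slope η h lam τ ρ * slope' η h lam τ ρ) ρ := fun ρ hρ => by
    have := ((hasDerivAt_id' ρ).fun_mul ((hasDerivAt_slope (η := η) (h := h) (lam := lam) hρ
      hτ).fun_pow 2)).const_add E
    exact this.congr_deriv (by push_cast; ring)
  have hG := fun j : Fin n => PolyDeriv.radial (n := n) hGd hGp hG'p j
  have hu : ∀ j, RapidDeriv j (fun x => v x * Real.exp (phase η h lam τ (‖x‖ ^ 2) / h))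
      (fun x => Real.exp (phase η h lam τ (‖x‖ ^ 2) / h) *
        (dv j x + slope η h lam τ (‖x‖ ^ 2) / h * x j * v x)) := fun j =>
    ((hv j).mul_poly (hW j)).congr fun x => by ring
  have hq : ∀ j k, RapidDeriv j (fun x => Real.exp (phase η h lam τ (‖x‖ ^ 2) / h) *
        (dv k x + slope η h lam τ (‖x‖ ^ 2) / h * x k * v x))
      (fun x => Real.exp (phase η h lam τ (‖x‖ ^ 2) / h) * (ddv j k x
        + slope η h lam τ (‖x‖ ^ 2) / h * (x j * dv k x + x k * dv j x)
        + (slope η h lam τ (‖x‖ ^ 2) / h) ^ 2 * (x j * x k) * v x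
        + 1 / h * (2 * (x j * x k) * slope' η h lam τ (‖x‖ ^ 2)
          + slope η h lam τ (‖x‖ ^ 2) * if k = j then 1 else 0) * v x)) := fun j k => by
    have h1 := ((hdv j k).add ((hv j).mul_poly (((hψ j).mul (.coord k)).const_mul (1 / h)))).mul_poly
      (hW j)
    convert h1 using 1 <;> funext x <;> ring
  obtain ⟨dJ, hJ1, hJ2, hJ3⟩ := integrable_and_integral_divergence (h := h) ha ha' hG hu hq
    fun j k x => by rw [hsymm j k]; simp only [eq_comm (a := j)]; ring
  refine ⟨dJ, hJ1, hJ2, fun x V ρ W a a' a'' ψ ψ' u D L hρ hW ha ha' ha'' hψ hψ' hu hD hL => ?_⟩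
  rw [hJ3 x]
  simp only [if_true, ← hρ, ← hW, ← ha, ← ha', ← ha'', ← hψ, ← hψ']
  have hD' : D = W * (∑ k, x k * dv k x) + W * ψ / h * ρ * v x := by
    rw [hD, hρ, EuclideanSpace.real_norm_sq_eq, Finset.mul_sum, Finset.mul_sum, Finset.sum_mul,
      ← Finset.sum_add_distrib]
    exact Finset.sum_congr rfl fun k _ => by ring
  have hT : h ^ 2 * ∑ j, W * (ddv j j x + ψ / h * (x j * dv j x + x j * dv j x)
        + (ψ / h) ^ 2 * (x j * x j) * v x
        + 1 / h * (2 * (x j * x j) * ψ' + ψ * 1) * v x) =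
      W * (h ^ 2 * ∑ j, ddv j j x) + 2 * h * ψ * D - ρ * ψ ^ 2 * u
        + h * (n * ψ + 2 * ρ * ψ') * u := by
    have e : ∀ j, W * (ddv j j x + ψ / h * (x j * dv j x + x j * dv j x)
        + (ψ / h) ^ 2 * (x j * x j) * v x
        + 1 / h * (2 * (x j * x j) * ψ' + ψ * 1) * v x) =
        W * ddv j j x + 2 * W * (ψ / h) * (x j * dv j x)
          + W * ((ψ / h) ^ 2 + 2 / h * ψ') * v x * x j ^ 2 + W / h * ψ * v x * 1 := fun j => by
      ring
    rw [Finset.sum_congr rfl fun j _ => e j]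
    simp only [Finset.sum_add_distrib, ← Finset.mul_sum]
    rw [← EuclideanSpace.real_norm_sq_eq, ← hρ, hD', hu]
    simp only [Finset.sum_const, Finset.card_univ, Fintype.card_fin, nsmul_eq_mul, mul_one]
    field_simp
    ring
  rw [← hD, mul_comm (v x) W, ← hu, ← hL]
  generalize (∑ j, W * (ddv j j x + ψ / h * (x j * dv j x + x j * dv j x)
        + (ψ / h) ^ 2 * (x j * x j) * v x
        + 1 / h * (2 * (x j * x j) * ψ' + ψ * 1) * v x)) = T at hT ⊢
  have hF : W * (-(h ^ 2 * ∑ j, ddv j j x) + (V - E) * v x) =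
      -(h ^ 2 * T) + 2 * h * ψ * L + h * (ψ + 2 * ρ * ψ') * u + (V - (E + ρ * ψ ^ 2)) * u := by
    rw [hT, hL, hu]; ring
  rw [hF]
  ring

/-- Absorption of the cross terms of `conjugated_identity`, by the arithmetic-geometric mean
inequality, into the positive term `4 h ψ a L²` and the zeroth order coefficient `Q`. -/
theorem absorb_cross_terms {a ψ c Q V φ u L F e b K J ε : ℝ} (hh0 : 0 < h) (ha : 0 < a)
    (hψ : 0 < ψ) (hε : 0 < ε) (hK : 0 ≤ K)
    (hid : 2 * a * (F + e + ε * b) * L = J + K + Q * u ^ 2 + 4 * h * ψ * a * L ^ 2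
      + 2 * a * (V + h * φ) * u * L)
    (hc : c ≤ Q - a * V ^ 2 / (h * ψ) - a * h * φ ^ 2 / ψ) :
    c * u ^ 2 + J ≤ a / (h * ψ) * F ^ 2 + ε⁻¹ * e ^ 2 + ε * b ^ 2 + 2 * ε * (a * L) ^ 2 := by
  have h1 : 2 * a * F * L ≤ a / (h * ψ) * F ^ 2 + h * ψ * a * L ^ 2 := by
    have e1 : a / (h * ψ) * F ^ 2 + h * ψ * a * L ^ 2 - 2 * a * F * L =
      a / (h * ψ) * (F - h * ψ * L) ^ 2 := by field_simp; ring
    have : 0 ≤ a / (h * ψ) * (F - h * ψ * L) ^ 2 := by positivity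
    linarith
  have h2 : -(2 * a * V * u * L) ≤ a * V ^ 2 / (h * ψ) * u ^ 2 + h * ψ * a * L ^ 2 := by
    have e1 : a * V ^ 2 / (h * ψ) * u ^ 2 + h * ψ * a * L ^ 2 + 2 * a * V * u * L =
      a / (h * ψ) * (V * u + h * ψ * L) ^ 2 := by field_simp; ring
    have : 0 ≤ a / (h * ψ) * (V * u + h * ψ * L) ^ 2 := by positivity
    linarith
  have h3 : -(2 * a * (h * φ) * u * L) ≤ a * h * φ ^ 2 / ψ * u ^ 2 + h * ψ * a * L ^ 2 := by
    have e1 : a * h * φ ^ 2 / ψ * u ^ 2 + h * ψ * a * L ^ 2 + 2 * a * (h * φ) * u * L =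
      a * h / ψ * (φ * u + ψ * L) ^ 2 := by field_simp; ring
    have : 0 ≤ a * h / ψ * (φ * u + ψ * L) ^ 2 := by positivity
    linarith
  have h4 : 2 * a * e * L ≤ ε⁻¹ * e ^ 2 + ε * (a * L) ^ 2 := by
    have e1 : ε⁻¹ * e ^ 2 + ε * (a * L) ^ 2 - 2 * a * e * L = ε⁻¹ * (e - ε * (a * L)) ^ 2 := by
      field_simp; ring
    have : 0 ≤ ε⁻¹ * (e - ε * (a * L)) ^ 2 := by positivity
    linarith
  have h5 : 2 * a * (ε * b) * L ≤ ε * b ^ 2 + ε * (a * L) ^ 2 := by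
    nlinarith [mul_nonneg hε.le (sq_nonneg (b - a * L))]
  have h6 : c * u ^ 2 ≤ (Q - a * V ^ 2 / (h * ψ) - a * h * φ ^ 2 / ψ) * u ^ 2 :=
    mul_le_mul_of_nonneg_right hc (sq_nonneg u)
  have h7 : 0 ≤ h * ψ * a * L ^ 2 := by positivity
  linarith

end

/-! ### The pointwise Carleman estimate -/

section

variable {n : ℕ} {η h τ lam : ℝ}

theorem sq_sum_coord_mul_le (x : RSpace n) (p : Fin n → ℝ) :
    (∑ k, x k * p k) ^ 2 ≤ ‖x‖ ^ 2 * ∑ k, p k ^ 2 := by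
  rw [EuclideanSpace.real_norm_sq_eq]
  exact Finset.sum_mul_sq_le_sq_mul_sq _ _ _

/-- Nonnegativity of the quadratic form in the gradient: its angular part has coefficient
`a - 2 ρ a'` and its radial part has coefficient `(a - 2 ρ a') + 4 ρ a' = a + 2 ρ a'`. -/
theorem kinetic_nonneg {a a' ρ P D : ℝ} (hadd : 0 ≤ a + 2 * ρ * a')
    (hsub : 0 ≤ a - 2 * ρ * a') (hP : 0 ≤ P) (hD : D ^ 2 ≤ ρ * P) :
    0 ≤ P * (a - 2 * ρ * a') + 4 * a' * D ^ 2 := by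
  rcases le_total 0 a' with h | h
  · have := mul_nonneg hP hsub
    have := mul_nonneg h (sq_nonneg D)
    linarith
  · have h1 := mul_nonneg hP hadd
    have h2 := mul_le_mul_of_nonpos_left hD h
    nlinarith

/-- A crude bound for the multiplier, by the full `H¹` density; it only enters with a factor `ε`. -/
theorem multiplier_sq_le {N a ψ ρ v D S : ℝ} (hρ : 0 ≤ ρ) (hS : 0 ≤ S) (hN : 3 ≤ N)
    (hh0 : 0 < h) (ha : a ^ 2 * (1 + ρ) ≤ 9 / h ^ 4) (hψ : ψ ^ 2 * ρ ≤ lam ^ 2)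
    (hD : D ^ 2 ≤ ρ * S) :
    (a * (D + ψ * ρ / h * v + (N - 1) / 2 * v)) ^ 2 ≤
      27 / h ^ 4 * (1 + lam ^ 2 / h ^ 2 + N ^ 2) * (S + v ^ 2) := by
  have h2 : D ^ 2 ≤ (1 + ρ) * S := by linarith
  have h3 : (ψ * ρ / h * v) ^ 2 ≤ (1 + ρ) * (lam ^ 2 / h ^ 2 * v ^ 2) := by
    have h30 : (ψ ^ 2 * ρ) * ρ ≤ lam ^ 2 * (1 + ρ) :=
      mul_le_mul hψ (by linarith) hρ (sq_nonneg _)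
    calc (ψ * ρ / h * v) ^ 2 = (ψ ^ 2 * ρ) * ρ * (v ^ 2 / h ^ 2) := by
          field_simp
      _ ≤ lam ^ 2 * (1 + ρ) * (v ^ 2 / h ^ 2) :=
          mul_le_mul_of_nonneg_right h30 (by positivity)
      _ = _ := by ring
  have h4 : ((N - 1) / 2 * v) ^ 2 ≤ (1 + ρ) * (N ^ 2 * v ^ 2) := by
    have : ((N - 1) / 2) ^ 2 ≤ N ^ 2 := by nlinarith
    rw [mul_pow]
    calc _ ≤ N ^ 2 * v ^ 2 := mul_le_mul_of_nonneg_right this (sq_nonneg v)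
      _ ≤ _ := le_mul_of_one_le_left (by positivity) (by linarith)
  have h6 : S + lam ^ 2 / h ^ 2 * v ^ 2 + N ^ 2 * v ^ 2 ≤
      (1 + lam ^ 2 / h ^ 2 + N ^ 2) * (S + v ^ 2) := by
    have h60 : 0 ≤ (lam ^ 2 / h ^ 2 + N ^ 2) * S := by positivity
    linarith [sq_nonneg v]
  have h7 := mul_le_mul_of_nonneg_left h6 (by linarith : 0 ≤ 1 + ρ)
  have h5 : (D + ψ * ρ / h * v + (N - 1) / 2 * v) ^ 2 ≤
      3 * (D ^ 2 + (ψ * ρ / h * v) ^ 2 + ((N - 1) / 2 * v) ^ 2) := by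
    linarith [sq_nonneg (D - ψ * ρ / h * v), sq_nonneg (D - (N - 1) / 2 * v),
      sq_nonneg (ψ * ρ / h * v - (N - 1) / 2 * v)]
  have h9 : 0 ≤ (1 + lam ^ 2 / h ^ 2 + N ^ 2) * (S + v ^ 2) := by positivity
  calc _ = a ^ 2 * (D + ψ * ρ / h * v + (N - 1) / 2 * v) ^ 2 := mul_pow _ _ _
    _ ≤ a ^ 2 * (3 * ((1 + ρ) * ((1 + lam ^ 2 / h ^ 2 + N ^ 2) * (S + v ^ 2)))) :=
        mul_le_mul_of_nonneg_left (by linarith) (sq_nonneg a)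
    _ = 3 * (a ^ 2 * (1 + ρ)) * ((1 + lam ^ 2 / h ^ 2 + N ^ 2) * (S + v ^ 2)) := by ring
    _ ≤ 3 * (9 / h ^ 4) * ((1 + lam ^ 2 / h ^ 2 + N ^ 2) * (S + v ^ 2)) :=
        mul_le_mul_of_nonneg_right (by linarith) h9
    _ = _ := by ring

/-- The conditions on the parameters under which the Carleman estimate holds with weight
`exp (φ / h)` of size at most `M`, for potentials with `|V| ≤ C ⟨x⟩⁻³`. -/
structure Admissible (n : ℕ) (η h τ lam s E C M : ℝ) : Prop where
  η_pos : 0 < η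
  η_le : η ≤ 1 / 2
  le_s : 1 / 2 + η ≤ s
  τ_pos : 0 < τ
  τ_le : τ ≤ 1
  h_pos : 0 < h
  h_sq_le : h ^ 2 ≤ 1
  lam_pos : 0 < lam
  two_mul_lam_mul_τ : 2 * lam * τ = h
  three_le : 3 ≤ n
  E_pos : 0 < E
  potential_le : 48 * C ^ 2 ≤ lam ^ 3 * h
  error_le : 9 * (n : ℝ) ^ 2 * h ^ 2 + (8 * lam ^ 2 * h ^ 2 + 4 * τ * lam ^ 2) + 24 * h * lam
    + (3 * C ^ 2 / lam ^ 2 + 3 * C ^ 2 * h / lam) ≤ η * E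
  exp_phase_le : ∀ ρ, 0 ≤ ρ → Real.exp (phase η h lam τ ρ / h) ≤ M

/-- The pointwise form of the Carleman estimate, up to a divergence `dJ`. -/
theorem carleman_pointwise {s E C M : ℝ} (hadm : Admissible n η h τ lam s E C M)
    {v : RSpace n → ℝ} {dv : Fin n → RSpace n → ℝ} {ddv : Fin n → Fin n → RSpace n → ℝ}
    (hv : ∀ j, RapidDeriv j v (dv j)) (hdv : ∀ j k, RapidDeriv j (dv k) (ddv j k))
    (hsymm : ∀ j k x, ddv j k x = ddv k j x) :
    ∃ dJ : RSpace n → ℝ, Integrable dJ ∧ ∫ x, dJ x = 0 ∧ ∀ x, ∀ V g e b ε : ℝ, 0 < ε →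
      V ^ 2 ≤ C ^ 2 / √(1 + ‖x‖ ^ 2) ^ 6 →
      -(h ^ 2 * ∑ j, ddv j j x) + (V - E) * v x = √(1 + ‖x‖ ^ 2) ^ (-s) * g + e + ε * b →
      η * E * (√(1 + ‖x‖ ^ 2) ^ (-s) * v x) ^ 2 + dJ x ≤ M ^ 2 * (3 / (h ^ 3 * lam) * g ^ 2 +
        ε⁻¹ * e ^ 2 + ε * b ^ 2 + ε * (54 / h ^ 4 * (1 + lam ^ 2 / h ^ 2 + n ^ 2)) *
          (∑ j, dv j x ^ 2 + v x ^ 2)) := by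
  obtain ⟨hη0, hη, hs, hτ, hτ1, hh0, hh, hlam, hlt, hn, hE, hC, hsmall, hM⟩ := hadm
  obtain ⟨dJ, hJ1, hJ2, hJ⟩ := conjugated_identity (lam := lam) E hη0.le hτ hh0 hM hv hdv hsymm
  refine ⟨dJ, hJ1, hJ2, fun x V g e b ε hε hV hF => ?_⟩
  have hid := hJ x V _ _ _ _ _ _ _ _ _ _ rfl rfl rfl rfl rfl rfl rfl rfl rfl rfl
  have hρ : 0 ≤ ‖x‖ ^ 2 := sq_nonneg _
  set ρ := ‖x‖ ^ 2 with hρdef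
  set W := Real.exp (phase η h lam τ ρ / h) with hW
  set a := mult η h τ ρ with ha
  set ψ := slope η h lam τ ρ with hψ
  set q := √(1 + ρ) with hq
  have hq1 : 1 ≤ q := Real.one_le_sqrt.2 (by linarith)
  have hq0 : 0 < q := by linarith
  have ha0 : 0 < a := mult_pos hη0.le hρ hτ
  have hψ0 : 0 < ψ := slope_pos hlam hρ hτ
  have hW1 : 1 ≤ W := Real.one_le_exp (div_nonneg (phase_nonneg hlam hρ hτ) hh0.le)
  have hWM : W ≤ M := hM ρ hρ
  have hM0 : 0 < M := by linarith
  have hWM2 : W ^ 2 ≤ M ^ 2 := pow_le_pow_left₀ (by linarith) hWM 2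
  have hco := coercivity hη0 hη hρ hτ hτ1 hh0 hh hlam hlt (Nat.ofNat_le_cast.2 hn) hE hV hC hsmall
  have hy := rpow_neg_le_gain hη0.le hρ hh hs
  have hy2 : (q ^ (-s)) ^ 2 = q ^ (-(2 * s)) := by
    rw [← Real.rpow_natCast (q ^ (-s)), ← Real.rpow_mul hq0.le]; norm_num; ring_nf
  set p : Fin n → ℝ := fun k => W * (dv k x + ψ / h * x k * v x) with hp
  set D := ∑ k, x k * p k with hD
  have hkin : 0 ≤ h ^ 2 * ((∑ k, p k ^ 2) * (a - 2 * ρ * mult' η h τ ρ)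
      + 4 * mult' η h τ ρ * D ^ 2) := by
    refine mul_nonneg (sq_nonneg h) (kinetic_nonneg ?_ (mult_sub_nonneg hη0 hη hρ hτ)
      (Finset.sum_nonneg fun k _ => sq_nonneg _) (sq_sum_coord_mul_le x p))
    refine le_trans ?_ (gain_le_mult_add hη0 hη hρ hτ hh)
    have := cutoff_pos (η := η) (h := h) hρ
    positivity
  set L := D + ((n : ℝ) - 1) / 2 * (W * v x) with hL
  rw [hF] at hid
  have habs := absorb_cross_terms (F := W * (q ^ (-s) * g)) (e := W * e) (b := W * b) (ε := ε)
    (V := V) (φ := ψ + 2 * ρ * slope' η h lam τ ρ) (u := W * v x) (L := L) (J := dJ x)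
    hh0 ha0 hψ0 hε hkin (by rw [← hid]; ring) hco
  -- the zeroth order term dominates the weighted norm of `v`
  have hlow : η * E * (q ^ (-s) * v x) ^ 2 ≤
      η * E * (q * cutoff η h ρ / (1 + h ^ 2 * ρ)) * (W * v x) ^ 2 := by
    rw [mul_pow, hy2, mul_pow, ← mul_assoc, ← mul_assoc]
    refine mul_le_mul_of_nonneg_right ?_ (sq_nonneg _)
    calc η * E * q ^ (-(2 * s)) ≤ η * E * (q * cutoff η h ρ / (1 + h ^ 2 * ρ)) := by gcongr
      _ ≤ _ := le_mul_of_one_le_right (by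
          have := cutoff_pos (η := η) (h := h) hρ; positivity) (one_le_pow₀ hW1)
  have hg : a / (h * ψ) * (W * (q ^ (-s) * g)) ^ 2 ≤ M ^ 2 * (3 / (h ^ 3 * lam) * g ^ 2) := by
    have h1 : a / (h * ψ) * q ^ (-(2 * s)) ≤ 3 / (h ^ 3 * lam) := by
      rw [Real.rpow_neg hq0.le, ← div_eq_mul_inv, div_div, div_le_iff₀ (by positivity),
        ← mul_assoc]
      exact mult_le_slope_mul hη0.le hρ hτ hτ1 hh0 hh hlam hs
    calc _ = W ^ 2 * (a / (h * ψ) * q ^ (-(2 * s)) * g ^ 2) := by rw [← hy2]; ring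
      _ ≤ _ := by gcongr
  have he : ε⁻¹ * (W * e) ^ 2 ≤ M ^ 2 * (ε⁻¹ * e ^ 2) := by
    rw [mul_pow, mul_left_comm]; gcongr
  have hb : ε * (W * b) ^ 2 ≤ M ^ 2 * (ε * b ^ 2) := by
    rw [mul_pow, mul_left_comm]; gcongr
  have haL : (a * L) ^ 2 ≤ M ^ 2 * (27 / h ^ 4 * (1 + lam ^ 2 / h ^ 2 + n ^ 2) *
      (∑ j, dv j x ^ 2 + v x ^ 2)) := by
    have h1 : L = W * (∑ k, x k * dv k x + ψ * ρ / h * v x + ((n : ℝ) - 1) / 2 * v x) := by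
      have : D = W * (∑ k, x k * dv k x) + W * ψ / h * ρ * v x := by
        rw [hD, hρdef, EuclideanSpace.real_norm_sq_eq, Finset.mul_sum, Finset.mul_sum,
          Finset.sum_mul, ← Finset.sum_add_distrib]
        exact Finset.sum_congr rfl fun k _ => by ring
      rw [hL, this]; ring
    rw [h1, mul_left_comm, mul_pow]
    exact mul_le_mul hWM2 (multiplier_sq_le hρ (Finset.sum_nonneg fun k _ => sq_nonneg _)
      (Nat.ofNat_le_cast.2 hn) hh0 (mult_sq_mul_le hη0.le hρ hτ hτ1 hh0 hh)
      (slope_mul_le hη0.le hρ hτ) (sq_sum_coord_mul_le x fun k => dv k x))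
      (sq_nonneg _) (sq_nonneg _)
  have haL' := mul_le_mul_of_nonneg_left haL (by positivity : 0 ≤ 2 * ε)
  calc _ ≤ _ := add_le_add_left hlow _
    _ ≤ _ := habs
    _ ≤ M ^ 2 * (3 / (h ^ 3 * lam) * g ^ 2) + M ^ 2 * (ε⁻¹ * e ^ 2) + M ^ 2 * (ε * b ^ 2) +
        2 * ε * (M ^ 2 * (27 / h ^ 4 * (1 + lam ^ 2 / h ^ 2 + n ^ 2) *
          (∑ j, dv j x ^ 2 + v x ^ 2))) := by linarith
    _ = _ := by ring

end

/-! ### The Carleman estimate for Schwartz functions -/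

open scoped LineDeriv

section

variable {n : ℕ}

theorem rapidDecay_clm_comp (f : 𝓢(RSpace n, ℂ)) (ℓ : ℂ →L[ℝ] ℝ) : RapidDecay fun x => ℓ (f x) := by
  refine ⟨ℓ.continuous.comp f.continuous, fun k => ⟨‖ℓ‖ * (2 ^ k *
    (Finset.Iic (k, 0)).sup (fun m => SchwartzMap.seminorm ℝ m.1 m.2) f), fun x => ?_⟩⟩
  have h1 := SchwartzMap.one_add_le_sup_seminorm_apply (𝕜 := ℝ) (m := (k, 0)) (k := k) (n := 0)
    le_rfl le_rfl f x
  rw [norm_iteratedFDeriv_zero] at h1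
  have h2 := ℓ.le_opNorm (f x)
  have hx := norm_nonneg x
  calc (1 + ‖x‖) ^ k * |ℓ (f x)| ≤ (1 + ‖x‖) ^ k * (‖ℓ‖ * ‖f x‖) := by gcongr; exact h2
    _ = ‖ℓ‖ * ((1 + ‖x‖) ^ k * ‖f x‖) := by ring
    _ ≤ _ := by gcongr

theorem rapidDeriv_clm_comp (f : 𝓢(RSpace n, ℂ)) (ℓ : ℂ →L[ℝ] ℝ) (j : Fin n) :
    RapidDeriv j (fun x => ℓ (f x)) fun x => ℓ ((∂_{stdVec j} f : 𝓢(RSpace n, ℂ)) x) := by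
  refine ⟨fun x => ?_, rapidDecay_clm_comp f ℓ, rapidDecay_clm_comp _ ℓ⟩
  have h1 := ((ℓ.hasFDerivAt (x := f x)).comp x (f.hasFDerivAt x)).hasLineDerivAt (stdVec j)
  simpa [SchwartzMap.lineDerivOp_apply_eq_fderiv] using! h1

theorem schwartz_lineDerivOp_comm (f : 𝓢(RSpace n, ℂ)) (a b : RSpace n) (x : RSpace n) :
    (∂_{a} (∂_{b} f : 𝓢(RSpace n, ℂ)) : 𝓢(RSpace n, ℂ)) x =
      (∂_{b} (∂_{a} f : 𝓢(RSpace n, ℂ)) : 𝓢(RSpace n, ℂ)) x := by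
  have hd : DifferentiableAt ℝ (fderiv ℝ f) x :=
    ((f.smooth 2).contDiffAt.fderiv_right (m := 1) (by norm_num)).differentiableAt
      (by norm_num)
  have h1 : ∀ a b : RSpace n, (∂_{a} (∂_{b} f : 𝓢(RSpace n, ℂ)) : 𝓢(RSpace n, ℂ)) x =
      fderiv ℝ (fderiv ℝ f) x a b := fun a b => by
    rw [SchwartzMap.lineDerivOp_apply_eq_fderiv]
    have : ⇑(∂_{b} f : 𝓢(RSpace n, ℂ)) = fun y => fderiv ℝ f y b :=
      funext fun y => SchwartzMap.lineDerivOp_apply_eq_fderiv _ _ _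
    rw [this, fderiv_clm_apply hd (differentiableAt_const b)]
    simp
  rw [h1, h1]
  exact ((f.smooth 2).contDiffAt.isSymmSndFDerivAt (by simp)) a b

theorem laplacian_apply_eq_sum (f : 𝓢(RSpace n, ℂ)) (x : RSpace n) :
    (Δ f : 𝓢(RSpace n, ℂ)) x =
      ∑ j : Fin n, (∂_{stdVec j} (∂_{stdVec j} f : 𝓢(RSpace n, ℂ)) : 𝓢(RSpace n, ℂ)) x := by
  rw [SchwartzMap.laplacian_eq_sum (EuclideanSpace.basisFun (Fin n) ℝ)]
  simp only [sum_apply, EuclideanSpace.basisFun_apply]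

theorem L2_norm_sq (u : L2 n) : ‖u‖ ^ 2 = ∫ x, ‖u x‖ ^ 2 := by
  rw [@norm_sq_eq_re_inner ℂ, L2.inner_def, ← integral_re (L2.integrable_inner u u)]
  exact integral_congr_ae (.of_forall fun x => (@norm_sq_eq_re_inner ℂ _ _ _ _ (u x)).symm)

theorem L2_integrable_norm_sq (u : L2 n) : Integrable fun x => ‖u x‖ ^ 2 :=
  (Lp.memLp u).norm.integrable_sq

theorem norm_sq_eq_re_add_im (z : ℂ) : ‖z‖ ^ 2 = z.re ^ 2 + z.im ^ 2 := by
  rw [Complex.sq_norm, Complex.normSq_apply]; ring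

/-- The class in `L²(ℝⁿ)` of a Schwartz function. -/
def schwartzToL2 (f : 𝓢(RSpace n, ℂ)) : L2 n := f.toLp 2 volume

theorem schwartzToL2_coeFn (f : 𝓢(RSpace n, ℂ)) : (schwartzToL2 f : RSpace n → ℂ) =ᵐ[volume] f :=
  f.coeFn_toLp 2 volume

theorem weightOp_coeFn {s : ℝ} (hs : 0 ≤ s) (u : L2 n) :
    (weightOp n s hs u : RSpace n → ℂ) =ᵐ[volume]
      fun x => ((√(1 + ‖x‖ ^ 2) ^ (-s) : ℝ) : ℂ) * u x := mulOp_coeFn _ _ u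

/-- The pointwise Carleman estimate for a real component `ℓ ∘ f`, such as the real or imaginary
part, of a Schwartz function. -/
theorem carleman_component {η h τ lam s E C M : ℝ} (hadm : Admissible n η h τ lam s E C M)
    (f : 𝓢(RSpace n, ℂ)) (ℓ : ℂ →L[ℝ] ℝ) :
    ∃ dJ : RSpace n → ℝ, Integrable dJ ∧ ∫ x, dJ x = 0 ∧ ∀ x, ∀ V g e b ε : ℝ, 0 < ε →
      V ^ 2 ≤ C ^ 2 / √(1 + ‖x‖ ^ 2) ^ 6 →
      -(h ^ 2 * ℓ ((Δ f : 𝓢(RSpace n, ℂ)) x)) + (V - E) * ℓ (f x) =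
        √(1 + ‖x‖ ^ 2) ^ (-s) * g + e + ε * b →
      η * E * (√(1 + ‖x‖ ^ 2) ^ (-s) * ℓ (f x)) ^ 2 + dJ x ≤ M ^ 2 * (3 / (h ^ 3 * lam) * g ^ 2 +
        ε⁻¹ * e ^ 2 + ε * b ^ 2 + ε * (54 / h ^ 4 * (1 + lam ^ 2 / h ^ 2 + n ^ 2)) *
          (∑ j : Fin n, ℓ ((∂_{stdVec j} f : 𝓢(RSpace n, ℂ)) x) ^ 2 + ℓ (f x) ^ 2)) := by
  have hsymm : ∀ (j k : Fin n) (x : RSpace n),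
      ℓ ((∂_{stdVec j} (∂_{stdVec k} f : 𝓢(RSpace n, ℂ)) : 𝓢(RSpace n, ℂ)) x) =
      ℓ ((∂_{stdVec k} (∂_{stdVec j} f : 𝓢(RSpace n, ℂ)) : 𝓢(RSpace n, ℂ)) x) := fun j k x => by
    rw [schwartz_lineDerivOp_comm]
  obtain ⟨dJ, h1, h2, h3⟩ := carleman_pointwise hadm (fun j => rapidDeriv_clm_comp f ℓ j)
    (fun j k => rapidDeriv_clm_comp (∂_{stdVec k} f) ℓ j) hsymm
  refine ⟨dJ, h1, h2, fun x V g e b ε hε hV hF => h3 x V g e b ε hε hV ?_⟩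
  rwa [laplacian_apply_eq_sum, map_sum] at hF

/-- The Carleman estimate for Schwartz functions, in integrated form. The equation has a weighted
source `⟨x⟩⁻ˢ g` and a remainder `e`; the terms `± i ε f` couple the real and imaginary parts and are
treated as sources. -/
theorem carleman_schwartz {η h τ lam s E C M : ℝ} (hadm : Admissible n η h τ lam s E C M)
    (hs : 0 ≤ s) {V : RSpace n → ℝ} (hV : ∀ᵐ x, V x ^ 2 ≤ C ^ 2 / √(1 + ‖x‖ ^ 2) ^ 6)
    {σ ε : ℝ} (hσ : σ ^ 2 = 1) (hε : 0 < ε) (f : 𝓢(RSpace n, ℂ)) (g e : L2 n)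
    (hf : ∀ᵐ x, -((h : ℂ) ^ 2 * (Δ f : 𝓢(RSpace n, ℂ)) x) + ((V x - E : ℝ) : ℂ) * f x
      + (σ * ε : ℝ) * Complex.I * f x = ((√(1 + ‖x‖ ^ 2) ^ (-s) : ℝ) : ℂ) * g x + e x) :
    η * E * ‖weightOp n s hs (schwartzToL2 f)‖ ^ 2 ≤ M ^ 2 * (3 / (h ^ 3 * lam) * ‖g‖ ^ 2 +
      ε⁻¹ * ‖e‖ ^ 2 + ε * ‖schwartzToL2 f‖ ^ 2 +
      ε * (54 / h ^ 4 * (1 + lam ^ 2 / h ^ 2 + n ^ 2)) *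
        (∑ j : Fin n, ‖schwartzToL2 (∂_{stdVec j} f)‖ ^ 2
          + ‖schwartzToL2 f‖ ^ 2)) := by
  obtain ⟨dJ, hJ1, hJ2, hJ⟩ := carleman_component hadm f Complex.reCLM
  obtain ⟨dK, hK1, hK2, hK⟩ := carleman_component hadm f Complex.imCLM
  simp only [Complex.reCLM_apply] at hJ
  simp only [Complex.imCLM_apply] at hK
  set c := 54 / h ^ 4 * (1 + lam ^ 2 / h ^ 2 + (n : ℝ) ^ 2) with hc
  set w := weightOp n s hs (schwartzToL2 f) with hw
  set F := schwartzToL2 f with hF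
  set dF : Fin n → L2 n := fun j => schwartzToL2 (∂_{stdVec j} f)
    with hdF
  have hdFx : ∀ᵐ x, ∀ j, dF j x = (∂_{stdVec j} f : 𝓢(RSpace n, ℂ)) x :=
    ae_all_iff.2 fun j => schwartzToL2_coeFn _
  have hpt : ∀ᵐ x, η * E * ‖w x‖ ^ 2 + (dJ x + dK x) ≤ M ^ 2 * (3 / (h ^ 3 * lam) * ‖g x‖ ^ 2 +
      ε⁻¹ * ‖e x‖ ^ 2 + ε * ‖F x‖ ^ 2 + ε * c * (∑ j, ‖dF j x‖ ^ 2 + ‖F x‖ ^ 2)) := by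
    filter_upwards [hV, hf, hdFx, weightOp_coeFn hs F, schwartzToL2_coeFn f]
      with x hVx hfx hdx hwx hFx
    rw [hFx] at hwx
    have hr := congrArg Complex.re hfx
    have hi := congrArg Complex.im hfx
    have e1 : (h : ℂ) ^ 2 = ((h ^ 2 : ℝ) : ℂ) := by push_cast; rfl
    rw [e1] at hr hi
    simp only [Complex.add_re, Complex.add_im, Complex.neg_re, Complex.neg_im,
      Complex.re_ofReal_mul, Complex.im_ofReal_mul, mul_assoc, Complex.I_mul_re, Complex.I_mul_im] at hr hi
    -- the term `i σ ε f` contributes `-σ ε Im f` to the real part and `σ ε Re f` to the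
    -- imaginary part
    have h1 := hJ x (V x) (g x).re (e x).re (σ * (f x).im) ε hε hVx (by linarith)
    have h2 := hK x (V x) (g x).im (e x).im (-σ * (f x).re) ε hε hVx (by linarith)
    simp only [mul_pow σ, neg_sq, mul_pow (-σ), hσ,
      one_mul] at h1 h2
    rw [hwx, hFx]
    simp only [hdx, norm_sq_eq_re_add_im, Complex.re_ofReal_mul, Complex.im_ofReal_mul,
      Finset.sum_add_distrib]
    linarith
  have hint := integral_mono_ae
    (((L2_integrable_norm_sq w).const_mul (η * E)).add (hJ1.add hK1))
    (((((L2_integrable_norm_sq g).const_mul (3 / (h ^ 3 * lam))).add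
      ((L2_integrable_norm_sq e).const_mul ε⁻¹)).add
      ((L2_integrable_norm_sq F).const_mul ε)).add
      (((integrable_finsetSum Finset.univ fun j _ => L2_integrable_norm_sq (dF j)).add
        (L2_integrable_norm_sq F)).const_mul (ε * c)) |>.const_mul (M ^ 2)) hpt
  have hl : ∫ x, (η * E * ‖w x‖ ^ 2 + (dJ x + dK x)) = η * E * ‖w‖ ^ 2 := by
    have hJK : Integrable (fun x => dJ x + dK x) := hJ1.add hK1
    rw [integral_add ((L2_integrable_norm_sq w).const_mul _) hJK,
      integral_add hJ1 hK1, hJ2, hK2, integral_const_mul, L2_norm_sq]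
    ring
  have hr : ∫ x, M ^ 2 * (3 / (h ^ 3 * lam) * ‖g x‖ ^ 2 + ε⁻¹ * ‖e x‖ ^ 2 + ε * ‖F x‖ ^ 2 +
      ε * c * (∑ j, ‖dF j x‖ ^ 2 + ‖F x‖ ^ 2)) =
      M ^ 2 * (3 / (h ^ 3 * lam) * ‖g‖ ^ 2 + ε⁻¹ * ‖e‖ ^ 2 + ε * ‖F‖ ^ 2 +
      ε * c * (∑ j, ‖dF j‖ ^ 2 + ‖F‖ ^ 2)) := by
    have i1 := (L2_integrable_norm_sq g).const_mul (3 / (h ^ 3 * lam))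
    have i2 := (L2_integrable_norm_sq e).const_mul ε⁻¹
    have i3 := (L2_integrable_norm_sq F).const_mul ε
    have i4 := integrable_finsetSum Finset.univ fun j _ => L2_integrable_norm_sq (dF j)
    have i12 : Integrable fun x => 3 / (h ^ 3 * lam) * ‖g x‖ ^ 2 + ε⁻¹ * ‖e x‖ ^ 2 := i1.add i2
    have i123 : Integrable fun x => 3 / (h ^ 3 * lam) * ‖g x‖ ^ 2 + ε⁻¹ * ‖e x‖ ^ 2
      + ε * ‖F x‖ ^ 2 := i12.add i3
    have i5 : Integrable fun x => ε * c * (∑ j, ‖dF j x‖ ^ 2 + ‖F x‖ ^ 2) :=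
      (i4.add (L2_integrable_norm_sq F)).const_mul (ε * c)
    rw [integral_const_mul, integral_add i123 i5, integral_add i12 i3,
      integral_add i1 i2, integral_const_mul, integral_const_mul, integral_const_mul,
      integral_const_mul, integral_add i4 (L2_integrable_norm_sq F),
      integral_finsetSum _ fun j _ => L2_integrable_norm_sq (dF j)]
    simp only [L2_norm_sq]
  exact hl.ge.trans (hint.trans hr.le)

end

/-! ### Density of Schwartz functions in `H²` -/

section

variable {n : ℕ}

theorem schwartzToL2_toTemperedDistribution (f : 𝓢(RSpace n, ℂ)) :
    (schwartzToL2 f : 𝓢'(RSpace n, ℂ)) = SchwartzMap.toTemperedDistributionCLM (RSpace n) ℂ volume f :=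
  Lp.toTemperedDistribution_toLp_eq f

theorem schwartzToL2_mem_H2 (f : 𝓢(RSpace n, ℂ)) : schwartzToL2 f ∈ H2 n := by
  change MemSobolev 2 2 (schwartzToL2 f : 𝓢'(RSpace n, ℂ))
  rw [schwartzToL2_toTemperedDistribution]
  exact SchwartzMap.memSobolev f

theorem laplacianH2_eq_iff {u : H2 n} {w : L2 n} :
    laplacianH2 n u = w ↔ (w : 𝓢'(RSpace n, ℂ)) = Δ ((u : L2 n) : 𝓢'(RSpace n, ℂ)) := by
  rw [← laplacianH2_spec]
  exact ⟨fun h => by rw [h], fun h => (toTemperedDistribution_injective h).symm⟩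

theorem laplacianH2_schwartzToL2 (f : 𝓢(RSpace n, ℂ)) :
    laplacianH2 n ⟨schwartzToL2 f, schwartzToL2_mem_H2 f⟩ = schwartzToL2 (Δ f) := by
  rw [laplacianH2_eq_iff, schwartzToL2_toTemperedDistribution]
  change _ = Δ (schwartzToL2 f : 𝓢'(RSpace n, ℂ))
  rw [schwartzToL2_toTemperedDistribution, laplacian_toTemperedDistributionCLM_eq]

/-- The Bessel potential of order `2` is `1 - (2 π)⁻² Δ` in the normalization of Mathlib. -/
theorem laplacian_eq_besselPotential (u : 𝓢'(RSpace n, ℂ)) :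
    Δ u = ((2 * Real.pi) ^ 2 : ℝ) • (u - besselPotential (RSpace n) ℂ 2 u) := by
  have h1 : fourierMultiplierCLM ℂ (fun x : RSpace n => Complex.ofReal (‖x‖ ^ 2)) u =
      besselPotential (RSpace n) ℂ 2 u - u := by
    ext φ
    have h2 : (fun x : RSpace n => (((1 + ‖x‖ ^ 2) ^ ((2 : ℝ) / 2) : ℝ) : ℂ)) =
        (fun x => Complex.ofReal (‖x‖ ^ 2)) + fun _ => 1 := by
      funext x; simp; ring
    have h3 : besselPotential (RSpace n) ℂ 2 u φ = fourierMultiplierCLM ℂ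
      (fun x : RSpace n => Complex.ofReal (‖x‖ ^ 2)) u φ + u φ := by
      rw [besselPotential, h2, fourierMultiplierCLM_apply_apply, fourierMultiplierCLM_apply_apply,
        SchwartzMap.smulLeftCLM_add (by fun_prop) (by fun_prop)]
      simp
    change _ = besselPotential (RSpace n) ℂ 2 u φ - u φ
    rw [h3]; ring
  rw [laplacian_eq_fourierMultiplierCLM, h1, neg_smul, ← smul_neg, neg_sub]

/-- Integration by parts, `⟨f, Δf⟩ = -‖∇f‖²`. -/
theorem inner_schwartz_laplacian (f : 𝓢(RSpace n, ℂ)) :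
    inner ℂ (schwartzToL2 f) (schwartzToL2 (Δ f)) =
      -((∑ j : Fin n, ‖schwartzToL2 (∂_{stdVec j} f)‖ ^ 2 : ℝ) : ℂ) := by
  have hΔ : schwartzToL2 (Δ f) = ∑ j : Fin n, schwartzToL2 (∂_{stdVec j} (∂_{stdVec j} f)) := by
    rw [SchwartzMap.laplacian_eq_sum (EuclideanSpace.basisFun (Fin n) ℝ)]
    simp only [EuclideanSpace.basisFun_apply]
    exact map_sum (SchwartzMap.toLpCLM ℂ ℂ 2 (volume : Measure (RSpace n))) _ _
  rw [hΔ, inner_sum, Complex.ofReal_sum, ← Finset.sum_neg_distrib]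
  refine Finset.sum_congr rfl fun j _ => ?_
  have h1 := SchwartzMap.integral_bilinear_lineDerivOp_right_eq_neg_left
    (μ := (volume : Measure (RSpace n))) f (∂_{stdVec j} f)
    ((ContinuousLinearMap.mul ℝ ℂ).comp Complex.conjCLE.toContinuousLinearMap) (stdVec j)
  have h2 : ∀ a b : 𝓢(RSpace n, ℂ), inner ℂ (schwartzToL2 a) (schwartzToL2 b) =
      ∫ x, (ContinuousLinearMap.mul ℝ ℂ).comp Complex.conjCLE.toContinuousLinearMap (a x) (b x) :=
    fun a b => (SchwartzMap.inner_toL2_toL2_eq a b _).trans (integral_congr_ae (.of_forall fun x =>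
      (mul_comm _ _)))
  rw [h2, h1, ← h2, Complex.ofReal_pow]
  congr 1
  exact inner_self_eq_norm_sq_to_K (𝕜 := ℂ) _

/-- Applied to `w = Δu`, this controls the graph norm by the norm of `u - c Δu`. -/
theorem norm_sq_add_le_of_inner {u w : L2 n} {c : ℝ} (hc : 0 ≤ c)
    (h : (inner ℂ u w).re ≤ 0) : ‖u‖ ^ 2 + c ^ 2 * ‖w‖ ^ 2 ≤ ‖u - (c : ℂ) • w‖ ^ 2 := by
  rw [@norm_sub_sq ℂ, inner_smul_right, norm_smul, mul_pow]
  simp only [RCLike.re_eq_complex_re, Complex.re_ofReal_mul, Complex.norm_real, Real.norm_eq_abs,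
    sq_abs]
  nlinarith

theorem besselConst_pos : (0 : ℝ) < ((2 * Real.pi) ^ 2)⁻¹ := by positivity

theorem sub_smul_laplacian (u : 𝓢'(RSpace n, ℂ)) :
    u - ((2 * Real.pi) ^ 2)⁻¹ • Δ u = besselPotential (RSpace n) ℂ 2 u := by
  rw [laplacian_eq_besselPotential, smul_smul, inv_mul_cancel₀ (by positivity), one_smul,
    sub_sub_cancel]

theorem toTemperedDistribution_sub_smul (u w : L2 n) (c : ℝ) :
    ((u - (c : ℂ) • w : L2 n) : 𝓢'(RSpace n, ℂ)) = (u : 𝓢'(RSpace n, ℂ)) - c • (w : 𝓢'(RSpace n, ℂ)) := by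
  simp only [← Lp.toTemperedDistributionCLM_apply, map_sub, map_smul]
  rfl

/-- `1 - (2 π)⁻² Δ` is surjective on Schwartz functions, by Fourier multiplication. -/
theorem exists_schwartz_bessel (g : 𝓢(RSpace n, ℂ)) : ∃ f : 𝓢(RSpace n, ℂ),
    schwartzToL2 f - ((((2 * Real.pi) ^ 2)⁻¹ : ℝ) : ℂ) • schwartzToL2 (Δ f) = schwartzToL2 g := by
  refine ⟨SchwartzMap.fourierMultiplierCLM ℂ
    (fun x : RSpace n => (((1 + ‖x‖ ^ 2) ^ ((-2 : ℝ) / 2) : ℝ) : ℂ)) g, ?_⟩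
  set f := SchwartzMap.fourierMultiplierCLM ℂ
    (fun x : RSpace n => (((1 + ‖x‖ ^ 2) ^ ((-2 : ℝ) / 2) : ℝ) : ℂ)) g with hf
  have h1 : (schwartzToL2 f : 𝓢'(RSpace n, ℂ)) =
      besselPotential (RSpace n) ℂ (-2) (schwartzToL2 g : 𝓢'(RSpace n, ℂ)) := by
    rw [schwartzToL2_toTemperedDistribution, schwartzToL2_toTemperedDistribution, besselPotential,
      fourierMultiplierCLM_toTemperedDistributionCLM_eq (by fun_prop)]
  apply toTemperedDistribution_injective
  rw [← laplacianH2_schwartzToL2, toTemperedDistribution_sub_smul,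
    laplacianH2_spec, sub_smul_laplacian, h1, besselPotential_besselPotential_apply]
  simp

open Filter Topology in
/-- Schwartz functions are dense in `H²(ℝⁿ)` for the graph norm of the Laplacian. -/
theorem exists_schwartz_tendsto (u : H2 n) : ∃ f : ℕ → 𝓢(RSpace n, ℂ),
    Tendsto (fun k => schwartzToL2 (f k)) atTop (𝓝 (u : L2 n)) ∧
      Tendsto (fun k => schwartzToL2 (Δ (f k))) atTop (𝓝 (laplacianH2 n u)) := by
  set c : ℝ := ((2 * Real.pi) ^ 2)⁻¹ with hc
  have hc0 : 0 < c := besselConst_pos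
  set g : L2 n := u - (c : ℂ) • laplacianH2 n u with hg
  have hden : DenseRange (SchwartzMap.toLpCLM ℝ ℂ 2 (volume : Measure (RSpace n))) :=
    SchwartzMap.denseRange_toLpCLM ENNReal.ofNat_ne_top
  obtain ⟨y, hy, hyg⟩ := mem_closure_iff_seq_limit.1 (hden g)
  choose gk hgk using hy
  choose f hf using fun k => exists_schwartz_bessel (gk k)
  have hlim : Tendsto (fun k => schwartzToL2 (f k) - (c : ℂ) • schwartzToL2 (Δ (f k))) atTop
      (𝓝 g) := by
    refine hyg.congr fun k => ?_
    rw [← hgk k]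
    exact (hf k).symm
  have hen : ∀ k l, ‖schwartzToL2 (f k) - schwartzToL2 (f l)‖ ^ 2 +
      c ^ 2 * ‖schwartzToL2 (Δ (f k)) - schwartzToL2 (Δ (f l))‖ ^ 2 ≤
      ‖(schwartzToL2 (f k) - (c : ℂ) • schwartzToL2 (Δ (f k))) -
        (schwartzToL2 (f l) - (c : ℂ) • schwartzToL2 (Δ (f l)))‖ ^ 2 := fun k l => by
    have e1 : ∀ a b : 𝓢(RSpace n, ℂ), schwartzToL2 a - schwartzToL2 b = schwartzToL2 (a - b) :=
      fun a b => (map_sub (SchwartzMap.toLpCLM ℂ ℂ 2 (volume : Measure (RSpace n))) a b).symm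
    have e2 : Δ (f k) - Δ (f l) = Δ (f k - f l) :=
      (map_sub (LineDeriv.laplacianCLM ℝ (RSpace n) 𝓢(RSpace n, ℂ)) (f k) (f l)).symm
    have := norm_sq_add_le_of_inner (u := schwartzToL2 (f k - f l))
      (w := schwartzToL2 (Δ (f k - f l))) hc0.le (by
        rw [inner_schwartz_laplacian, ← Complex.ofReal_neg, Complex.ofReal_re]
        exact neg_nonpos.2 (Finset.sum_nonneg fun _ _ => sq_nonneg _))
    rw [← e2, ← e1, ← e1] at this
    convert this using 3
    module
  have hcau := hlim.cauchySeq
  have hcF : CauchySeq fun k => schwartzToL2 (f k) := by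
    refine Metric.cauchySeq_iff.2 fun ε hε => ?_
    obtain ⟨N, hN⟩ := Metric.cauchySeq_iff.1 hcau ε hε
    refine ⟨N, fun k hk l hl => lt_of_le_of_lt ?_ (hN k hk l hl)⟩
    rw [dist_eq_norm, dist_eq_norm]
    exact le_of_sq_le_sq (by nlinarith [hen k l, sq_nonneg (c *
      ‖schwartzToL2 (Δ (f k)) - schwartzToL2 (Δ (f l))‖)]) (norm_nonneg _)
  have hcD : CauchySeq fun k => schwartzToL2 (Δ (f k)) := by
    refine Metric.cauchySeq_iff.2 fun ε hε => ?_
    obtain ⟨N, hN⟩ := Metric.cauchySeq_iff.1 hcau (c * ε) (by positivity)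
    refine ⟨N, fun k hk l hl => lt_of_mul_lt_mul_left (lt_of_le_of_lt ?_ (hN k hk l hl)) hc0.le⟩
    rw [dist_eq_norm, dist_eq_norm]
    refine le_of_sq_le_sq ?_ (norm_nonneg _)
    rw [mul_pow]
    nlinarith [hen k l, sq_nonneg ‖schwartzToL2 (f k) - schwartzToL2 (f l)‖]
  obtain ⟨u', hu'⟩ := cauchySeq_tendsto_of_complete hcF
  obtain ⟨w', hw'⟩ := cauchySeq_tendsto_of_complete hcD
  have hg' : u' - (c : ℂ) • w' = g := tendsto_nhds_unique (hu'.sub (hw'.const_smul (c : ℂ))) hlim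
  have hΔ : (w' : 𝓢'(RSpace n, ℂ)) = Δ (u' : 𝓢'(RSpace n, ℂ)) := by
    have h1 := ((Lp.toTemperedDistributionCLM ℂ (volume : Measure (RSpace n)) 2).continuous.tendsto
      w').comp hw'
    have h2 := ((LineDeriv.laplacianCLM ℝ (RSpace n) 𝓢'(RSpace n, ℂ)).continuous.tendsto _).comp
      (((Lp.toTemperedDistributionCLM ℂ (volume : Measure (RSpace n)) 2).continuous.tendsto
      u').comp hu')
    refine tendsto_nhds_unique h1 (h2.congr fun k => ?_)
    simp only [Function.comp]
    rw [← laplacianH2_schwartzToL2]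
    exact (laplacianH2_spec ⟨schwartzToL2 (f k), schwartzToL2_mem_H2 (f k)⟩).symm
  have hb : besselPotential (RSpace n) ℂ 2 (u' : 𝓢'(RSpace n, ℂ)) =
      besselPotential (RSpace n) ℂ 2 ((u : L2 n) : 𝓢'(RSpace n, ℂ)) := by
    rw [← sub_smul_laplacian, ← sub_smul_laplacian, ← hΔ, ← laplacianH2_spec,
      ← toTemperedDistribution_sub_smul, ← toTemperedDistribution_sub_smul]
    exact congrArg _ hg'
  have huu : u' = u := toTemperedDistribution_injective (by
    simpa using congrArg (besselPotential (RSpace n) ℂ (-2)) hb)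
  subst huu
  refine ⟨f, hu', ?_⟩
  rwa [laplacianH2_eq_iff.2 hΔ]

end

/-! ### Surjectivity by continuity -/

section

section Continuation

variable {D H : Type*} [AddCommGroup D] [Module ℂ D] [NormedAddCommGroup H] [NormedSpace ℂ H]

/-- A surjective operator that is bounded below has a bounded inverse. -/
theorem exists_bounded_inverse {ι T : D →ₗ[ℂ] H} (hι : Function.Injective ι) {c : ℝ} (hc : 0 < c)
    (hT : ∀ u, c * ‖ι u‖ ≤ ‖T u‖) (hsurj : Function.Surjective T) :
    ∃ R : H →L[ℂ] H, (∀ f, ∃ u, ι u = R f ∧ T u = f) ∧ (∀ u, R (T u) = ι u) ∧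
      ∀ f, ‖R f‖ ≤ c⁻¹ * ‖f‖ := by
  have hinj : Function.Injective T := (injective_iff_map_eq_zero T).2 fun u hu => by
    refine (injective_iff_map_eq_zero ι).1 hι u (norm_le_zero_iff.1 ?_)
    have := hT u
    rw [hu, norm_zero] at this
    exact nonpos_of_mul_nonpos_right this hc
  let e := LinearEquiv.ofBijective T ⟨hinj, hsurj⟩
  have hb : ∀ f, ‖(ι ∘ₗ e.symm.toLinearMap) f‖ ≤ c⁻¹ * ‖f‖ := fun f => by
    have := hT (e.symm f)
    rw [show T (e.symm f) = f from e.apply_symm_apply f] at this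
    rwa [inv_mul_eq_div, le_div_iff₀ hc, mul_comm]
  exact ⟨(ι ∘ₗ e.symm.toLinearMap).mkContinuous c⁻¹ hb,
    fun f => ⟨e.symm f, rfl, e.apply_symm_apply f⟩,
    fun u => congrArg ι (e.symm_apply_apply u), hb⟩

variable [CompleteSpace H]

/-- Surjectivity is stable under perturbations that are small relative to the lower bound. -/
theorem surjective_add_smul {ι T : D →ₗ[ℂ] H} (hι : Function.Injective ι) {c : ℝ} (hc : 0 < c)
    (hT : ∀ u, c * ‖ι u‖ ≤ ‖T u‖) (hsurj : Function.Surjective T) (B : H →L[ℂ] H) {t : ℝ}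
    (ht0 : 0 ≤ t) (ht : t * ‖B‖ < c) :
    Function.Surjective fun u => T u + (t : ℂ) • B (ι u) := fun f => by
  obtain ⟨R, hR1, -, hR3⟩ := exists_bounded_inverse hι hc hT hsurj
  have hR : ‖R‖ ≤ c⁻¹ := R.opNorm_le_bound (inv_nonneg.2 hc.le) hR3
  have hN : ‖-((t : ℂ) • B ∘L R)‖ < 1 := by
    rw [norm_neg]
    calc ‖((t : ℂ) • B) ∘L R‖ ≤ ‖(t : ℂ) • B‖ * ‖R‖ := ContinuousLinearMap.opNorm_comp_le _ _
      _ ≤ t * ‖B‖ * c⁻¹ := by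
          rw [norm_smul, Complex.norm_real, Real.norm_eq_abs, abs_of_nonneg ht0]
          gcongr
      _ < 1 := by rwa [← div_eq_mul_inv, div_lt_one hc]
  -- invert `1 + t B R` by the Neumann series
  obtain ⟨U, hU⟩ := isUnit_one_sub_of_norm_lt_one hN
  have hy : (U : H →L[ℂ] H) ((↑U⁻¹ : H →L[ℂ] H) f) = f := by
    rw [← mul_apply_eq_comp, Units.mul_inv, one_apply_eq_self]
  obtain ⟨u, hu1, hu2⟩ := hR1 ((↑U⁻¹ : H →L[ℂ] H) f)
  refine ⟨u, ?_⟩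
  rw [hU] at hy
  simp only [hu1, hu2]
  simpa using hy

/-- The method of continuity. -/
theorem surjective_of_continuity {ι A : D →ₗ[ℂ] H} (hι : Function.Injective ι) {c : ℝ} (hc : 0 < c)
    (B : H →L[ℂ] H)
    (hT : ∀ t : ℝ, 0 ≤ t → t ≤ 1 → ∀ u, c * ‖ι u‖ ≤ ‖A u + (t : ℂ) • B (ι u)‖)
    (hsurj : Function.Surjective A) : Function.Surjective fun u => A u + B (ι u) := by
  obtain ⟨N, hN⟩ := exists_nat_gt (‖B‖ / c)
  have hN0 : (0 : ℝ) < N := lt_of_le_of_lt (by positivity) hN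
  have key : ∀ k : ℕ, k ≤ N →
      Function.Surjective fun u => A u + ((k / N : ℝ) : ℂ) • B (ι u) := by
    intro k
    induction k with
    | zero => intro _; simpa using hsurj
    | succ k ih =>
      intro hk
      have hk' : (k : ℝ) / N ≤ 1 := (div_le_one hN0).2 (by exact_mod_cast (by omega : k ≤ N))
      have := surjective_add_smul (T := A + (((k / N : ℝ) : ℂ) • B.toLinearMap) ∘ₗ ι) hι hc
        (hT _ (by positivity) hk') (ih (by omega)) B (t := 1 / N) (by positivity) (by
          rw [div_lt_iff₀ hc] at hN
          rw [one_div, inv_mul_eq_div, div_lt_iff₀ hN0, mul_comm]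
          exact hN)
      convert this using 2 with u
      simp only [LinearMap.add_apply, LinearMap.comp_apply, LinearMap.smul_apply,
        ContinuousLinearMap.coe_coe, add_assoc, ← add_smul, ← Complex.ofReal_add]
      congr 4
      push_cast
      ring
  have := key N le_rfl
  rw [div_self hN0.ne'] at this
  simpa using this

end Continuation

variable {n : ℕ}

open Filter Topology in
/-- The quadratic form of the Laplacian on `H²(ℝⁿ)` is real and nonpositive. -/
theorem inner_laplacianH2 (u : H2 n) :
    (inner ℂ (u : L2 n) (laplacianH2 n u)).re ≤ 0 ∧
      (inner ℂ (u : L2 n) (laplacianH2 n u)).im = 0 := by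
  obtain ⟨f, h1, h2⟩ := exists_schwartz_tendsto u
  have h3 := h1.inner (𝕜 := ℂ) h2
  constructor
  · refine le_of_tendsto ((Complex.continuous_re.tendsto _).comp h3) (.of_forall fun k => ?_)
    simp only [Function.comp, inner_schwartz_laplacian, Complex.neg_re, Complex.ofReal_re]
    exact neg_nonpos.2 (Finset.sum_nonneg fun _ _ => sq_nonneg _)
  · refine tendsto_nhds_unique ((Complex.continuous_im.tendsto _).comp h3)
      (tendsto_const_nhds.congr fun k => ?_)
    simp only [Function.comp, inner_schwartz_laplacian, Complex.neg_im, Complex.ofReal_im, neg_zero]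

theorem inner_potentialOp_im {V : RSpace n → ℝ} (hV : MemLp V ∞ volume) (u : L2 n) :
    (inner ℂ u (potentialOp V hV u)).im = 0 := by
  rw [L2.inner_def, ← RCLike.im_eq_complex_im, ← integral_im (L2.integrable_inner u _)]
  refine integral_eq_zero_of_ae ?_
  filter_upwards [mulOp_coeFn _ hV.ofReal u] with x hx
  have : (potentialOp V hV u : RSpace n → ℂ) x = V x * u x := hx
  rw [this, RCLike.inner_apply]
  simp
  ring

theorem surjective_sub_laplacianH2 : Function.Surjective fun u : H2 n =>
    (u : L2 n) - ((((2 * Real.pi) ^ 2)⁻¹ : ℝ) : ℂ) • laplacianH2 n u := fun g => by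
  have h2 : MemSobolev 2 2 (besselPotential (RSpace n) ℂ (-2) (g : 𝓢'(RSpace n, ℂ))) := by
    rw [memSobolev_besselPotential_iff, neg_add_cancel, memSobolev_zero_iff]
    exact ⟨g, rfl⟩
  obtain ⟨u, hu⟩ := memSobolev_zero_iff.1 (h2.mono (by norm_num : (0 : ℝ) ≤ 2))
  refine ⟨⟨u, by change MemSobolev 2 2 (u : 𝓢'(RSpace n, ℂ)); rwa [← hu]⟩, ?_⟩
  apply toTemperedDistribution_injective
  rw [toTemperedDistribution_sub_smul, laplacianH2_spec, sub_smul_laplacian]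
  simp only
  rw [← hu, besselPotential_besselPotential_apply]
  simp

/-- The operator `-h² Δ + V + z`, as a linear map on `H²(ℝⁿ)`. -/
def shiftedOp {V : RSpace n → ℝ} (hV : MemLp V ∞ volume) (h : ℝ) (z : ℂ) : H2 n →ₗ[ℂ] L2 n :=
  (shift (schrodinger h V hV) z).toFun

theorem shiftedOp_apply {V : RSpace n → ℝ} (hV : MemLp V ∞ volume) (h : ℝ) (z : ℂ) (u : H2 n) :
    shiftedOp hV h z u = -((h : ℂ) ^ 2 • laplacianH2 n u) +
      potentialOp V hV (u : L2 n) + z • (u : L2 n) := rfl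

end

/-! ### The resolvent -/

section

variable {n : ℕ}

theorem mul_norm_le_of_le_inner {u w : L2 n} {c : ℝ} (h : c * ‖u‖ ^ 2 ≤ ‖(inner ℂ u w : ℂ)‖) :
    c * ‖u‖ ≤ ‖w‖ := by
  rcases (norm_nonneg u).eq_or_lt with h0 | h0
  · rw [← h0, mul_zero]; exact norm_nonneg w
  · refine le_of_mul_le_mul_left ?_ h0
    calc ‖u‖ * (c * ‖u‖) = c * ‖u‖ ^ 2 := by ring
      _ ≤ _ := h.trans (norm_inner_le_norm u w)

theorem inner_self_eq (u : L2 n) : inner ℂ u u = ((‖u‖ ^ 2 : ℝ) : ℂ) := by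
  rw [inner_self_eq_norm_sq_to_K]; push_cast; rfl

section Shift

variable {V : RSpace n → ℝ} (hV : MemLp V ∞ volume) {h E σ ε : ℝ}

/-- The imaginary part of the quadratic form of `P(h) - E + i σ ε` is `σ ε ‖u‖²`. -/
theorem inner_shiftedOp_im (u : H2 n) :
    (inner ℂ (u : L2 n) (shiftedOp hV h (-(E : ℂ) + σ * Complex.I * ε) u)).im =
      σ * ε * ‖(u : L2 n)‖ ^ 2 := by
  rw [shiftedOp_apply, inner_add_right, inner_add_right, inner_neg_right,
    inner_smul_right, inner_smul_right, inner_self_eq, ← Complex.ofReal_pow]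
  simp only [Complex.add_im, Complex.neg_im, Complex.im_ofReal_mul, Complex.im_mul_ofReal,
    (inner_laplacianH2 u).2, inner_potentialOp_im]
  simp

theorem inner_shiftedOp_re (u : H2 n) :
    (inner ℂ (u : L2 n) (shiftedOp hV h (-(E : ℂ) + σ * Complex.I * ε) u)).re =
      -(h ^ 2 * (inner ℂ (u : L2 n) (laplacianH2 n u)).re)
        + (inner ℂ (u : L2 n) (potentialOp V hV u)).re - E * ‖(u : L2 n)‖ ^ 2 := by
  rw [shiftedOp_apply, inner_add_right, inner_add_right, inner_neg_right,
    inner_smul_right, inner_smul_right, inner_self_eq, ← Complex.ofReal_pow]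
  simp only [Complex.add_re, Complex.neg_re, Complex.re_ofReal_mul, Complex.re_mul_ofReal]
  simp
  ring

/-- Surjectivity of `P(h) - E ± i ε`, by continuity from `-h² Δ + b` with `b = (2 π h)²`, which is
`b` times the Bessel potential of order `2`. The real part of the quadratic form bounds the path to
`-h² Δ + b ± i ε` from below, and its imaginary part the path from there to `P(h) - E ± i ε`. -/
theorem surjective_shiftedOp (hh : 0 < h) (hσ : σ ^ 2 = 1) (hε : 0 < ε) :
    Function.Surjective (shiftedOp hV h (-(E : ℂ) + σ * Complex.I * ε)) := by
  set b : ℝ := (2 * Real.pi * h) ^ 2 with hb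
  have hb0 : 0 < b := by positivity
  set ι : H2 n →ₗ[ℂ] L2 n := (H2 n).subtype with hι
  have hιi : Function.Injective ι := Subtype.coe_injective
  set A : H2 n →ₗ[ℂ] L2 n := -((h : ℂ) ^ 2 • laplacianH2 n) + (b : ℂ) • ι with hA
  have hAu : ∀ u, A u = -((h : ℂ) ^ 2 • laplacianH2 n u) + (b : ℂ) • (u : L2 n) := fun u => rfl
  have hAs : Function.Surjective A := fun g => by
    obtain ⟨u, hu⟩ := surjective_sub_laplacianH2 ((b : ℂ)⁻¹ • g)
    refine ⟨u, ?_⟩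
    have hu' : (u : L2 n) = (b : ℂ)⁻¹ • g + ((((2 * Real.pi) ^ 2)⁻¹ : ℝ) : ℂ) • laplacianH2 n u :=
      sub_eq_iff_eq_add.1 hu
    have e : (b : ℂ) * ((((2 * Real.pi) ^ 2)⁻¹ : ℝ) : ℂ) = (h : ℂ) ^ 2 := by
      rw [← Complex.ofReal_mul, ← Complex.ofReal_pow]
      congr 1
      rw [hb]; field_simp
    have hb' : (b : ℂ) ≠ 0 := Complex.ofReal_ne_zero.2 hb0.ne'
    rw [hAu, congrArg (fun y => (b : ℂ) • y) hu', smul_add, smul_smul, smul_smul, e,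
      mul_inv_cancel₀ hb', one_smul]
    abel
  set B₁ : L2 n →L[ℂ] L2 n := (σ * Complex.I * ε : ℂ) • ContinuousLinearMap.id ℂ _ with hB₁
  have h1 : Function.Surjective fun u => A u + B₁ (ι u) := by
    refine surjective_of_continuity hιi hb0 B₁ (fun t _ _ u => ?_) hAs
    refine mul_norm_le_of_le_inner (le_trans ?_ (Complex.abs_re_le_norm _))
    refine le_trans ?_ (le_abs_self _)
    change _ ≤ (inner ℂ (u : L2 n) (A u + (t : ℂ) • ((σ * Complex.I * ε : ℂ) • (u : L2 n)))).re
    rw [hAu, inner_add_right, inner_add_right, inner_neg_right, inner_smul_right,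
      inner_smul_right, inner_smul_right, inner_smul_right, inner_self_eq, ← Complex.ofReal_pow]
    have := mul_nonneg (sq_nonneg h) (neg_nonneg.2 (inner_laplacianH2 u).1)
    simp only [Complex.add_re, Complex.neg_re, Complex.re_ofReal_mul, Complex.re_mul_ofReal,
      Complex.ofReal_re, Complex.I_re]
    change b * ‖(u : L2 n)‖ ^ 2 ≤ _
    linarith
  set A₁ : H2 n →ₗ[ℂ] L2 n := A + B₁.toLinearMap ∘ₗ ι with hA₁
  have h1' : Function.Surjective A₁ := h1
  set B₂ : L2 n →L[ℂ] L2 n := potentialOp V hV - ((E + b : ℝ) : ℂ) • ContinuousLinearMap.id ℂ _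
    with hB₂
  have h2 : Function.Surjective fun u => A₁ u + B₂ (ι u) := by
    refine surjective_of_continuity hιi hε B₂ (fun t _ _ u => ?_) h1'
    refine mul_norm_le_of_le_inner (le_trans (le_of_eq ?_) (Complex.abs_im_le_norm _))
    change ε * ‖(u : L2 n)‖ ^ 2 = |(inner ℂ (u : L2 n) (A u + (σ * Complex.I * ε : ℂ) • (u : L2 n) +
      (t : ℂ) • (potentialOp V hV (u : L2 n) - ((E + b : ℝ) : ℂ) • (u : L2 n)))).im|
    rw [hAu]
    simp only [inner_add_right, inner_neg_right, inner_sub_right, inner_smul_right, inner_self_eq,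
      ← Complex.ofReal_pow]
    simp only [Complex.add_im, Complex.neg_im, Complex.sub_im, Complex.im_ofReal_mul,
      Complex.im_mul_ofReal, (inner_laplacianH2 u).2, inner_potentialOp_im, Complex.ofReal_im,
      Complex.I_im]
    have hσ' : |σ| = 1 := by rw [← Real.sqrt_sq_eq_abs, hσ, Real.sqrt_one]
    simp [abs_mul, hσ', abs_of_pos hε]
  intro g
  obtain ⟨u, hu⟩ := h2 g
  refine ⟨u, ?_⟩
  rw [← hu]
  change shiftedOp hV h (-(E : ℂ) + σ * Complex.I * ε) u =
    -((h : ℂ) ^ 2 • laplacianH2 n u) + (b : ℂ) • (u : L2 n) +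
      (σ * Complex.I * ε : ℂ) • (u : L2 n) + (potentialOp V hV u - ((E + b : ℝ) : ℂ) • (u : L2 n))
  rw [shiftedOp_apply]
  push_cast
  module

theorem exists_isBoundedInverse (hh : 0 < h) (hσ : σ ^ 2 = 1) (hε : 0 < ε) :
    ∃ R : L2 n →L[ℂ] L2 n,
      IsBoundedInverse (shift (schrodinger h V hV) (-(E : ℂ) + σ * Complex.I * ε)) R := by
  have hσ' : |σ| = 1 := by rw [← Real.sqrt_sq_eq_abs, hσ, Real.sqrt_one]
  obtain ⟨R, hR1, hR2, -⟩ := exists_bounded_inverse (ι := (H2 n).subtype)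
    (T := shiftedOp hV h (-(E : ℂ) + σ * Complex.I * ε))
    Subtype.coe_injective hε (fun u => by
      refine mul_norm_le_of_le_inner (le_trans (le_of_eq ?_) (Complex.abs_im_le_norm _))
      change _ = |(inner ℂ (u : L2 n)
        (shiftedOp hV h (-(E : ℂ) + σ * Complex.I * ε) u)).im|
      rw [inner_shiftedOp_im, abs_mul, abs_mul, hσ', one_mul, abs_of_pos hε,
        abs_of_nonneg (sq_nonneg _)]
      rfl) (surjective_shiftedOp hV hh hσ hε)
  exact ⟨R, hR1, hR2⟩

end Shift

end

/-! ### The weighted resolvent bound -/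

section

variable {n : ℕ}

theorem inner_weightOp {s : ℝ} (hs : 0 ≤ s) (u v : L2 n) :
    inner ℂ u (weightOp n s hs v) = inner ℂ (weightOp n s hs u) v := by
  rw [L2.inner_def, L2.inner_def]
  refine integral_congr_ae ?_
  filter_upwards [weightOp_coeFn hs u, weightOp_coeFn hs v] with x h1 h2
  rw [h1, h2, RCLike.inner_apply, RCLike.inner_apply, map_mul, RCLike.conj_eq_re_sub_im]
  simp
  ring

open Filter Topology in
/-- The Carleman estimate on `H²(ℝⁿ)`, by density. The remainder `e` carries the factor `ε⁻¹`, which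
is harmless since it tends to zero along the approximating sequence. -/
theorem carleman_H2 {η h τ lam s E C M : ℝ} (hadm : Admissible n η h τ lam s E C M)
    (hs : 0 ≤ s) {V : RSpace n → ℝ} (hVL : MemLp V ∞ volume)
    (hV : ∀ᵐ x, V x ^ 2 ≤ C ^ 2 / √(1 + ‖x‖ ^ 2) ^ 6)
    {σ ε : ℝ} (hσ : σ ^ 2 = 1) (hε : 0 < ε) (u : H2 n) (g : L2 n)
    (hu : shiftedOp hVL h (-(E : ℂ) + σ * Complex.I * ε) u = weightOp n s hs g) :
    η * E * ‖weightOp n s hs u‖ ^ 2 ≤ M ^ 2 * (3 / (h ^ 3 * lam) * ‖g‖ ^ 2 +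
      ε * ‖(u : L2 n)‖ ^ 2 + ε * (54 / h ^ 4 * (1 + lam ^ 2 / h ^ 2 + n ^ 2)) *
        (-(inner ℂ (u : L2 n) (laplacianH2 n u)).re + ‖(u : L2 n)‖ ^ 2)) := by
  obtain ⟨f, h1, h2⟩ := exists_schwartz_tendsto u
  set e : ℕ → L2 n := fun k => (-((h : ℂ) ^ 2 • schwartzToL2 (Δ (f k))) +
    potentialOp V hVL (schwartzToL2 (f k)) + (-(E : ℂ) + σ * Complex.I * ε) • schwartzToL2 (f k)) -
      weightOp n s hs g with he
  have he0 : Tendsto e atTop (𝓝 0) := by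
    have := ((((h2.const_smul ((h : ℂ) ^ 2)).neg.add
      (((potentialOp V hVL).continuous.tendsto _).comp h1)).add
      (h1.const_smul (-(E : ℂ) + σ * Complex.I * ε))).sub_const (weightOp n s hs g))
    rw [← shiftedOp_apply, hu, sub_self] at this
    exact this
  have hk : ∀ k, η * E * ‖weightOp n s hs (schwartzToL2 (f k))‖ ^ 2 ≤
      M ^ 2 * (3 / (h ^ 3 * lam) * ‖g‖ ^ 2 + ε⁻¹ * ‖e k‖ ^ 2 + ε * ‖schwartzToL2 (f k)‖ ^ 2 +
      ε * (54 / h ^ 4 * (1 + lam ^ 2 / h ^ 2 + n ^ 2)) *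
        (-(inner ℂ (schwartzToL2 (f k)) (schwartzToL2 (Δ (f k)))).re +
          ‖schwartzToL2 (f k)‖ ^ 2)) := fun k => by
    rw [inner_schwartz_laplacian, Complex.neg_re, neg_neg, Complex.ofReal_re]
    refine carleman_schwartz hadm hs hV hσ hε (f k) g (e k) ?_
    filter_upwards [schwartzToL2_coeFn (f k), schwartzToL2_coeFn (Δ (f k)),
      weightOp_coeFn hs g, mulOp_coeFn _ hVL.ofReal (schwartzToL2 (f k)),
      Lp.coeFn_sub (-((h : ℂ) ^ 2 • schwartzToL2 (Δ (f k))) +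
        potentialOp V hVL (schwartzToL2 (f k)) +
        (-(E : ℂ) + σ * Complex.I * ε) • schwartzToL2 (f k)) (weightOp n s hs g),
      Lp.coeFn_add (-((h : ℂ) ^ 2 • schwartzToL2 (Δ (f k))) +
        potentialOp V hVL (schwartzToL2 (f k)))
        ((-(E : ℂ) + σ * Complex.I * ε) • schwartzToL2 (f k)),
      Lp.coeFn_add (-((h : ℂ) ^ 2 • schwartzToL2 (Δ (f k))))
        (potentialOp V hVL (schwartzToL2 (f k))),
      Lp.coeFn_neg ((h : ℂ) ^ 2 • schwartzToL2 (Δ (f k))),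
      Lp.coeFn_smul ((h : ℂ) ^ 2) (schwartzToL2 (Δ (f k))),
      Lp.coeFn_smul (-(E : ℂ) + σ * Complex.I * ε) (schwartzToL2 (f k))]
      with x x1 x2 x3 x4 x5 x6 x7 x8 x9 x10
    have x4' : (potentialOp V hVL (schwartzToL2 (f k)) : RSpace n → ℂ) x = V x * schwartzToL2 (f k) x :=
      x4
    simp only [Pi.add_apply, Pi.sub_apply, Pi.neg_apply, Pi.smul_apply, smul_eq_mul] at x5 x6 x7 x8 x9 x10
    rw [he]
    simp only
    rw [x5, x6, x7, x8, x9, x10, x4', x3, x1, x2]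
    push_cast
    ring
  have hl : Tendsto (fun k => η * E * ‖weightOp n s hs (schwartzToL2 (f k))‖ ^ 2) atTop
      (𝓝 (η * E * ‖weightOp n s hs u‖ ^ 2)) :=
    ((((weightOp n s hs).continuous.tendsto _).comp h1).norm.pow 2).const_mul _
  have hr := ((((he0.norm.pow 2).const_mul ε⁻¹).const_add (3 / (h ^ 3 * lam) * ‖g‖ ^ 2)).add
    ((h1.norm.pow 2).const_mul ε)).add ((((Complex.continuous_re.tendsto _).comp
      (h1.inner (𝕜 := ℂ) h2)).neg.add (h1.norm.pow 2)).const_mul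
      (ε * (54 / h ^ 4 * (1 + lam ^ 2 / h ^ 2 + n ^ 2)))) |>.const_mul (M ^ 2)
  have := le_of_tendsto_of_tendsto' hl hr hk
  simpa using this

theorem le_of_sq_le_add {a g A K L : ℝ} (hg : 0 ≤ g) (hA : 0 < A) (hK : 0 ≤ K)
    (hL : A ≤ L) (h : A * a ^ 2 ≤ K * g ^ 2 + L * (a * g)) : a ≤ (L + K) / A * g := by
  by_contra! hc
  have hLK : 0 < L + K := by linarith
  have h1 : (L + K) * g < A * a := by
    rw [div_mul_eq_mul_div, div_lt_iff₀ hA] at hc; linarith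
  have hga : g ≤ a := by
    by_contra! h2
    nlinarith
  have ha0 : 0 < a := lt_of_le_of_lt (by positivity) hc
  have h2 := mul_lt_mul_of_pos_right h1 ha0
  have h3 := mul_le_mul_of_nonneg_left hga (mul_nonneg hK hg)
  nlinarith

/-- The weighted resolvent bound. The terms of `carleman_H2` with the factor `ε` are removed by
`ε ‖u‖² ≤ ‖⟨x⟩⁻ˢ u‖ ‖g‖`, from the imaginary part of the quadratic form, and by the corresponding
bound for `ε ‖∇u‖²`, from the real part. -/
theorem norm_weighted_resolvent_le {η h τ lam s E C M : ℝ}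
    (hadm : Admissible n η h τ lam s E C M)
    (hs : 0 ≤ s) {V : RSpace n → ℝ} (hVL : MemLp V ∞ volume)
    (hV : ∀ᵐ x, V x ^ 2 ≤ C ^ 2 / √(1 + ‖x‖ ^ 2) ^ 6)
    {σ ε : ℝ} (hσ : σ ^ 2 = 1) (hε : 0 < ε) (hε1 : ε < 1) {R : L2 n →L[ℂ] L2 n}
    (hR : IsBoundedInverse (shift (schrodinger h V hVL) (-(E : ℂ) + σ * Complex.I * ε)) R) :
    ‖weightOp n s hs ∘L R ∘L weightOp n s hs‖ ≤
      (M ^ 2 * (1 + 54 / h ^ 4 * (1 + lam ^ 2 / h ^ 2 + n ^ 2) *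
          ((1 + E + ‖potentialOp V hVL‖) / h ^ 2 + 1)) + η * E + M ^ 2 * (3 / (h ^ 3 * lam))) /
        (η * E) := by
  have hE := hadm.E_pos
  have hη := hadm.η_pos
  have hh := hadm.h_pos
  have hlam := hadm.lam_pos
  refine ContinuousLinearMap.opNorm_le_bound _ (by positivity) fun g => ?_
  obtain ⟨u, hu1, hu2⟩ := hR.1 (weightOp n s hs g)
  change H2 n at u
  change shiftedOp hVL h (-(E : ℂ) + σ * Complex.I * ε) u = weightOp n s hs g at hu2
  have hmain := carleman_H2 hadm hs hVL hV hσ hε u g hu2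
  change ‖weightOp n s hs (R (weightOp n s hs g))‖ ≤ _
  rw [← hu1]
  set a := ‖weightOp n s hs (u : L2 n)‖ with ha
  set G := -(inner ℂ (u : L2 n) (laplacianH2 n u)).re with hG
  set c := 54 / h ^ 4 * (1 + lam ^ 2 / h ^ 2 + (n : ℝ) ^ 2) with hc
  have hc0 : 0 ≤ c := by positivity
  set B := ‖potentialOp V hVL‖ with hB
  have hB0 : 0 ≤ B := norm_nonneg _
  have hin : ‖(inner ℂ (u : L2 n) (shiftedOp hVL h (-(E : ℂ) + σ * Complex.I * ε) u) : ℂ)‖ ≤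
      a * ‖g‖ := by
    rw [hu2, inner_weightOp]; exact norm_inner_le_norm _ _
  have hag : 0 ≤ a * ‖g‖ := (norm_nonneg _).trans hin
  have him : ε * ‖(u : L2 n)‖ ^ 2 ≤ a * ‖g‖ := by
    have := (Complex.abs_im_le_norm _).trans hin
    rwa [inner_shiftedOp_im, abs_mul, abs_mul, ← Real.sqrt_sq_eq_abs σ, hσ, Real.sqrt_one,
      one_mul, abs_of_pos hε, abs_of_nonneg (sq_nonneg _)] at this
  have hre : h ^ 2 * G ≤ a * ‖g‖ + (E + B) * ‖(u : L2 n)‖ ^ 2 := by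
    have h1 := (le_abs_self _).trans ((Complex.abs_re_le_norm _).trans hin)
    rw [inner_shiftedOp_re] at h1
    have h2 : -(inner ℂ (u : L2 n) (potentialOp V hVL u)).re ≤ B * ‖(u : L2 n)‖ ^ 2 := by
      refine (neg_le_abs _).trans ((Complex.abs_re_le_norm _).trans
        ((norm_inner_le_norm _ _).trans ?_))
      have := (potentialOp V hVL).le_opNorm (u : L2 n)
      calc _ ≤ ‖(u : L2 n)‖ * (B * ‖(u : L2 n)‖) := by gcongr
        _ = _ := by ring
    rw [hG]; linarith
  have hGle : ε * G ≤ (1 + E + B) / h ^ 2 * (a * ‖g‖) := by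
    rw [div_mul_eq_mul_div, le_div_iff₀ (by positivity)]
    calc ε * G * h ^ 2 = ε * (h ^ 2 * G) := by ring
      _ ≤ ε * (a * ‖g‖ + (E + B) * ‖(u : L2 n)‖ ^ 2) := by gcongr
      _ = ε * (a * ‖g‖) + (E + B) * (ε * ‖(u : L2 n)‖ ^ 2) := by ring
      _ ≤ 1 * (a * ‖g‖) + (E + B) * (a * ‖g‖) := by gcongr
      _ = _ := by ring
  refine le_of_sq_le_add (norm_nonneg _) (by positivity) (by positivity)
    (le_add_of_nonneg_left (by positivity)) ?_
  refine hmain.trans ?_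
  have h5 : ε * c * (G + ‖(u : L2 n)‖ ^ 2) ≤ c * ((1 + E + B) / h ^ 2 + 1) * (a * ‖g‖) := by
    calc _ = c * (ε * G + ε * ‖(u : L2 n)‖ ^ 2) := by ring
      _ ≤ c * ((1 + E + B) / h ^ 2 * (a * ‖g‖) + a * ‖g‖) := by gcongr
      _ = _ := by ring
  have h6 := mul_le_mul_of_nonneg_left (add_le_add him h5) (sq_nonneg M)
  have h7 : 0 ≤ η * E * (a * ‖g‖) := by positivity
  linarith

end

/-! ### Choice of the parameters -/

theorem sq_le_of_abs_le_bracket {n : ℕ} {v C₀ δ : ℝ} {x : RSpace n} (hδ : 3 < δ)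
    (h : |v| ≤ C₀ * bracket x ^ (-δ)) : v ^ 2 ≤ |C₀| ^ 2 / √(1 + ‖x‖ ^ 2) ^ 6 := by
  have hq : 1 ≤ √(1 + ‖x‖ ^ 2) := Real.one_le_sqrt.2 (by nlinarith [norm_nonneg x])
  have hq0 : 0 < √(1 + ‖x‖ ^ 2) := by linarith
  have h1 : √(1 + ‖x‖ ^ 2) ^ (-δ) ≤ (√(1 + ‖x‖ ^ 2) ^ 3)⁻¹ := by
    rw [← Real.rpow_natCast (√(1 + ‖x‖ ^ 2)) 3, ← Real.rpow_neg hq0.le]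
    exact Real.rpow_le_rpow_of_exponent_le hq (by push_cast; linarith)
  have h2 : |v| ≤ |C₀| * (√(1 + ‖x‖ ^ 2) ^ 3)⁻¹ :=
    h.trans (mul_le_mul (le_abs_self _) h1 (Real.rpow_nonneg hq0.le _) (abs_nonneg _))
  calc v ^ 2 = |v| ^ 2 := (sq_abs v).symm
    _ ≤ (|C₀| * (√(1 + ‖x‖ ^ 2) ^ 3)⁻¹) ^ 2 := pow_le_pow_left₀ (abs_nonneg _) h2 2
    _ = _ := by rw [mul_pow, inv_pow, ← pow_mul, div_eq_mul_inv]

/-- The size of the phase. The choices are written in terms of `k = h ^ (1 / 3)`, so that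
`lam = c h ^ (-1 / 3)` and the bound is of order `h ^ (-4 / 3) log (1 / h)`. -/
theorem phase_div_le {η h lam τ ρ c k : ℝ} (hη : 0 < η) (hk0 : 0 < k) (hk1 : k ≤ 1) (hc : 1 ≤ c)
    (hkc : k * (2 * c) ≤ 1) (hkη : k ≤ Real.exp (-(1 / (3 * η)))) (hh : h = k ^ 3)
    (hlam : lam = c / k) (hτ : τ = k ^ 4 / (2 * c)) (hρ : 0 ≤ ρ) :
    phase η h lam τ ρ / h ≤ c * Real.exp 6 / 2 * (k ^ 4)⁻¹ * Real.log (1 / h) := by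
  have hc0 : 0 < c := by linarith
  have hh0 : 0 < h := by rw [hh]; positivity
  have hh1 : h ≤ 1 := by rw [hh]; exact pow_le_one₀ hk0.le hk1
  have hτ0 : 0 < τ := by rw [hτ]; positivity
  have hlam0 : 0 < lam := by rw [hlam]; positivity
  have hτ1 : τ ≤ 1 := by
    rw [hτ, div_le_one (by positivity)]
    exact (pow_le_one₀ hk0.le hk1).trans (by linarith)
  have hl : 1 / η ≤ Real.log (1 / h) := by
    have h1 := Real.log_le_log hk0 hkη
    rw [Real.log_exp] at h1
    rw [one_div h, Real.log_inv, hh, Real.log_pow]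
    have h2 : 1 / η = 3 * (1 / (3 * η)) := by field_simp
    push_cast
    linarith
  have hl0 : 0 < Real.log (1 / h) := lt_of_lt_of_le (by positivity) hl
  set ℓ := Real.log (1 / h) with hℓ
  have hη' : ℓ⁻¹ ≤ η := by
    rw [inv_le_comm₀ hl0 hη, ← one_div]; exact hl
  have h1 := phase_le (inv_pos.2 hl0) hη' hρ hτ0 hτ1 hh0 (pow_le_one₀ hh0.le hh1) hlam0
  have h2 : (h * τ) ^ (-(2 * ℓ⁻¹)) ≤ Real.exp 6 := by
    have h3 : h ^ 3 ≤ h * τ := by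
      have : k ^ 9 * (2 * c) ≤ k ^ 7 := by
        have h7 : 0 < k ^ 7 := by positivity
        calc k ^ 9 * (2 * c) = k ^ 7 * (k * (k * (2 * c))) := by ring
          _ ≤ k ^ 7 * (1 * 1) := by gcongr
          _ = _ := by ring
      rw [hτ, hh, ← mul_div_assoc, le_div_iff₀ (by positivity)]
      calc _ = k ^ 9 * (2 * c) := by ring
        _ ≤ _ := this
        _ = _ := by ring
    calc (h * τ) ^ (-(2 * ℓ⁻¹)) ≤ (h ^ 3) ^ (-(2 * ℓ⁻¹)) :=
          Real.rpow_le_rpow_of_nonpos (by positivity) h3 (by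
            have := inv_pos.2 hl0; linarith)
      _ = Real.exp 6 := by
          rw [Real.rpow_def_of_pos (by positivity), Real.log_pow]
          congr 1
          have : Real.log h = -ℓ := by rw [hℓ, one_div, Real.log_inv, neg_neg]
          rw [this]
          field_simp
          norm_num
  rw [div_le_iff₀ hh0]
  calc _ ≤ lam / (2 * ℓ⁻¹) * (h * τ) ^ (-(2 * ℓ⁻¹)) := h1
    _ ≤ lam / (2 * ℓ⁻¹) * Real.exp 6 := by gcongr
    _ = _ := by rw [hlam, hh]; field_simp

theorem admissible_of_small {n : ℕ} (hn : 3 ≤ n) {η h lam τ s E C c k : ℝ} (hη : 0 < η)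
    (hη2 : η ≤ 1 / 2) (hs : 1 / 2 + η ≤ s) (hE : 0 < E) (hk0 : 0 < k) (hk1 : k ≤ 1) (hc : 1 ≤ c)
    (hcC : c ^ 3 = 48 * C ^ 2 + 1) (hkc : k * (2 * c) ≤ 1)
    (hkE : k * (9 * n ^ 2 + 8 * c ^ 2 + 26 * c + 6 * C ^ 2) ≤ η * E)
    (hkη : k ≤ Real.exp (-(1 / (3 * η)))) (hh : h = k ^ 3)
    (hlam : lam = c / k) (hτ : τ = k ^ 4 / (2 * c)) :
    Admissible n η h τ lam s E C
      (Real.exp (c * Real.exp 6 / 2 * (k ^ 4)⁻¹ * Real.log (1 / h))) where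
  η_pos := hη
  η_le := hη2
  le_s := hs
  τ_pos := by rw [hτ]; positivity
  τ_le := by
    rw [hτ, div_le_one (by positivity)]
    exact (pow_le_one₀ hk0.le hk1).trans (by linarith)
  h_pos := by rw [hh]; positivity
  h_sq_le := by rw [hh, ← pow_mul]; exact pow_le_one₀ hk0.le hk1
  lam_pos := by rw [hlam]; positivity
  two_mul_lam_mul_τ := by
    have : 0 < c := by linarith
    rw [hlam, hτ, hh]; field_simp
  three_le := hn
  E_pos := hE
  potential_le := by
    rw [hlam, hh, div_pow, div_mul_cancel₀ _ (by positivity), hcC]; linarith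
  error_le := by
    have hc0 : 0 < c := by linarith
    have e : 9 * (n : ℝ) ^ 2 * h ^ 2 + (8 * lam ^ 2 * h ^ 2 + 4 * τ * lam ^ 2) + 24 * h * lam
        + (3 * C ^ 2 / lam ^ 2 + 3 * C ^ 2 * h / lam) =
        k * (9 * n ^ 2 * k ^ 5 + 8 * c ^ 2 * k ^ 3 + 26 * c * k + 3 * C ^ 2 * (k / c ^ 2) +
          3 * C ^ 2 * (k ^ 3 / c)) := by
      rw [hlam, hτ, hh]; field_simp; ring
    have h1 : k / c ^ 2 ≤ 1 := (div_le_one (by positivity)).2 (hk1.trans (one_le_pow₀ hc))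
    have h2 : k ^ 3 / c ≤ 1 := (div_le_one hc0).2 ((pow_le_one₀ hk0.le hk1).trans hc)
    have h3 : k ^ 3 ≤ 1 := pow_le_one₀ hk0.le hk1
    have h5 : k ^ 5 ≤ 1 := pow_le_one₀ hk0.le hk1
    rw [e]
    refine le_trans ?_ hkE
    calc _ ≤ k * (9 * n ^ 2 * 1 + 8 * c ^ 2 * 1 + 26 * c * 1 + 3 * C ^ 2 * 1 + 3 * C ^ 2 * 1) := by
          gcongr
      _ = _ := by ring
  exp_phase_le ρ hρ := Real.exp_le_exp.2 (phase_div_le hη hk0 hk1 hc hkc hkη hh hlam hτ hρ)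

/-- Up to the square of the exponential weight, the constant in `norm_weighted_resolvent_le` grows
polynomially in `1 / h`. -/
theorem resolvent_const_le {N η E B c k h lam M : ℝ} (hη : 0 < η) (hE : 0 < E) (hB : 0 ≤ B)
    (hk0 : 0 < k) (hk1 : k ≤ 1) (hc : 1 ≤ c) (hh : h = k ^ 3) (hlam : lam = c / k) (hM : 1 ≤ M) :
    (M ^ 2 * (1 + 54 / h ^ 4 * (1 + lam ^ 2 / h ^ 2 + N ^ 2) * ((1 + E + B) / h ^ 2 + 1)) +
      η * E + M ^ 2 * (3 / (h ^ 3 * lam))) / (η * E) ≤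
    M ^ 2 * (k ^ 26)⁻¹ * ((4 + 54 * (1 + c ^ 2 + N ^ 2) * (2 + E + B) + η * E) / (η * E)) := by
  have hc0 : 0 < c := by linarith
  have hkp : ∀ m : ℕ, 1 ≤ (k ^ m)⁻¹ := fun m => one_le_inv_iff₀.2
    ⟨by positivity, pow_le_one₀ hk0.le hk1⟩
  have h1 : 1 + lam ^ 2 / h ^ 2 + N ^ 2 ≤ (1 + c ^ 2 + N ^ 2) * (k ^ 8)⁻¹ := by
    have e : lam ^ 2 / h ^ 2 = c ^ 2 * (k ^ 8)⁻¹ := by rw [hlam, hh]; field_simp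
    have := mul_le_mul_of_nonneg_left (hkp 8) (by positivity : 0 ≤ 1 + N ^ 2)
    rw [e]; linarith
  have h2 : (1 + E + B) / h ^ 2 + 1 ≤ (2 + E + B) * (k ^ 6)⁻¹ := by
    have e : (1 + E + B) / h ^ 2 = (1 + E + B) * (k ^ 6)⁻¹ := by rw [hh]; field_simp
    rw [e]; linarith [hkp 6]
  have h3 : 3 / (h ^ 3 * lam) ≤ 3 * (k ^ 26)⁻¹ := by
    have e : 3 / (h ^ 3 * lam) = 3 * (k ^ 8)⁻¹ / c := by rw [hlam, hh]; field_simp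
    rw [e]
    refine (div_le_self (by positivity) hc).trans ?_
    have : k ^ 26 ≤ k ^ 8 := pow_le_pow_of_le_one hk0.le hk1 (by norm_num)
    gcongr
  have h4 : 1 + 54 / h ^ 4 * (1 + lam ^ 2 / h ^ 2 + N ^ 2) * ((1 + E + B) / h ^ 2 + 1) ≤
      (1 + 54 * (1 + c ^ 2 + N ^ 2) * (2 + E + B)) * (k ^ 26)⁻¹ := by
    have h0 : 0 < h := by rw [hh]; positivity
    calc _ ≤ (k ^ 26)⁻¹ + 54 / h ^ 4 * ((1 + c ^ 2 + N ^ 2) * (k ^ 8)⁻¹) *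
          ((2 + E + B) * (k ^ 6)⁻¹) := by
          gcongr
          exact hkp 26
      _ = _ := by rw [hh]; field_simp
  have hM2 : 1 ≤ M ^ 2 := one_le_pow₀ hM
  rw [← mul_div_assoc (M ^ 2 * (k ^ 26)⁻¹)]
  refine div_le_div_of_nonneg_right ?_ (by positivity)
  calc _ ≤ M ^ 2 * ((1 + 54 * (1 + c ^ 2 + N ^ 2) * (2 + E + B)) * (k ^ 26)⁻¹) +
        η * E * (M ^ 2 * (k ^ 26)⁻¹) + M ^ 2 * (3 * (k ^ 26)⁻¹) := by
        have h5 : η * E ≤ η * E * (M ^ 2 * (k ^ 26)⁻¹) :=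
          le_mul_of_one_le_right (by positivity) (one_le_mul_of_one_le_of_one_le hM2 (hkp 26))
        exact add_le_add (add_le_add (mul_le_mul_of_nonneg_left h4 (by positivity)) h5)
          (mul_le_mul_of_nonneg_left h3 (by positivity))
    _ = _ := by ring

end SemiclassicalResolvent

end

theorem theorem1p1 (n : ℕ) (hn : 3 ≤ n)
    (V : SemiclassicalResolvent.RSpace n → ℝ) (hV : MemLp V ∞ volume)
    (C₀ δ : ℝ) (hδ : 3 < δ)
    (hdecay : ∀ᵐ x, |V x| ≤ C₀ * SemiclassicalResolvent.bracket x ^ (-δ))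
    (E : ℝ) (hE : 0 < E) (s : ℝ) (hs : 1 / 2 < s) :
    ∃ C > 0, ∃ h₀ > 0, ∀ h : ℝ, 0 < h → h ≤ h₀ → ∀ ε : ℝ, 0 < ε → ε < 1 →
      ∀ σ : ℝ, σ = 1 ∨ σ = -1 →
        ∃ R : SemiclassicalResolvent.L2 n →L[ℂ] SemiclassicalResolvent.L2 n,
          SemiclassicalResolvent.IsBoundedInverse
            (SemiclassicalResolvent.shift (SemiclassicalResolvent.schrodinger h V hV)
              (-(E : ℂ) + (σ : ℂ) * Complex.I * (ε : ℂ))) R ∧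
          Real.log ‖SemiclassicalResolvent.weightOp n s (one_half_pos.trans hs).le ∘L R ∘L
              SemiclassicalResolvent.weightOp n s (one_half_pos.trans hs).le‖ ≤
            C * h ^ (-(4 / 3 : ℝ)) * Real.log (1 / h) := by
  open SemiclassicalResolvent in
  set η : ℝ := min s 1 - 1 / 2 with hη
  have hη0 : 0 < η := sub_pos.2 (lt_min hs (by norm_num))
  have hη2 : η ≤ 1 / 2 := by have := min_le_right s 1; rw [hη]; linarith
  have hηs : 1 / 2 + η ≤ s := by have := min_le_left s 1; rw [hη]; linarith
  set c : ℝ := (48 * |C₀| ^ 2 + 1) ^ (1 / 3 : ℝ) with hc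
  have hc1 : 1 ≤ c := Real.one_le_rpow (by linarith [sq_nonneg |C₀|]) (by norm_num)
  have hc3 : c ^ 3 = 48 * |C₀| ^ 2 + 1 := by
    rw [hc, ← Real.rpow_natCast, ← Real.rpow_mul (by positivity)]; norm_num
  set D : ℝ := 9 * n ^ 2 + 8 * c ^ 2 + 26 * c + 6 * |C₀| ^ 2 with hD
  have hD0 : 0 < D := by positivity
  set B : ℝ := ‖potentialOp V hV‖ with hB
  have hB0 : 0 ≤ B := norm_nonneg _
  set K : ℝ := (4 + 54 * (1 + c ^ 2 + (n : ℝ) ^ 2) * (2 + E + B) + η * E) / (η * E) with hK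
  have hK0 : 0 < K := by positivity
  set k₀ : ℝ := min (η * E / D) (min (1 / (2 * c)) (Real.exp (-(1 / (3 * η))))) with hk₀
  have hk₀0 : 0 < k₀ := by positivity
  refine ⟨c * Real.exp 6 + 26 / 3 + |Real.log K|, by positivity, k₀ ^ 3, by positivity,
    fun h hh0 hh ε hε hε1 σ hσ => ?_⟩
  have hσ2 : σ ^ 2 = 1 := by rcases hσ with rfl | rfl <;> norm_num
  obtain ⟨R, hR⟩ := exists_isBoundedInverse hV (E := E) hh0 hσ2 hε
  refine ⟨R, hR, ?_⟩
  set k : ℝ := h ^ (1 / 3 : ℝ) with hk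
  have hk0 : 0 < k := by positivity
  have hk3 : h = k ^ 3 := by
    rw [hk, ← Real.rpow_natCast, ← Real.rpow_mul hh0.le]; norm_num
  have hkk : k ≤ k₀ := by
    rw [hk3] at hh; exact le_of_pow_le_pow_left₀ (by norm_num) hk₀0.le hh
  have hkE : k * D ≤ η * E := (le_div_iff₀ hD0).1 (hkk.trans (min_le_left _ _))
  have hkc : k * (2 * c) ≤ 1 := (le_div_iff₀ (by positivity)).1
    (hkk.trans ((min_le_right _ _).trans (min_le_left _ _)))
  have hkη : k ≤ Real.exp (-(1 / (3 * η))) :=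
    hkk.trans ((min_le_right _ _).trans (min_le_right _ _))
  have hk1 : k ≤ 1 := by nlinarith
  have hadm := admissible_of_small hn hη0 hη2 hηs hE hk0 hk1 hc1 hc3 hkc hkE hkη hk3 rfl rfl
  have hk4 : h ^ (-(4 / 3 : ℝ)) = (k ^ 4)⁻¹ := by
    rw [hk, ← Real.rpow_natCast, ← Real.rpow_mul hh0.le, ← Real.rpow_neg hh0.le]; norm_num
  set ℓ := Real.log (1 / h) with hℓ
  have hlk : ℓ = 3 * -Real.log k := by
    rw [hℓ, one_div, Real.log_inv, hk3, Real.log_pow]; push_cast; ring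
  have hℓ1 : 1 ≤ ℓ := by
    have h1 := Real.log_le_log hk0 hkη
    rw [Real.log_exp] at h1
    have h2 : 1 / 3 ≤ 1 / (3 * η) := by gcongr; linarith
    rw [hlk]; linarith
  have hk4' : 1 ≤ (k ^ 4)⁻¹ := one_le_inv_iff₀.2 ⟨by positivity, pow_le_one₀ hk0.le hk1⟩
  set M := Real.exp (c * Real.exp 6 / 2 * (k ^ 4)⁻¹ * ℓ) with hM
  have hM1 : 1 ≤ M := Real.one_le_exp (by positivity)
  have hbound := (norm_weighted_resolvent_le hadm (one_half_pos.trans hs).le hV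
    (hdecay.mono fun x hx => sq_le_of_abs_le_bracket hδ hx) hσ2 hε hε1 hR).trans
    (resolvent_const_le (N := (n : ℝ)) hη0 hE hB0 hk0 hk1 hc1 hk3 rfl hM1)
  rw [hk4]
  rcases (norm_nonneg (weightOp n s (one_half_pos.trans hs).le ∘L R ∘L
    weightOp n s (one_half_pos.trans hs).le)).eq_or_lt with h0 | h0
  · rw [← h0, Real.log_zero]; positivity
  refine (Real.log_le_log h0 hbound).trans ?_
  rw [← hK, Real.log_mul (by positivity) hK0.ne', Real.log_mul (by positivity) (by positivity),
    Real.log_pow, Real.log_inv, Real.log_pow, hM, Real.log_exp]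
  have h1 : ℓ ≤ (k ^ 4)⁻¹ * ℓ := le_mul_of_one_le_left (by linarith) hk4'
  have h2 : |Real.log K| ≤ |Real.log K| * ((k ^ 4)⁻¹ * ℓ) :=
    le_mul_of_one_le_right (abs_nonneg _) (hℓ1.trans h1)
  have h3 := le_abs_self (Real.log K)
  push_cast
  have h4 : -Real.log k = ℓ / 3 := by linarith
  calc _ = c * Real.exp 6 * ((k ^ 4)⁻¹ * ℓ) + 26 * -Real.log k + Real.log K := by ring
    _ ≤ c * Real.exp 6 * ((k ^ 4)⁻¹ * ℓ) + 26 / 3 * ((k ^ 4)⁻¹ * ℓ) +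
        |Real.log K| * ((k ^ 4)⁻¹ * ℓ) := by rw [h4]; linarith
    _ = _ := by ring
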